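/- \textbf{Setting.} Let $S_f$ be a finite set of odd primes, $S=S_f\cup\{\infty\}$, $\mathbb Q_\infty=\mathbb R$, $\mathbb Q_S=\prod_{p\in S}\mathbb Q_p$, and $\mathbb Z_S=\{m\prod_{p\in S_f}p^{e_p}: m,e_p\in\mathbb Z\}$, embedded diagonally in $\mathbb Q_S$. Let $n\in\{3,4\}$. Let $\|\cdot\|_\infty$ be the Euclidean norm on $\mathbb R^n$ and $\|\cdot\|_p$ the maximum norm on $\mathbb Q_p^n$, and put $\sigma(\infty)=1$, $\sigma(p)=-1$ for $p<\infty$. For $p<\infty$ a power $\|v\|_p^{\pm1}$ of $p$ is regarded as an element of $\mathbb Q_p$, so that $v/\|v\|_p^{\sigma}=\|v\|_p\,v$ is a unit vector. For each $p\in S$ let $$q^0_p(x)=2x_1x_n+\sum_{i=2}^{n-1}a_{i,p}\,x_i^2$$ be a standard isotropic form of rank $n$, where $a_{i,\infty}\in\{\pm1\}$ and $a_{i,p}\in\{\pm1,\pm u_p,\pm p,\pm pu_p\}$ for $p<\infty$, with $u_p$ a fixed integer that is not a square modulo $p$. If $n=4$, $p<\infty$ and $-a_{2,p}a_{3,p}$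 is a square in $\mathbb Q_p$ (that is, if $q^0_p$ is split), assume that $a_{2,p},a_{3,p}$ are not both divisible by $p$. Let $\mathsf K=K_\infty\times\prod_{p\in S_f}K_p$ with $K_\infty=\mathrm{SO}(q^0_\infty)\cap \mathrm{SO}(n)$ and $K_p=\mathrm{SO}(q^0_p)\cap\mathrm{SL}_n(\mathbb Z_p)$, and let $m$ be the normalized Haar measure of $\mathsf K$. For $\mathsf t=(t_p)_{p\in S}$ with $t_\infty\in\mathbb R$ and $t_p\in\mathbb Z$ for $p<\infty$, let $\mathsf a_{\mathsf t}$ have the components $\mathrm{diag}(e^{-t_\infty},1,\dots,1,e^{t_\infty})$ and $\mathrm{diag}(p^{t_p},1,\dots,1,p^{-t_p})$; put $T_\infty=e^{t_\infty}$, $T_p=p^{t_p}$ and $|\mathsf T|=\prod_{p\in S}T_p$. Write $\mathsf t\succ\mathsf t_0$ if $t_p>t_{0,p}$ for all $p\in S$. For a compactly supported function $f$ on $\mathbb Q_S^n$ and $\mathsf h\in\mathrm{SL}_n(\mathbb Q_S)$ let $\tilde f(\mathsf h)=\sum_{\mathbf v\in\mathbb Z_S^n}f(\mathsf h\mathbf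 v)$ be the Siegel transform, which depends only on $\mathsf h\Gamma$, $\Gamma=\mathrm{SL}_n(\mathbb Z_S)$. \textbf{Test functions.} Let $f=\prod_{p\in S}f_p$, where $f_p:\mathbb Q_p^n\to\mathbb R$ is continuous with compact support contained in $\{x_1>0\}$ if $p=\infty$ and in $\{x_1\ne0\}$ if $p<\infty$, and, for $p<\infty$, $f_p(ux_1,x_2,\dots,x_{n-1},u^{-1}x_n)=f_p(x)$ for all $u\in\mathbb Z_p^\times$. Let $\nu=\prod_{p\in S}\nu_p$, where $\nu_p$ is a non-negative continuous function on the unit sphere of $\mathbb Q_p^n$ and, for $p<\infty$, $\nu_p(uv)=\nu_p(v)$ for all $u\in\mathbb Z_p^\times$. Put $J_f=\prod_{p\in S}J_{f_p}$, where $$J_{f_\infty}(r,\zeta)=\frac1{r^{n-2}}\int_{\mathbb R^{n-2}}f_\infty(r,x_2,\dots,x_n)\,dx_2\cdots dx_{n-1},\qquad J_{f_p}(p^{-r},\zeta)=\frac1{p^{r(n-2)}}\int_{\mathbb Q_p^{n-2}}f_p(p^{-r},x_2,\dots,x_n)\,dx_2\cdots dx_{n-1},$$ $x_n$ being determined by $q^0_\infty(r,x_2,\dots,x_n)=\zeta$,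 respectively $q^0_p(p^{-r},x_2,\dots,x_n)=\zeta$, and the Haar measure of $\mathbb Q_p$ being normalized by $\mathbb Z_p$ having measure $1$. The term $\mathbf v=0$ in the sum below is understood to be $0$. \textbf{Proposition.} There is a constant $c(\mathsf K)>0$, depending only on the standard form $(q^0_p)_{p\in S}$ (and so on $S$, $n$ and $\mathsf K$), with the following property. Let $\mathsf g\in\mathrm{SL}_n(\mathbb Q_S)$ and let $\mathsf q_S=(q_p)_{p\in S}$ be the isotropic quadratic form $\mathsf q_S(\mathbf v)=\mathsf q^0_S(\mathsf g\mathbf v)$ of rank $n$. Let $f,\nu$ be as above, and suppose that there is a non-negative continuous function $f^+$ of compact support on $\mathbb Q_S^n$ that is positive on $\operatorname{supp}(f)$ (so that $\operatorname{supp}(f)\subset\operatorname{supp}(f^+)^\circ$) and satisfies $$\sup_{\mathsf t\succ0}\int_{\mathsf K}\widetilde{f^+}(\mathsf a_{\mathsf t}\mathsf k\mathsf g)\,dm(\mathsf k)<\infty.$$ Then for every $\epsilon>0$ there is $\mathsf t_0\succ0$ such that for all $\mathsf t\succ\mathsf t_0$ the sum below converges, the integrand below is integrable, and $$\left||\mathsf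 T|^{-(n-2)}\sum_{\mathbf v\in\mathbb Z_S^n}J_f\!\left(\frac{\|\mathsf g\mathbf v\|^\sigma}{\mathsf T^\sigma},\mathsf q_S(\mathbf v)\right)\nu\!\left(\frac{\mathsf g\mathbf v}{\|\mathsf g\mathbf v\|^\sigma}\right)-c(\mathsf K)\int_{\mathsf K}\tilde f(\mathsf a_{\mathsf t}\mathsf k\mathsf g)\,\nu(\mathsf k^{-1}e_1)\,dm(\mathsf k)\right|\le\epsilon .$$ -/

import Mathlib

open MeasureTheory

noncomputable section

/-! ### Quadratic forms, special linear groups, maximal compact subgroups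

Throughout, the rank is `n = d + 2`; a vector has coordinates `x 0 = x_1`,
`x (Fin.last _) = x_n`, and the middle ones `x i.succ.castSucc`, `i : Fin d`. -/

/-- The form `2 x_1 x_n + ∑ a_i x_i ^ 2`, the sum being over the `d = n - 2` middle coordinates. -/
def stdForm {F : Type*} [Field F] {d : ℕ} (a : Fin d → F) (x : Fin (d + 2) → F) : F :=
  2 * x 0 * x (Fin.last (d + 1)) + ∑ i : Fin d, a i * x i.succ.castSucc ^ 2

/-- `SO(q⁰)` for `q⁰ = stdForm a`. -/
def stdSO {F : Type*} [Field F] {d : ℕ} (a : Fin d → F) :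
    Subgroup (Matrix.SpecialLinearGroup (Fin (d + 2)) F) where
  carrier := {k | ∀ x : Fin (d + 2) → F, stdForm a (k.1.mulVec x) = stdForm a x}
  one_mem' := by intro x; simp
  mul_mem' := by
    intro k l hk hl x
    have h := hk (l.1.mulVec x)
    rw [Matrix.mulVec_mulVec] at h
    rw [Matrix.SpecialLinearGroup.coe_mul, h, hl x]
  inv_mem' := by
    intro k hk x
    have h := hk ((k⁻¹).1.mulVec x)
    rw [Matrix.mulVec_mulVec, ← Matrix.SpecialLinearGroup.coe_mul, mul_inv_cancel,
      Matrix.SpecialLinearGroup.coe_one, Matrix.one_mulVec] at h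
    exact h.symm

/-- `SO(n) ⊆ SL_n(ℝ)`. -/
def realSO (n : ℕ) : Subgroup (Matrix.SpecialLinearGroup (Fin n) ℝ) where
  carrier := {k | k.1 * k.1.transpose = 1}
  one_mem' := by simp
  mul_mem' := by
    intro k l hk hl
    simp only [Set.mem_ofPred_eq] at hk hl ⊢
    rw [Matrix.SpecialLinearGroup.coe_mul, Matrix.transpose_mul, Matrix.mul_assoc,
      ← Matrix.mul_assoc l.1, hl, Matrix.one_mul, hk]
  inv_mem' := by
    intro k hk
    simp only [Set.mem_ofPred_eq] at hk ⊢
    have h1 : (k⁻¹).1 * k.1 = 1 := by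
      rw [← Matrix.SpecialLinearGroup.coe_mul, inv_mul_cancel, Matrix.SpecialLinearGroup.coe_one]
    have h2 : (k⁻¹).1 = k.1.transpose := by
      calc (k⁻¹).1 = (k⁻¹).1 * (k.1 * k.1.transpose) := by rw [hk, Matrix.mul_one]
        _ = k.1.transpose := by rw [← Matrix.mul_assoc, h1, Matrix.one_mul]
    rw [h2, Matrix.transpose_transpose, ← h2, h1]

/-- `K_∞ = SO(q⁰_∞) ∩ SO(n)`. -/
def realK {d : ℕ} (a : Fin d → ℝ) : Subgroup (Matrix.SpecialLinearGroup (Fin (d + 2)) ℝ) :=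
  stdSO a ⊓ realSO (d + 2)

/-- `K_p = SO(q⁰_p) ∩ SL_n(ℤ_p)`. -/
def padicK {d : ℕ} (p : ℕ) [Fact p.Prime] (a : Fin d → ℚ_[p]) :
    Subgroup (Matrix.SpecialLinearGroup (Fin (d + 2)) ℚ_[p]) :=
  stdSO a ⊓ (Matrix.SpecialLinearGroup.map (PadicInt.Coe.ringHom (p := p))).range

/-- The matrix `diag(u, 1, …, 1, u⁻¹)` of size `d + 2`. -/
def diagSL {F : Type*} [Field F] (d : ℕ) (u : F) (hu : u ≠ 0) :
    Matrix.SpecialLinearGroup (Fin (d + 2)) F :=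
  ⟨Matrix.diagonal (Fin.cons u (Fin.snoc (fun _ : Fin d => (1 : F)) u⁻¹ : Fin (d + 1) → F)), by
    rw [Matrix.det_diagonal, Fin.prod_univ_succ, Fin.prod_univ_castSucc]
    simp [hu]⟩

/-- The values `±1, ±u₀, ±p, ±p u₀` that a coefficient of a standard `p`-adic form may take. -/
def IsStdPadicCoeff (p : ℕ) [Fact p.Prime] (u₀ : ℤ) (a : ℚ_[p]) : Prop :=
  ∃ s ∈ ({1, (u₀ : ℚ_[p]), (p : ℚ_[p]), (p : ℚ_[p]) * (u₀ : ℚ_[p])} : Set ℚ_[p]), a = s ∨ a = -s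

/-! ### Measures and norms -/

instance padicMeasurableSpace (p : ℕ) [Fact p.Prime] : MeasurableSpace ℚ_[p] := borel _

instance padicBorelSpace (p : ℕ) [Fact p.Prime] : BorelSpace ℚ_[p] := ⟨rfl⟩

/-- The Haar measure on `ℚ_p` that gives `ℤ_p` (the closed unit ball) mass one. -/
def padicHaar (p : ℕ) [Fact p.Prime] : Measure ℚ_[p] :=
  Measure.addHaarMeasure
    ⟨⟨Metric.closedBall 0 1, isCompact_closedBall 0 1⟩,
      ⟨0, Metric.ball_subset_interior_closedBall (Metric.mem_ball_self one_pos)⟩⟩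

/-- The Euclidean norm. -/
def euclNorm {n : ℕ} (x : Fin n → ℝ) : ℝ := Real.sqrt (∑ i, x i ^ 2)

/-- The integer `m` with `‖x‖_p = p ^ m`, for a nonzero vector `x` (see `norm_eq_zpow_padicExp`);
the norm on `Fin n → ℚ_[p]` is the maximum norm. -/
def padicExp (p : ℕ) [Fact p.Prime] {n : ℕ} (x : Fin n → ℚ_[p]) : ℤ := Int.log p ‖x‖

theorem norm_eq_zpow_padicExp (p : ℕ) [hp : Fact p.Prime] {n : ℕ} (x : Fin n → ℚ_[p])
    (hx : x ≠ 0) : ‖x‖ = (p : ℝ) ^ padicExp p x := by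
  have hne : Nonempty (Fin n) := by
    by_contra h
    rw [not_nonempty_iff] at h
    exact hx (Subsingleton.elim _ _)
  obtain ⟨i, hi⟩ := Finite.exists_max (fun i => ‖x i‖)
  have hxi : ‖x‖ = ‖x i‖ :=
    le_antisymm ((pi_norm_le_iff_of_nonneg (norm_nonneg _)).2 hi) (norm_le_pi_norm x i)
  have hxi0 : x i ≠ 0 := by
    intro h0
    rw [h0, norm_zero, norm_eq_zero] at hxi
    exact hx hxi
  have h : ‖x‖ = (p : ℝ) ^ (-(x i).valuation) := by rw [hxi, Padic.norm_eq_zpow_neg_valuation hxi0]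
  rw [padicExp, h, Int.log_zpow hp.out.one_lt]

/-! ### The functions `J_f` -/

/-- The point `(r, y_1, …, y_d, x_n)` where `x_n` solves `q⁰(r, y, x_n) = ζ` (for `r ≠ 0`). -/
def levelPoint {F : Type*} [Field F] {d : ℕ} (a : Fin d → F) (r ζ : F) (y : Fin d → F) :
    Fin (d + 2) → F :=
  Fin.cons r (Fin.snoc y ((ζ - ∑ i, a i * y i ^ 2) / (2 * r)) : Fin (d + 1) → F)

theorem stdForm_levelPoint {F : Type*} [Field F] [CharZero F] {d : ℕ} (a : Fin d → F) (r ζ : F)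
    (hr : r ≠ 0) (y : Fin d → F) : stdForm a (levelPoint a r ζ y) = ζ := by
  have hlast : (Fin.last (d + 1)) = (Fin.last d).succ := rfl
  have hmid : ∀ i : Fin d, i.succ.castSucc = i.castSucc.succ := fun i => rfl
  simp only [stdForm, levelPoint, hlast, hmid, Fin.cons_zero, Fin.cons_succ, Fin.snoc_last,
    Fin.snoc_castSucc]
  field_simp
  ring

/-- `J_f(r, ζ) = r^{-(n-2)} ∫_{ℝ^{n-2}} f(r, x_2, …, x_n) dx_2 ⋯ dx_{n-1}`. -/
def realJ {d : ℕ} (a : Fin d → ℝ) (f : (Fin (d + 2) → ℝ) → ℝ) (r ζ : ℝ) : ℝ :=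
  (1 / r ^ d) * ∫ y : Fin d → ℝ, f (levelPoint a r ζ y)

/-- `J_f(p^{-r}, ζ) = p^{-r(n-2)} ∫_{ℚ_p^{n-2}} f(p^{-r}, x_2, …, x_n) dx_2 ⋯ dx_{n-1}`;
here `w` stands for `p^{-r}`, so that `‖w‖ = p^r`. -/
def padicJ {d : ℕ} (p : ℕ) [Fact p.Prime] (a : Fin d → ℚ_[p]) (f : (Fin (d + 2) → ℚ_[p]) → ℝ)
    (w ζ : ℚ_[p]) : ℝ :=
  (1 / ‖w‖ ^ d) *
    ∫ y : Fin d → ℚ_[p], f (levelPoint a w ζ y) ∂(Measure.pi fun _ => padicHaar p)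

/-! ### The `S`-arithmetic objects; `S = {∞} ∪ Sf` -/

/-- `ℚ_S^n`. -/
abbrev SSpace (Sf : Finset ℕ) [∀ p : Sf, Fact (p : ℕ).Prime] (n : ℕ) : Type :=
  (Fin n → ℝ) × (∀ p : Sf, Fin n → ℚ_[(p : ℕ)])

/-- `SL_n(ℚ_S)`. -/
abbrev SGroup (Sf : Finset ℕ) [∀ p : Sf, Fact (p : ℕ).Prime] (n : ℕ) : Type :=
  Matrix.SpecialLinearGroup (Fin n) ℝ ×
    (∀ p : Sf, Matrix.SpecialLinearGroup (Fin n) ℚ_[(p : ℕ)])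

/-- The linear action of `SL_n(ℚ_S)` on `ℚ_S^n`. -/
def sAct {Sf : Finset ℕ} [∀ p : Sf, Fact (p : ℕ).Prime] {n : ℕ} (g : SGroup Sf n)
    (v : SSpace Sf n) : SSpace Sf n :=
  (g.1.1.mulVec v.1, fun p => (g.2 p).1.mulVec (v.2 p))

/-- `K = K_∞ × ∏ K_p`. -/
def sK {Sf : Finset ℕ} [∀ p : Sf, Fact (p : ℕ).Prime] {d : ℕ} (a : Fin d → ℝ)
    (b : ∀ p : Sf, Fin d → ℚ_[(p : ℕ)]) : Subgroup (SGroup Sf (d + 2)) :=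
  (realK a).prod (Subgroup.pi Set.univ fun p : Sf => padicK (p : ℕ) (b p))

/-- `a_t`, with components `diag(e^{-t_∞}, 1, …, 1, e^{t_∞})` and `diag(p^{t_p}, 1, …, 1, p^{-t_p})`. -/
def sDiag (Sf : Finset ℕ) [hS : ∀ p : Sf, Fact (p : ℕ).Prime] (d : ℕ) (t : ℝ × (Sf → ℤ)) :
    SGroup Sf (d + 2) :=
  (diagSL d (Real.exp (-t.1)) (Real.exp_ne_zero _),
    fun p => diagSL d (((p : ℕ) : ℚ_[(p : ℕ)]) ^ t.2 p)
      (zpow_ne_zero _ (Nat.cast_ne_zero.2 (hS p).out.ne_zero)))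

/-- `|T| = ∏ T_p`, with `T_∞ = e^{t_∞}` and `T_p = p^{t_p}`. -/
def sVol (Sf : Finset ℕ) (t : ℝ × (Sf → ℤ)) : ℝ :=
  Real.exp t.1 * ∏ p : Sf, ((p : ℕ) : ℝ) ^ t.2 p

/-- `ℤ_S = {m p_1^{n_1} ⋯ p_s^{n_s} : m, n_1, …, n_s ∈ ℤ}`. -/
def zS (Sf : Finset ℕ) : Set ℚ :=
  {x | ∃ (m : ℤ) (e : Sf → ℤ), x = m * ∏ p : Sf, ((p : ℕ) : ℚ) ^ e p}

/-- `ℤ_S^n`. -/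
abbrev SLattice (Sf : Finset ℕ) (n : ℕ) : Type := Fin n → zS Sf

/-- The diagonal embedding of `ℤ_S^n` into `ℚ_S^n`. -/
def sEmb {Sf : Finset ℕ} [∀ p : Sf, Fact (p : ℕ).Prime] {n : ℕ} (v : SLattice Sf n) :
    SSpace Sf n :=
  (fun i => ((v i : ℚ) : ℝ), fun p i => ((v i : ℚ) : ℚ_[(p : ℕ)]))

/-- The Siegel transform of `f` at `h SL_n(ℤ_S)`: the sum of `f` over the lattice `h ℤ_S^n`. -/
def siegel {Sf : Finset ℕ} [∀ p : Sf, Fact (p : ℕ).Prime] {n : ℕ} (f : SSpace Sf n → ℝ)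
    (h : SGroup Sf n) : ℝ :=
  ∑' v : SLattice Sf n, f (sAct h (sEmb v))

/-- The product function `∏ f_p` on `ℚ_S^n`. -/
def sProd {Sf : Finset ℕ} [∀ p : Sf, Fact (p : ℕ).Prime] {n : ℕ} (f : (Fin n → ℝ) → ℝ)
    (φ : ∀ p : Sf, (Fin n → ℚ_[(p : ℕ)]) → ℝ) (x : SSpace Sf n) : ℝ :=
  f x.1 * ∏ p : Sf, φ p (x.2 p)

/-- The basis vector `e_1` at every place. -/
def sE1 (Sf : Finset ℕ) [∀ p : Sf, Fact (p : ℕ).Prime] (d : ℕ) : SSpace Sf (d + 2) :=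
  (Pi.single 0 1, fun _ => Pi.single 0 1)

/-- The unit vectors `w / ‖w‖^σ`: `w_∞ / ‖w_∞‖` at the real place, and `p^m w_p` at `p`,
where `‖w_p‖ = p^m`. -/
def sUnit {Sf : Finset ℕ} [∀ p : Sf, Fact (p : ℕ).Prime] {n : ℕ} (w : SSpace Sf n) :
    SSpace Sf n :=
  ((euclNorm w.1)⁻¹ • w.1,
    fun p => ((p : ℕ) : ℚ_[(p : ℕ)]) ^ padicExp (p : ℕ) (w.2 p) • w.2 p)

/-- `J_f(‖w‖^σ / T^σ, ζ)`: the first argument is `‖w_∞‖ e^{-t_∞}` at the real place, and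
`p^{t_p} ‖w_p‖^{-1} = p^{t_p - m}` at `p`, where `‖w_p‖ = p^m`. -/
def sJ {Sf : Finset ℕ} [∀ p : Sf, Fact (p : ℕ).Prime] {d : ℕ} (a : Fin d → ℝ)
    (b : ∀ p : Sf, Fin d → ℚ_[(p : ℕ)]) (f : (Fin (d + 2) → ℝ) → ℝ)
    (φ : ∀ p : Sf, (Fin (d + 2) → ℚ_[(p : ℕ)]) → ℝ) (t : ℝ × (Sf → ℤ)) (w : SSpace Sf (d + 2))
    (ζ : ℝ × (∀ p : Sf, ℚ_[(p : ℕ)])) : ℝ :=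
  realJ a f (euclNorm w.1 / Real.exp t.1) ζ.1 *
    ∏ p : Sf, padicJ (p : ℕ) (b p) (φ p)
      (((p : ℕ) : ℚ_[(p : ℕ)]) ^ (t.2 p - padicExp (p : ℕ) (w.2 p))) (ζ.2 p)

end

/-! The lattice sum and the integral of the Siegel transform are compared vector by vector. Put `d =
n - 2` and `w = g v ≠ 0`. The contribution `J_f · ν` of `w` to the sum is close to `c |T|^d ∫_K
f(a_t k w) ν(k⁻¹ e_1) dm`. An error that is merely small could not be summed, because the number of
contributing vectors grows with `t`. `exists_S_local_asymptotic` therefore gives a relative error,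
at most `ε |T|^d m{k : a_t k w ∈ N}` for a given open box `N` around the supports. If `f⁺ ≥ κ/2` on
`N`, Markov's inequality and summation over `v` bound the total error by a constant times `ε ∫ f̃⁺`,
and the last integral is bounded by hypothesis. For fixed `t` only finitely many `v` contribute.

All the objects are products over the places, so the estimate for one vector is a product of local
estimates. `abs_prod_sub_prod_le` multiplies them and keeps the error relative.

At a finite place, `a_t k w ∈ supp f` forces `k w` to have a dominant first coordinate and bounded
other coordinates. Hence, up to a unit, the direction of `w` is close to `k⁻¹ e_1`, and `ν` is
handled by uniform continuity. Without `ν` the formula is exact for large `t`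
(`padic_orbit_integral`). Indeed `K_p` moves a unit vector with small form value to `e_1 + (ζ/2)
e_n` (`exists_padicK_normal_form`; the assumption on split forms enters here). Averaging over the
Eichler unipotents of `K_p`, which fix `x_1` and translate the middle coordinates by `x_1 s`, shows
that on `|x_1| = 1` the middle coordinates are Haar distributed in `ℤ_p^d`
(`integral_padicK_indicator`). The last coordinate is then determined by the form.

At the real place the matrix of the form is an orthogonal involution, and the orbits of `K_∞` are
the sets on which both eigencomponents have given lengths (`exists_realK`). Rather than constructing
measures on these orbits, `integral_realK_eq` writes an orbital integral as a Lebesgue integral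
against an invariant weight, composed with the rescaling of both eigencomponents onto the orbit. In
coordinates adapted to the contraction factor `h = e^{-t}` the integrand extends continuously to `h
= 0`, where it yields a constant times `J_f`. Uniform continuity on a compact set of parameters
gives an error that is uniform in the vector (`exists_real_uniform_asymptotic`). It becomes relative
through `exists_real_lower_bound`: as soon as either side is non-zero, `e^{td} μ{k : a_t k w ∈ N}`
is bounded below. -/

/-! ### Coordinates `(x_1, y, x_n)` and the standard form -/

section Coordinates

variable {F : Type*} {d : ℕ}

/-- The vector `(r, y_1, …, y_d, z)`. -/
def mkVec (r : F) (y : Fin d → F) (z : F) : Fin (d + 2) → F :=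
  Fin.cons r (Fin.snoc y z : Fin (d + 1) → F)

/-- The middle coordinates of a vector. -/
def midVec (x : Fin (d + 2) → F) : Fin d → F := fun i => x i.succ.castSucc

@[simp] theorem mkVec_zero (r : F) (y : Fin d → F) (z : F) : mkVec r y z 0 = r := by
  simp [mkVec]

@[simp] theorem mkVec_last (r : F) (y : Fin d → F) (z : F) :
    mkVec r y z (Fin.last (d + 1)) = z := by
  have h : (Fin.last (d + 1)) = (Fin.last d).succ := rfl
  rw [h, mkVec, Fin.cons_succ, Fin.snoc_last]

@[simp] theorem mkVec_mid (r : F) (y : Fin d → F) (z : F) (i : Fin d) :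
    mkVec r y z i.castSucc.succ = y i := by
  rw [mkVec, Fin.cons_succ, Fin.snoc_castSucc]

theorem mkVec_mid' (r : F) (y : Fin d → F) (z : F) (i : Fin d) :
    mkVec r y z i.succ.castSucc = y i := mkVec_mid r y z i

@[simp] theorem midVec_mkVec (r : F) (y : Fin d → F) (z : F) : midVec (mkVec r y z) = y := by
  funext i; exact mkVec_mid r y z i

theorem forall_coord {P : Fin (d + 2) → Prop} (h0 : P 0) (hm : ∀ i : Fin d, P i.succ.castSucc)
    (hl : P (Fin.last (d + 1))) (j : Fin (d + 2)) : P j := by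
  refine Fin.lastCases hl (fun j => ?_) j
  refine Fin.cases h0 (fun i => ?_) j
  exact hm i

theorem vec_ext {x y : Fin (d + 2) → F} (h0 : x 0 = y 0)
    (hm : ∀ i : Fin d, x i.succ.castSucc = y i.succ.castSucc)
    (hl : x (Fin.last (d + 1)) = y (Fin.last (d + 1))) : x = y :=
  funext (forall_coord h0 hm hl)

theorem eq_mkVec (x : Fin (d + 2) → F) : x = mkVec (x 0) (midVec x) (x (Fin.last (d + 1))) :=
  vec_ext (by simp) (fun i => (mkVec_mid' (x 0) (midVec x) _ i).symm) (by simp)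

theorem sum_coord [AddCommMonoid F] (f : Fin (d + 2) → F) :
    ∑ j, f j = f 0 + ∑ i : Fin d, f i.succ.castSucc + f (Fin.last (d + 1)) := by
  rw [Fin.sum_univ_castSucc, Fin.sum_univ_succ]; rfl

theorem prod_coord [CommMonoid F] (f : Fin (d + 2) → F) :
    ∏ j, f j = f 0 * (∏ i : Fin d, f i.succ.castSucc) * f (Fin.last (d + 1)) := by
  rw [Fin.prod_univ_castSucc, Fin.prod_univ_succ]; rfl

theorem mid_ne_zero (i : Fin d) : (i.succ.castSucc : Fin (d + 2)) ≠ 0 := by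
  intro h
  have := congrArg Fin.val h
  simp at this

theorem mid_ne_last (i : Fin d) : (i.succ.castSucc : Fin (d + 2)) ≠ Fin.last (d + 1) := by
  intro h
  have := congrArg Fin.val h
  have h2 := i.2
  simp at this
  omega

theorem mid_inj {i j : Fin d} (h : (i.succ.castSucc : Fin (d + 2)) = j.succ.castSucc) : i = j := by
  have := congrArg Fin.val h
  simp at this
  exact Fin.ext this

theorem zero_ne_last' : (0 : Fin (d + 2)) ≠ Fin.last (d + 1) := by
  intro h
  have := congrArg Fin.val h
  simp at this

variable [Field F]

theorem levelPoint_eq_mkVec (a : Fin d → F) (r ζ : F) (y : Fin d → F) :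
    levelPoint a r ζ y = mkVec r y ((ζ - ∑ i, a i * y i ^ 2) / (2 * r)) := rfl

theorem stdForm_mkVec (a : Fin d → F) (r : F) (y : Fin d → F) (z : F) :
    stdForm a (mkVec r y z) = 2 * r * z + ∑ i, a i * y i ^ 2 := by
  simp only [stdForm, mkVec_zero, mkVec_last, mkVec_mid']

/-- The form is linear in `x_n` with coefficient `2 x_1`. Since `a_t` preserves the form and the
middle coordinates, this parametrises `a_t k w` at every place without its last coordinate, the one
that `a_t` expands. -/
theorem eq_levelPoint [CharZero F] (a : Fin d → F) (x : Fin (d + 2) → F) (h : x 0 ≠ 0) :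
    x = levelPoint a (x 0) (stdForm a x) (midVec x) := by
  conv_lhs => rw [eq_mkVec x]
  rw [levelPoint_eq_mkVec]
  congr 1
  simp only [stdForm, midVec]
  field_simp
  ring

theorem diagSL_mulVec (u : F) (hu : u ≠ 0) (x : Fin (d + 2) → F) :
    (diagSL d u hu).1.mulVec x = mkVec (u * x 0) (midVec x) (u⁻¹ * x (Fin.last (d + 1))) := by
  have h : ∀ j, (diagSL d u hu).1.mulVec x j
      = mkVec u (fun _ : Fin d => (1 : F)) u⁻¹ j * x j := by
    intro j
    simp only [diagSL, Matrix.mulVec_diagonal]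
    rfl
  apply vec_ext
  · rw [h]; simp
  · intro i; rw [h]; simp only [mkVec_mid', midVec, one_mul]
  · rw [h]; simp

theorem stdForm_diagSL (a : Fin d → F) (u : F) (hu : u ≠ 0) (x : Fin (d + 2) → F) :
    stdForm a ((diagSL d u hu).1.mulVec x) = stdForm a x := by
  rw [diagSL_mulVec, stdForm_mkVec, stdForm]
  simp only [midVec]
  field_simp

theorem stdForm_smul (a : Fin d → F) (c : F) (x : Fin (d + 2) → F) :
    stdForm a (c • x) = c ^ 2 * stdForm a x := by
  simp only [stdForm, Pi.smul_apply, smul_eq_mul, mul_add, Finset.mul_sum]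
  congr 1
  · ring
  · exact Finset.sum_congr rfl fun i _ => by ring

end Coordinates

/-! ### Topology of special linear groups -/

section Topology

theorem continuous_stdForm {F : Type*} [Field F] [TopologicalSpace F] [IsTopologicalRing F] {d : ℕ}
    (a : Fin d → F) : Continuous (stdForm a) := by
  unfold stdForm; fun_prop

theorem continuous_mkVec {F : Type*} [TopologicalSpace F] {d : ℕ} {X : Type*} [TopologicalSpace X]
    {r z : X → F} {y : X → Fin d → F} (hr : Continuous r) (hy : Continuous y) (hz : Continuous z) :
    Continuous fun x => mkVec (r x) (y x) (z x) := by
  refine continuous_pi (forall_coord ?_ ?_ ?_)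
  · simpa using hr
  · intro i; simpa only [mkVec_mid'] using! (continuous_apply i).comp hy
  · simpa using hz

variable {F : Type*} [Field F] [TopologicalSpace F] [IsTopologicalRing F] {n : ℕ}

theorem continuous_SL_mulVec {X : Type*} [TopologicalSpace X]
    {k : X → Matrix.SpecialLinearGroup (Fin n) F} {v : X → Fin n → F}
    (hk : Continuous k) (hv : Continuous v) : Continuous fun x => (k x).1.mulVec (v x) :=
  (continuous_subtype_val.comp hk).matrix_mulVec hv

theorem isClosed_stdSO [T2Space F] {d : ℕ} (a : Fin d → F) :
    IsClosed (stdSO a : Set (Matrix.SpecialLinearGroup (Fin (d + 2)) F)) := by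
  have : (stdSO a : Set (Matrix.SpecialLinearGroup (Fin (d + 2)) F))
      = ⋂ x : Fin (d + 2) → F, {k | stdForm a (k.1.mulVec x) = stdForm a x} := by
    ext k; simp [stdSO]
  rw [this]
  exact isClosed_iInter fun x => isClosed_eq
    ((continuous_stdForm a).comp (continuous_SL_mulVec continuous_id continuous_const))
    continuous_const

/-- Determinant one is a closed condition on a product of closed balls. Both kinds of maximal
compact subgroups are closed subsets of this set. -/
theorem isCompact_SL_norm_le {𝕜 : Type*} [NormedField 𝕜] [ProperSpace 𝕜] (n : ℕ) :
    IsCompact {k : Matrix.SpecialLinearGroup (Fin n) 𝕜 | ∀ i j, ‖k.1 i j‖ ≤ 1} := by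
  have h : IsCompact {M : Matrix (Fin n) (Fin n) 𝕜 | ∀ i j, M i j ∈ Metric.closedBall (0 : 𝕜) 1} :=
    by
    have := isCompact_univ_pi (X := fun _ : Fin n => Fin n → 𝕜)
      (s := fun _ => Set.univ.pi fun _ => Metric.closedBall (0 : 𝕜) 1)
      (fun _ => isCompact_univ_pi fun _ => isCompact_closedBall _ _)
    convert! this using 1
    exact Set.ext fun M => ⟨fun h i _ j _ => h i j, fun h i j => h i trivial j trivial⟩
  have h2 := Matrix.SpecialLinearGroup.isClosedEmbedding_val (n := Fin n) (R := 𝕜)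
    |>.isCompact_preimage h
  have h3 : {k : Matrix.SpecialLinearGroup (Fin n) 𝕜 | ∀ i j, ‖k.1 i j‖ ≤ 1}
      = (fun k : Matrix.SpecialLinearGroup (Fin n) 𝕜 => k.1) ⁻¹'
        {M : Matrix (Fin n) (Fin n) 𝕜 | ∀ i j, M i j ∈ Metric.closedBall (0 : 𝕜) 1} :=
    Set.ext fun k => ⟨fun h i j => mem_closedBall_zero_iff.2 (h i j),
      fun h i j => mem_closedBall_zero_iff.1 (h i j)⟩
  rw [h3]
  exact h2

instance secondCountable_SL {𝕜 : Type*} [CommRing 𝕜] [TopologicalSpace 𝕜]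
    [SecondCountableTopology 𝕜] :
    SecondCountableTopology (Matrix.SpecialLinearGroup (Fin n) 𝕜) :=
  have : SecondCountableTopology (Matrix (Fin n) (Fin n) 𝕜) :=
    inferInstanceAs (SecondCountableTopology (Fin n → Fin n → 𝕜))
  Topology.IsInducing.secondCountableTopology
    (f := fun k : Matrix.SpecialLinearGroup (Fin n) 𝕜 => k.1) ⟨rfl⟩

end Topology

/-! ### Right invariance of Haar measure on a compact group -/

section Haar

/-- A right translate of the measure is again a Haar probability measure, hence the same one. It is
used to change the base point of an orbit. -/
theorem integral_mul_right_of_isProbability {G : Type*} [Group G] [TopologicalSpace G]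
    [IsTopologicalGroup G] [CompactSpace G] [MeasurableSpace G] [BorelSpace G]
    (μ : Measure G) [μ.IsHaarMeasure] [IsProbabilityMeasure μ] (f : G → ℝ) (g : G) :
    ∫ k, f (k * g) ∂μ = ∫ k, f k ∂μ := by
  have hm : Measurable fun k : G => k * g := (continuous_mul_const g).measurable
  have : IsProbabilityMeasure (μ.map (· * g)) := Measure.isProbabilityMeasure_map hm.aemeasurable
  have : (μ.map (· * g)).IsHaarMeasure :=
    { toIsFiniteMeasureOnCompacts := inferInstance
      toIsMulLeftInvariant := inferInstance
      toIsOpenPosMeasure := (continuous_mul_const g).isOpenPosMeasure_map (mul_right_surjective g) }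
  have h := Measure.isHaarMeasure_eq_of_isProbabilityMeasure (μ.map (· * g)) μ
  have h2 := ((Homeomorph.mulRight g).measurableEmbedding).integral_map (μ := μ) f
  simp only [Homeomorph.coe_mulRight] at h2
  rw [← h2, h]

end Haar

/-! ### Explicit elements of the orthogonal group -/

section Eichler

variable {F : Type*} [Field F] {d : ℕ}

/-- The matrix of the Eichler transformation
`x ↦ (x_1, y + x_1 s, x_n - ∑ b_i s_i y_i - x_1 ∑ b_i s_i ^ 2 / 2)`. -/
def eichlerMatrix (b s : Fin d → F) : Matrix (Fin (d + 2)) (Fin (d + 2)) F :=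
  fun j l => if l = 0 then mkVec 1 s (-(∑ i, b i * s i ^ 2) / 2) j
    else if j = Fin.last (d + 1) then mkVec 0 (fun i => -(b i * s i)) 1 l
    else if j = l then 1 else 0

theorem eichlerMatrix_mulVec (b s : Fin d → F) (x : Fin (d + 2) → F) :
    (eichlerMatrix b s).mulVec x = mkVec (x 0) (fun i => midVec x i + x 0 * s i)
      (x (Fin.last (d + 1)) - ∑ i, b i * s i * midVec x i - x 0 * (∑ i, b i * s i ^ 2) / 2) := by
  have h0l : Fin.last (d + 1) ≠ (0 : Fin (d + 2)) := (zero_ne_last').symm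
  have h0l' := zero_ne_last' (d := d)
  have hm0 := mid_ne_zero (d := d)
  have hml := mid_ne_last (d := d)
  have hinj : ∀ i j : Fin d, (i.succ.castSucc : Fin (d + 2)) = j.succ.castSucc ↔ i = j :=
    fun i j => ⟨mid_inj, fun h => h ▸ rfl⟩
  apply vec_ext
  · rw [Matrix.mulVec, dotProduct, sum_coord]
    simp only [eichlerMatrix, if_true, mkVec_zero, hm0, h0l, h0l', (hm0 _).symm, if_false]
    simp
  · intro i
    rw [Matrix.mulVec, dotProduct, sum_coord]
    simp only [eichlerMatrix, if_true, mkVec_mid', hm0, hml, h0l, if_false, hinj]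
    simp [midVec]
    ring
  · rw [Matrix.mulVec, dotProduct, sum_coord]
    simp only [eichlerMatrix, if_true, mkVec_last, mkVec_mid', hm0, h0l, if_false, midVec,
      neg_mul, Finset.sum_neg_distrib]
    ring

theorem det_eichlerMatrix (b s : Fin d → F) : (eichlerMatrix b s).det = 1 := by
  rw [Matrix.det_of_isLowerTriangular]
  · refine Finset.prod_eq_one fun j _ => ?_
    refine forall_coord (P := fun j => eichlerMatrix b s j j = 1) ?_ ?_ ?_ j
    · simp [eichlerMatrix]
    · intro i; simp only [eichlerMatrix, mid_ne_zero, mid_ne_last, if_false, if_true]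
    · simp only [eichlerMatrix, (zero_ne_last').symm, if_false, if_true, mkVec_last]
  · intro j l hjl
    have hjl : j < l := hjl
    have h0 : l ≠ 0 := by rintro rfl; exact absurd hjl (Fin.not_lt_zero j)
    have hl : j ≠ Fin.last (d + 1) := by
      rintro rfl; exact absurd hjl (not_lt.2 (Fin.le_last l))
    simp [eichlerMatrix, h0, hl, hjl.ne]

/-- The Eichler transformation as an element of the special linear group. -/
def eichlerSL (b s : Fin d → F) : Matrix.SpecialLinearGroup (Fin (d + 2)) F :=
  ⟨eichlerMatrix b s, det_eichlerMatrix b s⟩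

/-- The correction to `x_n` is the one for which `2 x_1 x_n` absorbs the change of `∑ b_i y_i ^ 2`
under `y ↦ y + x_1 s`. -/
theorem eichlerSL_mem [CharZero F] (b s : Fin d → F) : eichlerSL b s ∈ stdSO b := by
  intro x
  change stdForm b ((eichlerMatrix b s).mulVec x) = _
  rw [eichlerMatrix_mulVec, stdForm_mkVec, stdForm]
  simp only [midVec]
  have h : ∀ i, b i * (x i.succ.castSucc + x 0 * s i) ^ 2 = b i * x i.succ.castSucc ^ 2
      + 2 * x 0 * (b i * s i * x i.succ.castSucc) + x 0 ^ 2 * (b i * s i ^ 2) := by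
    intro i; ring
  simp only [h, Finset.sum_add_distrib, ← Finset.mul_sum]
  field_simp
  ring

/-- The exchange of the first and last coordinates, made of determinant one by a sign change of
the middle coordinate `i₀`. -/
def swapSL (i₀ : Fin d) : Matrix.SpecialLinearGroup (Fin (d + 2)) F :=
  ⟨Matrix.diagonal (mkVec 1 (Function.update (1 : Fin d → F) i₀ (-1)) 1) *
      (Equiv.swap (0 : Fin (d + 2)) (Fin.last (d + 1))).permMatrix F, by
    rw [Matrix.det_mul, Matrix.det_permutation, Matrix.det_diagonal, prod_coord,
      Equiv.Perm.sign_swap zero_ne_last']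
    simp only [mkVec_zero, mkVec_last, mkVec_mid']
    rw [Finset.prod_update_of_mem (Finset.mem_univ _)]
    simp⟩

theorem swapSL_mulVec (i₀ : Fin d) (x : Fin (d + 2) → F) :
    (swapSL i₀).1.mulVec x = mkVec (x (Fin.last (d + 1)))
      (fun i => Function.update (1 : Fin d → F) i₀ (-1) i * midVec x i) (x 0) := by
  rw [swapSL, ← Matrix.mulVec_mulVec, Matrix.permMatrix_mulVec]
  apply vec_ext
  · rw [Matrix.mulVec_diagonal]; simp
  · intro i
    rw [Matrix.mulVec_diagonal, mkVec_mid', mkVec_mid', Function.comp,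
      Equiv.swap_apply_of_ne_of_ne (mid_ne_zero i) (mid_ne_last i), midVec]
  · rw [Matrix.mulVec_diagonal]; simp

theorem swapSL_mem (b : Fin d → F) (i₀ : Fin d) : swapSL i₀ ∈ stdSO b := by
  intro x
  rw [swapSL_mulVec, stdForm_mkVec, stdForm]
  congr 1
  · ring
  · refine Finset.sum_congr rfl fun i _ => ?_
    by_cases h : i = i₀
    · subst h; simp [midVec]
    · simp [Function.update_of_ne h, midVec]

theorem diagSL_mem (b : Fin d → F) (u : F) (hu : u ≠ 0) : diagSL d u hu ∈ stdSO b :=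
  fun x => stdForm_diagSL b u hu x

end Eichler

/-! ### The compact group `K_p` -/

section PadicCompact

variable {p : ℕ} [hp : Fact p.Prime] {d : ℕ}

/-- A matrix with integral entries lifts to `ℤ_p`, and its determinant there is one because `ℤ_p →
ℚ_p` is injective. -/
theorem mem_padicK_iff (b : Fin d → ℚ_[p]) (k : Matrix.SpecialLinearGroup (Fin (d + 2)) ℚ_[p]) :
    k ∈ padicK p b ↔ k ∈ stdSO b ∧ ∀ i j, ‖k.1 i j‖ ≤ 1 := by
  rw [padicK, Subgroup.mem_inf]
  refine and_congr_right fun _ => ⟨?_, fun h => ?_⟩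
  · rintro ⟨l, rfl⟩ i j
    exact (l.1 i j).2
  · have hd : (Matrix.of fun i j => ((⟨k.1 i j, h i j⟩ : ℤ_[p]) : ℤ_[p]) :
        Matrix (Fin (d + 2)) (Fin (d + 2)) ℤ_[p]).det = 1 := by
      apply Subtype.coe_injective
      change PadicInt.Coe.ringHom (p := p) _ = PadicInt.Coe.ringHom (p := p) 1
      rw [RingHom.map_det, map_one]
      exact k.2
    exact ⟨⟨_, hd⟩, Subtype.ext rfl⟩

instance compactSpace_padicK (b : Fin d → ℚ_[p]) : CompactSpace (padicK p b) := by
  refine isCompact_iff_compactSpace.1 ?_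
  have h : (padicK p b : Set (Matrix.SpecialLinearGroup (Fin (d + 2)) ℚ_[p]))
      = (stdSO b : Set _) ∩ {k | ∀ i j, ‖k.1 i j‖ ≤ 1} :=
    Set.ext fun k => mem_padicK_iff b k
  change IsCompact (padicK p b : Set (Matrix.SpecialLinearGroup (Fin (d + 2)) ℚ_[p]))
  rw [h]
  exact (isCompact_SL_norm_le (d + 2)).inter_left (isClosed_stdSO b)

theorem padic_norm_sum_le {ι : Type*} (s : Finset ι) (f : ι → ℚ_[p]) {C : ℝ} (hC : 0 ≤ C)
    (h : ∀ i ∈ s, ‖f i‖ ≤ C) : ‖∑ i ∈ s, f i‖ ≤ C :=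
  IsUltrametricDist.norm_sum_le_of_forall_le_of_nonneg hC h

theorem norm_mulVec_le {n : ℕ} {k : Matrix (Fin n) (Fin n) ℚ_[p]} (hk : ∀ i j, ‖k i j‖ ≤ 1)
    (x : Fin n → ℚ_[p]) : ‖k.mulVec x‖ ≤ ‖x‖ := by
  rw [pi_norm_le_iff_of_nonneg (norm_nonneg _)]
  intro i
  refine padic_norm_sum_le Finset.univ (fun j => k i j * x j) (norm_nonneg _) fun j _ => ?_
  rw [norm_mul]
  exact (mul_le_of_le_one_left (norm_nonneg _) (hk i j)).trans (norm_le_pi_norm x j)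

/-- An integral matrix does not increase the maximum norm; this applies to both `k` and its inverse.
-/
theorem norm_padicK_mulVec {b : Fin d → ℚ_[p]}
    {k : Matrix.SpecialLinearGroup (Fin (d + 2)) ℚ_[p]} (hk : k ∈ padicK p b)
    (x : Fin (d + 2) → ℚ_[p]) : ‖k.1.mulVec x‖ = ‖x‖ := by
  refine le_antisymm (norm_mulVec_le ((mem_padicK_iff b k).1 hk).2 x) ?_
  have h := norm_mulVec_le ((mem_padicK_iff b _).1 (inv_mem hk)).2 (k.1.mulVec x)
  rwa [Matrix.mulVec_mulVec, ← Matrix.SpecialLinearGroup.coe_mul, inv_mul_cancel,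
    Matrix.SpecialLinearGroup.coe_one, Matrix.one_mulVec] at h

theorem norm_two_padic (hp2 : p ≠ 2) : ‖(2 : ℚ_[p])‖ = 1 := by
  have h : ¬ (p : ℤ) ∣ 2 := by
    intro h
    have h2 : p ∣ 2 := by exact_mod_cast h
    exact hp2 ((Nat.prime_dvd_prime_iff_eq hp.out Nat.prime_two).1 h2)
  have h1 := Padic.norm_int_le_one (p := p) 2
  have h3 := (Padic.norm_intCast_lt_one_iff (p := p) (k := 2)).not.2 h
  push_cast at h1 h3
  exact le_antisymm h1 (not_lt.1 h3)

/-- The only denominator in the matrix is `2`, a unit because `p` is odd. -/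
theorem eichlerSL_mem_padicK (hp2 : p ≠ 2) (b s : Fin d → ℚ_[p]) (hb : ∀ i, ‖b i‖ ≤ 1)
    (hs : ∀ i, ‖s i‖ ≤ 1) : eichlerSL b s ∈ padicK p b := by
  refine (mem_padicK_iff b _).2 ⟨eichlerSL_mem b s, fun j l => ?_⟩
  change ‖eichlerMatrix b s j l‖ ≤ 1
  have h1 : ∀ i, ‖b i * s i ^ 2‖ ≤ 1 := fun i => by
    rw [norm_mul, norm_pow]
    exact mul_le_one₀ (hb i) (by positivity) (pow_le_one₀ (norm_nonneg _) (hs i))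
  unfold eichlerMatrix
  split_ifs
  · refine forall_coord (P := fun j => ‖mkVec 1 s (-(∑ i, b i * s i ^ 2) / 2) j‖ ≤ 1) ?_ ?_ ?_ j
    · simp
    · intro i; rw [mkVec_mid']; exact hs i
    · rw [mkVec_last, norm_div, norm_neg, norm_two_padic hp2, div_one]
      exact padic_norm_sum_le _ _ zero_le_one fun i _ => h1 i
  · refine forall_coord (P := fun l => ‖mkVec 0 (fun i => -(b i * s i)) 1 l‖ ≤ 1) ?_ ?_ ?_ l
    · simp
    · intro i
      rw [mkVec_mid', norm_neg, norm_mul]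
      exact mul_le_one₀ (hb i) (norm_nonneg _) (hs i)
    · simp
  · simp
  · simp

theorem norm_le_one_of_mulVec {n : ℕ} {k : Matrix (Fin n) (Fin n) ℚ_[p]}
    (h : ∀ x, ‖k.mulVec x‖ ≤ ‖x‖) (i j : Fin n) : ‖k i j‖ ≤ 1 := by
  have h1 := (norm_le_pi_norm _ i).trans (h (Pi.single j 1))
  rw [Matrix.mulVec_single_one] at h1
  refine h1.trans ?_
  rw [Pi.norm_single]; simp

theorem norm_mkVec_le {r z : ℚ_[p]} {y : Fin d → ℚ_[p]} {C : ℝ} (hr : ‖r‖ ≤ C)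
    (hy : ∀ i, ‖y i‖ ≤ C) (hz : ‖z‖ ≤ C) : ‖mkVec r y z‖ ≤ C := by
  rw [pi_norm_le_iff_of_nonneg ((norm_nonneg _).trans hr)]
  refine forall_coord ?_ ?_ ?_
  · simpa using hr
  · intro i; rw [mkVec_mid']; exact hy i
  · simpa using hz

theorem swapSL_mem_padicK (b : Fin d → ℚ_[p]) (i₀ : Fin d) : swapSL i₀ ∈ padicK p b := by
  refine (mem_padicK_iff b _).2 ⟨swapSL_mem b i₀, norm_le_one_of_mulVec fun x => ?_⟩
  rw [swapSL_mulVec]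
  refine norm_mkVec_le (norm_le_pi_norm x _) (fun i => ?_) (norm_le_pi_norm x _)
  rw [norm_mul]
  have : ‖(Function.update (1 : Fin d → ℚ_[p]) i₀ (-1) i)‖ = 1 := by
    by_cases h : i = i₀
    · subst h; simp
    · simp [Function.update_of_ne h]
  rw [this, one_mul]
  exact norm_le_pi_norm x _

theorem diagSL_mem_padicK (b : Fin d → ℚ_[p]) (u : ℚ_[p]) (hu : u ≠ 0) (hu1 : ‖u‖ = 1) :
    diagSL d u hu ∈ padicK p b := by
  refine (mem_padicK_iff b _).2 ⟨diagSL_mem b u hu, norm_le_one_of_mulVec fun x => ?_⟩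
  rw [diagSL_mulVec]
  refine norm_mkVec_le ?_ (fun i => norm_le_pi_norm x _) ?_
  · rw [norm_mul, hu1, one_mul]; exact norm_le_pi_norm x _
  · rw [norm_mul, norm_inv, hu1, inv_one, one_mul]; exact norm_le_pi_norm x _

end PadicCompact

/-! ### Orbits of `K_p` on unit vectors -/

section PadicOrbits

variable {p : ℕ} [hp : Fact p.Prime] {d : ℕ}

theorem padic_norm_le_inv_of_lt_one {x : ℚ_[p]} (hx : ‖x‖ < 1) : ‖x‖ ≤ (p : ℝ)⁻¹ := by
  have h := (Padic.norm_le_pow_iff_norm_lt_pow_add_one x (-1)).2 (by simpa using hx)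
  simpa using h

theorem padic_norm_sub_le_max (x y : ℚ_[p]) : ‖x - y‖ ≤ max ‖x‖ ‖y‖ := by
  have h := IsUltrametricDist.norm_add_le_max x (-y)
  rwa [norm_neg, ← sub_eq_add_neg] at h

/-- Hensel's lemma for `X ^ 2 - (1 - e)` at `1`, where the derivative `2` is a unit. -/
theorem isSquare_padic_one_sub (hp2 : p ≠ 2) {e : ℚ_[p]} (he : ‖e‖ < 1) : IsSquare (1 - e) := by
  obtain ⟨e, rfl⟩ : ∃ e' : ℤ_[p], (e' : ℚ_[p]) = e := ⟨⟨e, he.le⟩, rfl⟩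
  have hF : ‖(Polynomial.X ^ 2 - Polynomial.C (1 - e) : Polynomial ℤ_[p]).aeval (1 : ℤ_[p])‖ <
      ‖(Polynomial.X ^ 2 - Polynomial.C (1 - e) : Polynomial ℤ_[p]).derivative.aeval
        (1 : ℤ_[p])‖ ^ 2 := by
    have h2 : ‖(1 : ℤ_[p]) + 1‖ = 1 := by rw [one_add_one_eq_two]; exact norm_two_padic hp2
    have h1 : ‖e‖ < 1 := he
    simpa [h2] using h1
  obtain ⟨z, hz, -⟩ := hensels_lemma hF
  refine ⟨(z : ℚ_[p]), ?_⟩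
  have h : z ^ 2 = 1 - e := by simpa [sub_eq_zero] using hz
  have h' := congrArg (fun w : ℤ_[p] => (w : ℚ_[p])) h
  push_cast at h'
  rw [← pow_two, h']

/-- Vectors with a unit first coordinate are in the orbit of `(1, 0, …, 0, ζ / 2)`. -/
theorem exists_padicK_of_norm_zero (hp2 : p ≠ 2) (b : Fin d → ℚ_[p]) (hb : ∀ i, ‖b i‖ ≤ 1)
    (x : Fin (d + 2) → ℚ_[p]) (hx : ‖x‖ ≤ 1) (h0 : ‖x 0‖ = 1) :
    ∃ k ∈ padicK p b, k.1.mulVec x = mkVec 1 0 (stdForm b x / 2) := by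
  have hx0 : x 0 ≠ 0 := by intro h; simp [h] at h0
  -- The Eichler transformation with `s = -y / x_1` kills the middle coordinates and the diagonal
  -- element makes the first one equal to `1`. The form then determines the last coordinate.
  have hE := eichlerSL_mem_padicK hp2 b (fun i => -midVec x i / x 0) hb (fun i => by
    rw [norm_div, norm_neg, h0, div_one]; exact (norm_le_pi_norm x _).trans hx)
  have hD := diagSL_mem_padicK b (x 0)⁻¹ (inv_ne_zero hx0) (by rw [norm_inv, h0, inv_one])
  have hk := mul_mem hD hE
  refine ⟨_, hk, ?_⟩
  set k := diagSL d (x 0)⁻¹ (inv_ne_zero hx0) * eichlerSL b (fun i => -midVec x i / x 0) with hkdef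
  have hkx : k.1.mulVec x = (diagSL d (x 0)⁻¹ (inv_ne_zero hx0)).1.mulVec
      ((eichlerMatrix b (fun i => -midVec x i / x 0)).mulVec x) := by
    rw [hkdef, Matrix.SpecialLinearGroup.coe_mul, ← Matrix.mulVec_mulVec]; rfl
  have h1 : (k.1.mulVec x) 0 = 1 := by
    rw [hkx, diagSL_mulVec, eichlerMatrix_mulVec]
    simp [hx0]
  have h2 : midVec (k.1.mulVec x) = 0 := by
    rw [hkx, diagSL_mulVec, eichlerMatrix_mulVec, midVec_mkVec, midVec_mkVec]
    funext i
    simp only [Pi.zero_apply]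
    field_simp
    ring
  have h3 : stdForm b (k.1.mulVec x) = stdForm b x := ((mem_padicK_iff b k).1 hk).1 x
  rw [eq_levelPoint b (k.1.mulVec x) (by rw [h1]; exact one_ne_zero), h1, h2, h3,
    levelPoint_eq_mkVec]
  simp

theorem exists_padicK_of_norm_last (hp2 : p ≠ 2) (hd : 0 < d) (b : Fin d → ℚ_[p])
    (hb : ∀ i, ‖b i‖ ≤ 1) (x : Fin (d + 2) → ℚ_[p]) (hx : ‖x‖ ≤ 1)
    (h0 : ‖x (Fin.last (d + 1))‖ = 1) :
    ∃ k ∈ padicK p b, k.1.mulVec x = mkVec 1 0 (stdForm b x / 2) := by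
  have hW := swapSL_mem_padicK b ⟨0, hd⟩
  obtain ⟨k, hk, h⟩ := exists_padicK_of_norm_zero hp2 b hb ((swapSL ⟨0, hd⟩).1.mulVec x)
    (by rwa [norm_padicK_mulVec hW]) (by rw [swapSL_mulVec]; simpa using h0)
  rw [((mem_padicK_iff b _).1 hW).1 x] at h
  exact ⟨k * swapSL ⟨0, hd⟩, mul_mem hk hW, by
    rw [Matrix.SpecialLinearGroup.coe_mul, ← Matrix.mulVec_mulVec, h]⟩

/-- If `x_1` and `x_n` are not units, some middle coordinate `x_j` is one. Were every `b_i x_i` a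
non-unit, then `|b_j| = p⁻¹` and `|b_j x_j ^ 2| = p⁻¹`, although `|∑ b_i x_i ^ 2| ≤ p⁻²`. So there
is a second middle term that cancels the first modulo `p ^ 2`. This makes `-b_i b_j` a square with
both coefficients divisible by `p`, the excluded split case. -/
theorem exists_norm_mul_mid_eq_one (hp2 : p ≠ 2) (hd : d = 1 ∨ d = 2) (b : Fin d → ℚ_[p])
    (hb : ∀ i, ‖b i‖ = 1 ∨ ‖b i‖ = (p : ℝ)⁻¹)
    (hsplit : ∀ i j : Fin d, i ≠ j → IsSquare (-(b i * b j)) → ¬ (‖b i‖ < 1 ∧ ‖b j‖ < 1))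
    (x : Fin (d + 2) → ℚ_[p]) (hx : ‖x‖ = 1) (h0 : ‖x 0‖ < 1)
    (hl : ‖x (Fin.last (d + 1))‖ < 1) (hq : ‖stdForm b x‖ ≤ ((p : ℝ)⁻¹) ^ 2) :
    ∃ i, ‖b i * midVec x i‖ = 1 := by
  have hp1 : (1 : ℝ) < p := by exact_mod_cast hp.out.one_lt
  have hpi : (p : ℝ)⁻¹ < 1 := inv_lt_one_of_one_lt₀ hp1
  have hpi0 : (0 : ℝ) < (p : ℝ)⁻¹ := by positivity
  have hxle : ∀ j, ‖x j‖ ≤ 1 := fun j => (norm_le_pi_norm x j).trans hx.le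
  have hb1 : ∀ i, ‖b i‖ ≤ 1 := fun i => by
    rcases hb i with h | h
    · exact h.le
    · rw [h]; exact hpi.le
  by_contra! hcon
  have hlt : ∀ i, ‖b i * midVec x i‖ < 1 := fun i => lt_of_le_of_ne (by
    rw [norm_mul]; exact mul_le_one₀ (hb1 i) (norm_nonneg _) (hxle _)) (hcon i)
  obtain ⟨j, hj⟩ : ∃ j, ‖midVec x j‖ = 1 := by
    by_contra! hno
    have : ‖x‖ ≤ (p : ℝ)⁻¹ := by
      rw [eq_mkVec x]
      exact norm_mkVec_le (padic_norm_le_inv_of_lt_one h0)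
        (fun i => padic_norm_le_inv_of_lt_one (lt_of_le_of_ne (hxle _) (hno i)))
        (padic_norm_le_inv_of_lt_one hl)
    rw [hx] at this
    exact absurd this (not_le.2 hpi)
  have hbof : ∀ i, ‖midVec x i‖ = 1 → ‖b i‖ = (p : ℝ)⁻¹ := fun i hi => by
    rcases hb i with h | h
    · have := hlt i
      rw [norm_mul, h, hi] at this
      norm_num at this
    · exact h
  have hbj := hbof j hj
  have hsum : ‖∑ i, b i * midVec x i ^ 2‖ ≤ ((p : ℝ)⁻¹) ^ 2 := by
    have h : ∑ i, b i * midVec x i ^ 2 = stdForm b x - 2 * (x 0 * x (Fin.last (d + 1))) := by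
      simp only [stdForm, midVec]; ring
    rw [h]
    refine (padic_norm_sub_le_max _ _).trans (max_le hq ?_)
    rw [norm_mul, norm_two_padic hp2, one_mul, norm_mul, pow_two]
    exact mul_le_mul (padic_norm_le_inv_of_lt_one h0) (padic_norm_le_inv_of_lt_one hl)
      (norm_nonneg _) hpi0.le
  have hnj : ‖b j * midVec x j ^ 2‖ = (p : ℝ)⁻¹ := by
    rw [norm_mul, norm_pow, hj, hbj]; simp
  have hpp : ((p : ℝ)⁻¹) ^ 2 < (p : ℝ)⁻¹ := by
    rw [pow_two]; exact mul_lt_of_lt_one_left hpi0 hpi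
  by_cases hex : ∃ i, i ≠ j
  · obtain ⟨i, hij⟩ := hex
    have hsum2 : ∑ l, b l * midVec x l ^ 2 = b i * midVec x i ^ 2 + b j * midVec x j ^ 2 := by
      have hu : (Finset.univ : Finset (Fin d)) = {i, j} := by
        refine (Finset.eq_of_subset_of_card_le (Finset.subset_univ _) ?_).symm
        rw [Finset.card_pair hij, Finset.card_univ, Fintype.card_fin]
        omega
      rw [hu, Finset.sum_pair hij]
    rw [hsum2] at hsum
    rcases (hxle i.succ.castSucc).lt_or_eq with hi | hi
    · have h1 : ‖b i * midVec x i ^ 2‖ ≤ ((p : ℝ)⁻¹) ^ 2 := by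
        have : b i * midVec x i ^ 2 = (b i * midVec x i) * midVec x i := by ring
        rw [this, norm_mul, pow_two]
        exact mul_le_mul (padic_norm_le_inv_of_lt_one (hlt i)) (padic_norm_le_inv_of_lt_one hi)
          (norm_nonneg _) hpi0.le
      have h2 : ‖b j * midVec x j ^ 2‖ ≤ ((p : ℝ)⁻¹) ^ 2 := by
        have : b j * midVec x j ^ 2
          = (b i * midVec x i ^ 2 + b j * midVec x j ^ 2) - b i * midVec x i ^ 2 := by ring
        rw [this]
        exact (padic_norm_sub_le_max _ _).trans (max_le hsum h1)
      rw [hnj] at h2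
      exact absurd h2 (not_le.2 hpp)
    · have hbi := hbof i hi
      have hi' : ‖midVec x i‖ = 1 := hi
      have hxi : midVec x i ≠ 0 := by intro h; rw [h, norm_zero] at hi'; norm_num at hi'
      have hxj : midVec x j ≠ 0 := by intro h; rw [h, norm_zero] at hj; norm_num at hj
      have hbi0 : b i ≠ 0 := by intro h; rw [h, norm_zero] at hbi; exact hpi0.ne hbi
      set e := b i * midVec x i ^ 2 + b j * midVec x j ^ 2 with he
      have hee : ‖e / (b i * midVec x i ^ 2)‖ < 1 := by
        rw [norm_div, norm_mul, norm_pow, hi', hbi, one_pow, mul_one, div_lt_one hpi0]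
        exact hsum.trans_lt hpp
      obtain ⟨s, hs⟩ := isSquare_padic_one_sub hp2 hee
      -- From `1 - e / (b_i x_i ^ 2) = -b_j x_j ^ 2 / (b_i x_i ^ 2) = s ^ 2` one obtains the square
      -- root `b_i x_i s / x_j` of `-b_i b_j`.
      refine hsplit i j hij ⟨b i * midVec x i / midVec x j * s, ?_⟩
        ⟨by rw [hbi]; exact hpi, by rw [hbj]; exact hpi⟩
      have : b i * midVec x i / midVec x j * s * (b i * midVec x i / midVec x j * s)
          = (b i * midVec x i / midVec x j) ^ 2 * (1 - e / (b i * midVec x i ^ 2)) := by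
        rw [hs]; ring
      rw [this, he]
      field_simp
      ring
  · push Not at hex
    have hu : (Finset.univ : Finset (Fin d)) = {j} := by
      ext l; simp [hex l]
    rw [hu, Finset.sum_singleton, hnj] at hsum
    exact absurd hsum (not_le.2 hpp)

/-- The maximal compact subgroup acts transitively on unit vectors of given small norm form. -/
theorem exists_padicK_normal_form (hp2 : p ≠ 2) (hd : d = 1 ∨ d = 2) (b : Fin d → ℚ_[p])
    (hb : ∀ i, ‖b i‖ = 1 ∨ ‖b i‖ = (p : ℝ)⁻¹)
    (hsplit : ∀ i j : Fin d, i ≠ j → IsSquare (-(b i * b j)) → ¬ (‖b i‖ < 1 ∧ ‖b j‖ < 1))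
    (x : Fin (d + 2) → ℚ_[p]) (hx : ‖x‖ = 1) (hq : ‖stdForm b x‖ ≤ ((p : ℝ)⁻¹) ^ 2) :
    ∃ k ∈ padicK p b, k.1.mulVec x = mkVec 1 0 (stdForm b x / 2) := by
  have hp1 : (1 : ℝ) < p := by exact_mod_cast hp.out.one_lt
  have hpi : (p : ℝ)⁻¹ < 1 := inv_lt_one_of_one_lt₀ hp1
  have hd0 : 0 < d := by omega
  have hxle : ∀ j, ‖x j‖ ≤ 1 := fun j => (norm_le_pi_norm x j).trans hx.le
  have hb1 : ∀ i, ‖b i‖ ≤ 1 := fun i => by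
    rcases hb i with h | h
    · exact h.le
    · rw [h]; exact hpi.le
  rcases (hxle 0).lt_or_eq with h0 | h0
  swap
  · exact exists_padicK_of_norm_zero hp2 b hb1 x hx.le h0
  rcases (hxle (Fin.last (d + 1))).lt_or_eq with hl | hl
  swap
  · exact exists_padicK_of_norm_last hp2 hd0 b hb1 x hx.le hl
  obtain ⟨i, hi⟩ := exists_norm_mul_mid_eq_one hp2 hd b hb hsplit x hx h0 hl hq
  -- With `s = e_i` the last coordinate becomes `x_n - b_i x_i - x_1 b_i / 2`, where only the term
  -- `b_i x_i` is a unit. This reduces to the case of a unit last coordinate.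
  have hE := eichlerSL_mem_padicK hp2 b (Pi.single i 1) hb1 (fun j => by
    by_cases h : j = i
    · subst h; simp
    · simp [Pi.single_eq_of_ne h])
  obtain ⟨k, hk, h⟩ := exists_padicK_of_norm_last hp2 hd0 b hb1
    ((eichlerSL b (Pi.single i 1)).1.mulVec x) (by rw [norm_padicK_mulVec hE, hx]) (by
      change ‖(eichlerMatrix b (Pi.single i 1)).mulVec x _‖ = 1
      rw [eichlerMatrix_mulVec, mkVec_last]
      have h1 : ∑ j, b j * (Pi.single i 1 : Fin d → ℚ_[p]) j * midVec x j = b i * midVec x i := by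
        rw [Finset.sum_eq_single i]
        · simp
        · intro j _ hj; simp [Pi.single_eq_of_ne hj]
        · simp
      have h2 : ∑ j, b j * (Pi.single i 1 : Fin d → ℚ_[p]) j ^ 2 = b i := by
        rw [Finset.sum_eq_single i]
        · simp
        · intro j _ hj; simp [Pi.single_eq_of_ne hj]
        · simp
      rw [h1, h2]
      have hr : ‖x (Fin.last (d + 1)) - x 0 * b i / 2‖ < 1 := by
        refine (padic_norm_sub_le_max _ _).trans_lt (max_lt hl ?_)
        rw [norm_div, norm_two_padic hp2, div_one, norm_mul]
        exact (mul_le_of_le_one_right (norm_nonneg _) (hb1 i)).trans_lt h0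
      have : x (Fin.last (d + 1)) - b i * midVec x i - x 0 * b i / 2
          = -(b i * midVec x i) + (x (Fin.last (d + 1)) - x 0 * b i / 2) := by ring
      rw [this, IsUltrametricDist.norm_add_eq_max_of_norm_ne_norm]
      · rw [norm_neg, hi]; exact max_eq_left hr.le
      · rw [norm_neg, hi]; exact hr.ne')
  rw [((mem_padicK_iff b _).1 hE).1 x] at h
  exact ⟨k * eichlerSL b (Pi.single i 1), mul_mem hk hE, by
    rw [Matrix.SpecialLinearGroup.coe_mul, ← Matrix.mulVec_mulVec, h]⟩

end PadicOrbits

/-! ### Haar measure on `ℚ_p ^ d` and scaling -/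

section PadicMeasure

variable {p : ℕ} [hp : Fact p.Prime] {d : ℕ}

instance isAddHaar_padicHaar : (padicHaar p).IsAddHaarMeasure := by
  unfold padicHaar; infer_instance

theorem padicHaar_closedBall : padicHaar p (Metric.closedBall 0 1) = 1 := by
  unfold padicHaar; exact Measure.addHaarMeasure_self

/-- `ℤ_p` is the disjoint union of the `p` residue classes, which are translates of the open unit
ball. -/
theorem padicHaar_ball : padicHaar p (Metric.ball 0 1) = (p : ENNReal)⁻¹ := by
  have hcov : (Metric.closedBall (0 : ℚ_[p]) 1)
      = ⋃ i ∈ Finset.range p, (fun x => (i : ℚ_[p]) + x) '' Metric.ball 0 1 := by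
    ext x
    simp only [Set.mem_iUnion, Finset.mem_range, Set.mem_image, mem_ball_zero_iff,
      mem_closedBall_zero_iff, exists_prop]
    constructor
    · intro hx
      obtain ⟨x, rfl⟩ : ∃ x' : ℤ_[p], (x' : ℚ_[p]) = x := ⟨⟨x, hx⟩, rfl⟩
      obtain ⟨n, hn, h⟩ := PadicInt.exists_mem_range x
      refine ⟨n, hn, x - n, ?_, by ring⟩
      rw [IsLocalRing.mem_maximalIdeal, PadicInt.mem_nonunits] at h
      have h2 : ‖((x - (n : ℤ_[p]) : ℤ_[p]) : ℚ_[p])‖ < 1 := h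
      push_cast at h2
      exact h2
    · rintro ⟨n, -, y, hy, rfl⟩
      refine (IsUltrametricDist.norm_add_le_max _ _).trans (max_le ?_ hy.le)
      exact_mod_cast Padic.norm_int_le_one (p := p) n
  have hdisj : Set.PairwiseDisjoint (↑(Finset.range p))
      (fun i : ℕ => (fun x => (i : ℚ_[p]) + x) '' Metric.ball 0 1) := by
    intro i hi j hj hij
    rw [Function.onFun, Set.disjoint_left]
    rintro _ ⟨x, hx, rfl⟩ ⟨y, hy, hxy⟩
    rw [mem_ball_zero_iff] at hx hy
    have h : ‖(((i : ℤ) - (j : ℤ) : ℤ) : ℚ_[p])‖ < 1 := by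
      have : (((i : ℤ) - (j : ℤ) : ℤ) : ℚ_[p]) = y - x := by
        push_cast; linear_combination -hxy
      rw [this]
      exact (padic_norm_sub_le_max _ _).trans_lt (max_lt hy hx)
    rw [Padic.norm_intCast_lt_one_iff] at h
    have hi := Finset.mem_range.1 (Finset.mem_coe.1 hi)
    have hj := Finset.mem_range.1 (Finset.mem_coe.1 hj)
    obtain ⟨c, hc⟩ := h
    have hp0 : (0 : ℤ) < p := by exact_mod_cast hp.out.pos
    have h1 : (p : ℤ) * c < p * 1 := by omega
    have h2 : (p : ℤ) * (-1) < p * c := by omega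
    have h3 := lt_of_mul_lt_mul_left h1 hp0.le
    have h4 := lt_of_mul_lt_mul_left h2 hp0.le
    have : c = 0 := by omega
    subst this
    omega
  have h1 := padicHaar_closedBall (p := p)
  rw [hcov, measure_biUnion_finset hdisj] at h1
  · simp only [Set.image_add_left, measure_preimage_add, Finset.sum_const, Finset.card_range,
      nsmul_eq_mul] at h1
    exact ENNReal.eq_inv_of_mul_eq_one_left (by rw [mul_comm]; exact h1)
  · intro i _
    simp only [Set.image_add_left]
    exact (continuous_const_add _).measurable Metric.isOpen_ball.measurableSet

/-- The Haar measure on `ℚ_p ^ d` that gives `ℤ_p ^ d` mass one. -/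
noncomputable abbrev padicHaarPi (p : ℕ) [Fact p.Prime] (d : ℕ) : Measure (Fin d → ℚ_[p]) :=
  Measure.pi fun _ => padicHaar p

theorem padicHaarPi_closedBall : padicHaarPi p d (Metric.closedBall 0 1) = 1 := by
  rw [closedBall_pi _ zero_le_one, Measure.pi_pi]
  simp [padicHaar_closedBall]

/-- Both measures are Haar measures, so they are proportional, and the factor is read off on the
unit ball, which has mass one. -/
theorem padicHaarPi_map_smul {c : ℚ_[p]} (hc : c ≠ 0) :
    (padicHaarPi p d).map (c • ·) =
      (padicHaarPi p d {x | ‖c • x‖ ≤ 1}) • padicHaarPi p d := by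
  have hh : ((padicHaarPi p d).map (c • ·)).IsAddHaarMeasure :=
    (ContinuousLinearEquiv.smulLeft (Units.mk0 c hc) :
      (Fin d → ℚ_[p]) ≃L[ℚ_[p]] (Fin d → ℚ_[p])).isAddHaarMeasure_map (padicHaarPi p d)
  have h := Measure.isAddLeftInvariant_eq_smul ((padicHaarPi p d).map (c • ·)) (padicHaarPi p d)
  have h1 := congrArg (fun μ => μ (Metric.closedBall 0 1)) h
  simp only [Measure.smul_apply, padicHaarPi_closedBall] at h1
  rw [Measure.map_apply (continuous_const_smul c).measurable
    Metric.isClosed_closedBall.measurableSet] at h1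
  have h2 : (c • ·) ⁻¹' Metric.closedBall (0 : Fin d → ℚ_[p]) 1 = {x | ‖c • x‖ ≤ 1} := by
    ext x; simp [norm_smul]
  rw [h2] at h1
  rw [h1]
  conv_lhs => rw [h]
  rw [ENNReal.smul_def, ENNReal.smul_def, smul_eq_mul, mul_one]

theorem integral_padicHaarPi_smul_unit {u : ℚ_[p]} (hu : ‖u‖ = 1) (G : (Fin d → ℚ_[p]) → ℝ) :
    ∫ s, G (u • s) ∂padicHaarPi p d = ∫ s, G s ∂padicHaarPi p d := by
  have hu0 : u ≠ 0 := by intro h; simp [h] at hu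
  have h := padicHaarPi_map_smul (d := d) hu0
  have h2 : {x : Fin d → ℚ_[p] | ‖u • x‖ ≤ 1} = Metric.closedBall 0 1 := by
    ext x; simp [norm_smul, hu]
  rw [h2, padicHaarPi_closedBall, one_smul] at h
  have h3 := (Homeomorph.smulOfNeZero u hu0).measurableEmbedding.integral_map
    (μ := padicHaarPi p d) G
  simp only [Homeomorph.smulOfNeZero_apply] at h3
  rw [← h3]
  exact congrArg (fun μ => ∫ s, G s ∂μ) h

theorem integral_padicHaarPi_smul_p (G : (Fin d → ℚ_[p]) → ℝ) :
    ∫ s, G ((p : ℚ_[p]) • s) ∂padicHaarPi p d = (p : ℝ) ^ d * ∫ s, G s ∂padicHaarPi p d := by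
  have hp0 : (p : ℚ_[p]) ≠ 0 := Nat.cast_ne_zero.2 hp.out.ne_zero
  have hpR : (0 : ℝ) < p := Nat.cast_pos.2 hp.out.pos
  -- The factor for scaling by `p⁻¹` is the measure of `p ℤ_p ^ d`, a product of open unit balls.
  have h := padicHaarPi_map_smul (d := d) (inv_ne_zero hp0)
  have h2 : {x : Fin d → ℚ_[p] | ‖(p : ℚ_[p])⁻¹ • x‖ ≤ 1}
      = Set.univ.pi fun _ => Metric.ball 0 1 := by
    ext x
    rw [Set.mem_ofPred_eq, norm_smul, norm_inv, Padic.norm_p, inv_inv, ← le_inv_mul_iff₀ hpR,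
      mul_one, pi_norm_le_iff_of_nonneg (by positivity), Set.mem_univ_pi]
    refine forall_congr' fun i => ?_
    rw [mem_ball_zero_iff]
    refine ⟨fun h => h.trans_lt ?_, padic_norm_le_inv_of_lt_one⟩
    exact inv_lt_one_of_one_lt₀ (by exact_mod_cast hp.out.one_lt)
  rw [h2, Measure.pi_pi] at h
  simp only [padicHaar_ball, Finset.prod_const, Finset.card_univ, Fintype.card_fin] at h
  have h3 := (Homeomorph.smulOfNeZero (p : ℚ_[p])⁻¹ (inv_ne_zero hp0)).measurableEmbedding.integral_map
    (μ := padicHaarPi p d) (fun s => G ((p : ℚ_[p]) • s))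
  simp only [Homeomorph.smulOfNeZero_apply, smul_smul, mul_inv_cancel₀ hp0, one_smul] at h3
  rw [← h3]
  have h4 := congrArg (fun μ => ∫ s, G ((p : ℚ_[p]) • s) ∂μ) h
  simp only [integral_smul_measure] at h4
  have h5 : ((p : ENNReal)⁻¹ ^ d).toReal = ((p : ℝ) ^ d)⁻¹ := by simp
  rw [h5, smul_eq_mul] at h4
  have h6 := mul_inv_cancel_left₀ (pow_pos hpR d).ne'
    (∫ s, G ((p : ℚ_[p]) • s) ∂padicHaarPi p d)
  rw [← h6, ← h4]

theorem integral_padicHaarPi_smul_zpow (m : ℤ) (G : (Fin d → ℚ_[p]) → ℝ) :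
    ∫ s, G ((p : ℚ_[p]) ^ m • s) ∂padicHaarPi p d
      = ((p : ℝ) ^ m) ^ d * ∫ s, G s ∂padicHaarPi p d := by
  have hp0 : (p : ℚ_[p]) ≠ 0 := Nat.cast_ne_zero.2 hp.out.ne_zero
  have hpR : (p : ℝ) ≠ 0 := Nat.cast_ne_zero.2 hp.out.ne_zero
  induction m generalizing G with
  | zero => simp
  | succ m ih =>
    have h := ih (fun s => G ((p : ℚ_[p]) • s))
    simp only [smul_smul] at h
    rw [integral_padicHaarPi_smul_p] at h
    rw [zpow_add_one₀ hp0, mul_comm, h, zpow_add_one₀ hpR, mul_pow]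
    ring
  | pred m ih =>
    have h := integral_padicHaarPi_smul_p (d := d) (fun s => G ((p : ℚ_[p]) ^ (-(m : ℤ) - 1) • s))
    simp only [smul_smul, ← zpow_add_one₀ hp0, sub_add_cancel] at h
    rw [ih] at h
    have hpd : (p : ℝ) ^ d ≠ 0 := pow_ne_zero _ hpR
    rw [zpow_sub_one₀ hpR, mul_pow, inv_pow]
    field_simp
    linarith

end PadicMeasure

/-! ### Averaging over unipotent elements of `K_p` -/

section PadicAverage

variable {p : ℕ} [hp : Fact p.Prime] {d : ℕ}

theorem continuous_padicK_mulVec (b : Fin d → ℚ_[p]) (w : Fin (d + 2) → ℚ_[p]) :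
    Continuous fun k : padicK p b => k.1.1.mulVec w :=
  continuous_SL_mulVec continuous_subtype_val continuous_const

theorem isClopen_norm_eq_one : IsClopen {x : ℚ_[p] | ‖x‖ = 1} := by
  have h : {x : ℚ_[p] | ‖x‖ = 1} = Metric.sphere 0 1 := by ext x; simp
  rw [h]
  exact IsUltrametricDist.isClopen_sphere _ one_ne_zero

/-- For a unit `u` and integral `z`, the map `s ↦ z + u s` is a measure preserving bijection of `ℤ_p
^ d`. -/
theorem setIntegral_padic_affine {u : ℚ_[p]} (hu : ‖u‖ = 1) {z : Fin d → ℚ_[p]} (hz : ‖z‖ ≤ 1)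
    (F : (Fin d → ℚ_[p]) → ℝ) :
    ∫ s in Metric.closedBall 0 1, F (z + u • s) ∂padicHaarPi p d
      = ∫ s in Metric.closedBall 0 1, F s ∂padicHaarPi p d := by
  have hB : MeasurableSet (Metric.closedBall (0 : Fin d → ℚ_[p]) 1) :=
    Metric.isClosed_closedBall.measurableSet
  have hmem : ∀ s : Fin d → ℚ_[p], s ∈ Metric.closedBall (0 : Fin d → ℚ_[p]) 1 ↔
      z + u • s ∈ Metric.closedBall (0 : Fin d → ℚ_[p]) 1 := by
    intro s
    rw [mem_closedBall_zero_iff, mem_closedBall_zero_iff]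
    have hus : ‖u • s‖ = ‖s‖ := by rw [norm_smul, hu, one_mul]
    have hadd : ∀ x y : Fin d → ℚ_[p], ‖x‖ ≤ 1 → ‖y‖ ≤ 1 → ‖x + y‖ ≤ 1 := by
      intro x y hx hy
      rw [pi_norm_le_iff_of_nonneg zero_le_one] at hx hy ⊢
      exact fun i => (IsUltrametricDist.norm_add_le_max _ _).trans (max_le (hx i) (hy i))
    constructor
    · intro h; exact hadd _ _ hz (hus.trans_le h)
    · intro h
      rw [← hus]
      have := hadd (-z) (z + u • s) (by rwa [norm_neg]) h
      rwa [neg_add_cancel_left] at this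
  rw [← integral_indicator hB, ← integral_indicator hB]
  have h1 : (Metric.closedBall (0 : Fin d → ℚ_[p]) 1).indicator (fun s => F (z + u • s))
      = fun s => (fun y => (Metric.closedBall (0 : Fin d → ℚ_[p]) 1).indicator F (z + y)) (u • s) := by
    funext s
    by_cases h : s ∈ Metric.closedBall (0 : Fin d → ℚ_[p]) 1
    · exact (Set.indicator_of_mem h _).trans (Set.indicator_of_mem ((hmem s).1 h) F).symm
    · exact (Set.indicator_of_notMem h _).trans
        (Set.indicator_of_notMem (fun h' => h ((hmem s).2 h')) F).symm
  rw [h1, integral_padicHaarPi_smul_unit hu, integral_add_left_eq_self]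

/-- Left translation by an Eichler element with parameter `s ∈ ℤ_p ^ d` keeps the first coordinate
of `k w` and adds `x_1 s` to the middle ones. Averaging over `s` and exchanging the integrals
leaves, for each `k` with `|x_1| = 1`, the full integral of `F` over `ℤ_p ^ d`. So on that set the
middle coordinates are equidistributed. -/
theorem integral_padicK_indicator (hp2 : p ≠ 2) (b : Fin d → ℚ_[p]) (hb : ∀ i, ‖b i‖ ≤ 1)
    [MeasurableSpace (padicK p b)] [BorelSpace (padicK p b)] (μ : Measure (padicK p b))
    [μ.IsHaarMeasure] [IsProbabilityMeasure μ] {w : Fin (d + 2) → ℚ_[p]} (hw : ‖w‖ ≤ 1)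
    {F : (Fin d → ℚ_[p]) → ℝ} (hF : Continuous F) {C : ℝ} (hC : ∀ y, ‖F y‖ ≤ C) :
    ∫ k, {k : padicK p b | ‖(k.1.1.mulVec w) 0‖ = 1}.indicator
        (fun k => F (midVec (k.1.1.mulVec w))) k ∂μ
      = μ.real {k | ‖(k.1.1.mulVec w) 0‖ = 1} *
        ∫ s in Metric.closedBall 0 1, F s ∂padicHaarPi p d := by
  set A : Set (padicK p b) := {k | ‖(k.1.1.mulVec w) 0‖ = 1} with hA
  have hcont := continuous_padicK_mulVec b w
  have hAclopen : IsClopen A :=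
    isClopen_norm_eq_one.preimage ((continuous_apply 0).comp hcont)
  set B : Set (Fin d → ℚ_[p]) := Metric.closedBall 0 1 with hBdef
  have hB1 : padicHaarPi p d B = 1 := padicHaarPi_closedBall
  have hfin : IsFiniteMeasure ((padicHaarPi p d).restrict B) := ⟨by simp [hB1]⟩
  set I := ∫ k, A.indicator (fun k => F (midVec (k.1.1.mulVec w))) k ∂μ with hI
  set H : (Fin d → ℚ_[p]) → padicK p b → ℝ := fun s k =>
    A.indicator (fun k => F (midVec (k.1.1.mulVec w) + (k.1.1.mulVec w) 0 • s)) k with hH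
  have hmid : Continuous fun k : padicK p b => midVec (k.1.1.mulVec w) :=
    continuous_pi fun i => (continuous_apply _).comp hcont
  have h0 : Continuous fun k : padicK p b => (k.1.1.mulVec w) 0 := (continuous_apply 0).comp hcont
  have h1 : ∀ s ∈ B, ∫ k, H s k ∂μ = I := by
    intro s hs
    have hs' : ∀ i, ‖s i‖ ≤ 1 := fun i =>
      (norm_le_pi_norm s i).trans (mem_closedBall_zero_iff.1 hs)
    have hE := eichlerSL_mem_padicK hp2 b s hb hs'
    refine Eq.trans ?_ (integral_mul_left_eq_self
      (fun k => A.indicator (fun k => F (midVec (k.1.1.mulVec w))) k) (⟨_, hE⟩ : padicK p b))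
    congr 1
    funext k
    have hk : ((⟨_, hE⟩ * k : padicK p b)).1.1.mulVec w
        = (eichlerMatrix b s).mulVec (k.1.1.mulVec w) := by
      rw [Subgroup.coe_mul, Matrix.SpecialLinearGroup.coe_mul, ← Matrix.mulVec_mulVec]; rfl
    have hk0 : ((⟨_, hE⟩ * k : padicK p b)).1.1.mulVec w 0 = k.1.1.mulVec w 0 := by
      rw [hk, eichlerMatrix_mulVec, mkVec_zero]
    have hkm : midVec (((⟨_, hE⟩ * k : padicK p b)).1.1.mulVec w)
        = midVec (k.1.1.mulVec w) + (k.1.1.mulVec w) 0 • s := by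
      rw [hk, eichlerMatrix_mulVec, midVec_mkVec]; rfl
    have hmemA : (⟨_, hE⟩ * k : padicK p b) ∈ A ↔ k ∈ A := by
      simp only [hA, Set.mem_ofPred_eq, hk0]
    by_cases hkA : k ∈ A
    · simp only [hH]
      rw [Set.indicator_of_mem hkA, Set.indicator_of_mem (hmemA.2 hkA), hkm]
    · simp only [hH]
      rw [Set.indicator_of_notMem hkA, Set.indicator_of_notMem (fun h => hkA (hmemA.1 h))]
  have hHc : Continuous (Function.uncurry H) := by
    have : Function.uncurry H = (Prod.snd ⁻¹' A).indicator (fun q : (Fin d → ℚ_[p]) × padicK p b =>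
        F (midVec (q.2.1.1.mulVec w) + (q.2.1.1.mulVec w) 0 • q.1)) := by
      funext q; rfl
    rw [this]
    -- The unit sphere is clopen, so cutting off by `A` preserves continuity.
    refine (hF.comp ?_).indicator (fun a ha => ?_)
    · exact (hmid.comp continuous_snd).add ((h0.comp continuous_snd).smul continuous_fst)
    · rw [(hAclopen.preimage continuous_snd).frontier_eq] at ha
      exact absurd ha (Set.notMem_empty _)
  have hHb : ∀ q, ‖Function.uncurry H q‖ ≤ C := by
    intro q
    exact (norm_indicator_le_norm_self (fun k : padicK p b =>
      F (midVec (k.1.1.mulVec w) + (k.1.1.mulVec w) 0 • q.1)) q.2).trans (hC _)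
  have hint : Integrable (Function.uncurry H) (((padicHaarPi p d).restrict B).prod μ) :=
    Integrable.of_bound hHc.aestronglyMeasurable C (Filter.Eventually.of_forall hHb)
  have h2 : I = ∫ s in B, ∫ k, H s k ∂μ ∂padicHaarPi p d := by
    rw [setIntegral_congr_fun Metric.isClosed_closedBall.measurableSet h1, setIntegral_const,
      measureReal_def, hB1]
    simp
  rw [h2, integral_integral_swap hint]
  have h3 : ∀ k, ∫ s in B, H s k ∂padicHaarPi p d
      = A.indicator (fun _ => ∫ s in B, F s ∂padicHaarPi p d) k := by
    intro k
    by_cases hkA : k ∈ A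
    · simp only [hH]
      simp only [Set.indicator_of_mem hkA]
      refine setIntegral_padic_affine hkA ?_ F
      rw [pi_norm_le_iff_of_nonneg zero_le_one]
      intro i
      exact (norm_le_pi_norm (k.1.1.mulVec w) _).trans ((norm_padicK_mulVec k.2 w).trans_le hw)
    · simp only [hH]
      simp [Set.indicator_of_notMem hkA]
  simp only [h3]
  rw [integral_indicator hAclopen.isOpen.measurableSet, setIntegral_const, smul_eq_mul]

end PadicAverage

/-! ### The asymptotic formula at a finite place -/

section PadicLocal

variable {p : ℕ} [hp : Fact p.Prime] {d : ℕ}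

theorem norm_stdForm_le (hp2 : p ≠ 2) (b : Fin d → ℚ_[p]) (hb : ∀ i, ‖b i‖ ≤ 1)
    (x : Fin (d + 2) → ℚ_[p]) : ‖stdForm b x‖ ≤ ‖x‖ ^ 2 := by
  refine (IsUltrametricDist.norm_add_le_max _ _).trans (max_le ?_ ?_)
  · rw [norm_mul, norm_mul, norm_two_padic hp2, one_mul, pow_two]
    exact mul_le_mul (norm_le_pi_norm x _) (norm_le_pi_norm x _) (norm_nonneg _) (norm_nonneg _)
  · refine padic_norm_sum_le _ _ (by positivity) fun i _ => ?_
    rw [norm_mul, norm_pow]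
    exact (mul_le_of_le_one_left (by positivity) (hb i)).trans
      (pow_le_pow_left₀ (norm_nonneg _) (norm_le_pi_norm x _) 2)

/-- A continuous function of compact support in `{x_1 ≠ 0}` vanishes unless `x_1` is bounded away
from zero and `x` is bounded. -/
theorem exists_support_bounds {𝕜 : Type*} [NormedField 𝕜]
    {φ : (Fin (d + 2) → 𝕜) → ℝ} (hφc : HasCompactSupport φ) (hφs : tsupport φ ⊆ {x | x 0 ≠ 0}) :
    ∃ r > 0, ∃ C > 0, ∀ x ∈ tsupport φ, r ≤ ‖x 0‖ ∧ ‖x‖ ≤ C := by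
  obtain ⟨r, hr, h⟩ := hφc.isCompact.exists_forall_le' (f := fun x => ‖x 0‖) (a := 0)
    (by fun_prop) (fun x hx => norm_pos_iff.2 (show x 0 ≠ 0 from hφs hx))
  obtain ⟨C, hC, h'⟩ := hφc.isCompact.isBounded.exists_pos_norm_le
  exact ⟨r, hr, C, hC, fun x hx => ⟨h x hx, h' x hx⟩⟩

theorem p_ne_zero_padic : (p : ℚ_[p]) ≠ 0 := Nat.cast_ne_zero.2 hp.out.ne_zero

/-- The transformation `diag(p^t, 1, …, 1, p^{-t})`. -/
noncomputable abbrev padicDiag (p : ℕ) [hp : Fact p.Prime] (d : ℕ) (t : ℤ) :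
    Matrix.SpecialLinearGroup (Fin (d + 2)) ℚ_[p] :=
  diagSL d ((p : ℚ_[p]) ^ t) (zpow_ne_zero _ p_ne_zero_padic)

/-- The transformation divides `|x_1|` by `p ^ t`, multiplies `|x_n|` by `p ^ t` and keeps the
middle. If the image is bounded by `C` and its first coordinate is at least `r`, then `|x_1| ≥ r p ^
t > C` exceeds all the other coordinates. -/
theorem padicDiag_large {r C : ℝ} {t : ℤ} (ht : 0 ≤ t)
    (hrC : C < r * (p : ℝ) ^ t) {x : Fin (d + 2) → ℚ_[p]}
    (h0 : r ≤ ‖((padicDiag p d t).1.mulVec x) 0‖) (hC : ‖(padicDiag p d t).1.mulVec x‖ ≤ C) :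
    r * (p : ℝ) ^ t ≤ ‖x 0‖ ∧ ‖x‖ = ‖x 0‖ ∧ (∀ i, ‖midVec x i‖ ≤ C) ∧
      ‖x (Fin.last (d + 1))‖ ≤ C := by
  have hpR : (0 : ℝ) < p := Nat.cast_pos.2 hp.out.pos
  have hp1 : (1 : ℝ) ≤ (p : ℝ) ^ t :=
    one_le_zpow₀ (by exact_mod_cast hp.out.one_lt.le) ht
  have hpt : (0 : ℝ) < (p : ℝ) ^ t := by positivity
  have hm := fun i : Fin d => (norm_le_pi_norm _ i.succ.castSucc).trans hC
  have hl := (norm_le_pi_norm _ (Fin.last (d + 1))).trans hC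
  rw [diagSL_mulVec] at h0 hl hm
  simp only [mkVec_mid'] at hm
  rw [mkVec_zero, norm_mul, Padic.norm_p_zpow, zpow_neg, ← div_eq_inv_mul, le_div_iff₀ hpt] at h0
  rw [mkVec_last, norm_mul, norm_inv, Padic.norm_p_zpow, zpow_neg, inv_inv] at hl
  have hl' : ‖x (Fin.last (d + 1))‖ ≤ C :=
    (le_mul_of_one_le_left (norm_nonneg _) hp1).trans hl
  refine ⟨h0, le_antisymm ?_ (norm_le_pi_norm x 0), hm, hl'⟩
  have hC0 : C ≤ ‖x 0‖ := (hrC.trans_le h0).le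
  rw [eq_mkVec x]
  simp only [mkVec_zero]
  exact norm_mkVec_le le_rfl (fun i => (hm i).trans hC0) (hl'.trans hC0)

theorem continuous_levelPoint {𝕜 : Type*} [NormedField 𝕜] (a : Fin d → 𝕜) (r ζ : 𝕜) :
    Continuous (levelPoint a r ζ) :=
  continuous_mkVec continuous_const continuous_id (by fun_prop)

variable (b : Fin d → ℚ_[p]) [MeasurableSpace (padicK p b)] [BorelSpace (padicK p b)]
  (μ : Measure (padicK p b)) [μ.IsHaarMeasure] [IsProbabilityMeasure μ]

/-- The identity is exact, not asymptotic, once `p C ≤ r p ^ t`. Unless `‖w‖ ≥ r p ^ t` and `‖q(w)‖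
≤ C ^ 2`, both sides vanish. Otherwise `w` is moved to a multiple of the normal form, the support
condition restricts the integral to `|x_1| = ‖x‖`, and the middle coordinates are equidistributed
there. -/
theorem padic_orbit_integral (hp2 : p ≠ 2) (hd : d = 1 ∨ d = 2)
    (hb : ∀ i, ‖b i‖ = 1 ∨ ‖b i‖ = (p : ℝ)⁻¹)
    (hsplit : ∀ i j : Fin d, i ≠ j → IsSquare (-(b i * b j)) → ¬ (‖b i‖ < 1 ∧ ‖b j‖ < 1))
    {φ : (Fin (d + 2) → ℚ_[p]) → ℝ} (hφ : Continuous φ) (hφc : HasCompactSupport φ)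
    (hinv : ∀ (u : ℚ_[p]) (hu : u ≠ 0), ‖u‖ = 1 → ∀ x, φ ((diagSL d u hu).1.mulVec x) = φ x)
    {r C : ℝ} (hC : 0 < C) (hrC : ∀ x, φ x ≠ 0 → r ≤ ‖x 0‖ ∧ ‖x‖ ≤ C)
    {t : ℤ} (ht : 0 ≤ t) (htC : p * C ≤ r * (p : ℝ) ^ t)
    {w : Fin (d + 2) → ℚ_[p]} (hw : w ≠ 0) :
    ((p : ℝ) ^ t) ^ d * ∫ k, φ ((padicDiag p d t).1.mulVec (k.1.1.mulVec w)) ∂μ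
      = μ.real {k | ‖k.1.1 0 0‖ = 1} *
        padicJ p b φ ((p : ℚ_[p]) ^ (t - padicExp p w)) (stdForm b w) := by
  have hp0 : (p : ℚ_[p]) ≠ 0 := p_ne_zero_padic
  have hpR : (0 : ℝ) < p := Nat.cast_pos.2 hp.out.pos
  have hp1 : (1 : ℝ) < p := by exact_mod_cast hp.out.one_lt
  have hpi : (p : ℝ)⁻¹ < 1 := inv_lt_one_of_one_lt₀ hp1
  have hpt : (0 : ℝ) < (p : ℝ) ^ t := by positivity
  have hb1 : ∀ i, ‖b i‖ ≤ 1 := fun i => by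
    rcases hb i with h | h
    · exact h.le
    · rw [h]; exact hpi.le
  have hCt : C < r * (p : ℝ) ^ t := lt_of_lt_of_le (by nlinarith) htC
  set m := padicExp p w with hm
  set ζ := stdForm b w with hζ
  have hwm : ‖w‖ = (p : ℝ) ^ m := norm_eq_zpow_padicExp p w hw
  have hpm : (0 : ℝ) < (p : ℝ) ^ m := by positivity
  have hnorm : ‖(p : ℚ_[p]) ^ (t - m)‖ = (p : ℝ) ^ m / (p : ℝ) ^ t := by
    rw [Padic.norm_p_zpow, neg_sub, zpow_sub₀ hpR.ne']
  -- both sides vanish unless `‖w‖` is large and the form is bounded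
  by_cases hcase : r * (p : ℝ) ^ t ≤ (p : ℝ) ^ m ∧ ‖ζ‖ ≤ C ^ 2
  swap
  · have hL : ∀ k : padicK p b, φ ((padicDiag p d t).1.mulVec (k.1.1.mulVec w)) = 0 := by
      intro k
      by_contra hne
      refine hcase ?_
      obtain ⟨h1, h2⟩ := hrC _ hne
      obtain ⟨h3, h4, -⟩ := padicDiag_large ht hCt h1 h2
      refine ⟨?_, ?_⟩
      · rw [← h4, norm_padicK_mulVec k.2, hwm] at h3; exact h3
      · have h5 : stdForm b ((padicDiag p d t).1.mulVec (k.1.1.mulVec w)) = ζ := by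
          rw [stdForm_diagSL, ((mem_padicK_iff b _).1 k.2).1 w]
        rw [← h5]
        exact (norm_stdForm_le hp2 b hb1 _).trans (pow_le_pow_left₀ (norm_nonneg _) h2 2)
    have hR : ∀ y, φ (levelPoint b ((p : ℚ_[p]) ^ (t - m)) ζ y) = 0 := by
      intro y
      by_contra hne
      refine hcase ?_
      obtain ⟨h1, h2⟩ := hrC _ hne
      refine ⟨?_, ?_⟩
      · rw [levelPoint_eq_mkVec, mkVec_zero, hnorm, le_div_iff₀ hpt] at h1; exact h1
      · have h5 := stdForm_levelPoint b ((p : ℚ_[p]) ^ (t - m)) ζ (zpow_ne_zero _ hp0) y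
        rw [← h5]
        exact (norm_stdForm_le hp2 b hb1 _).trans (pow_le_pow_left₀ (norm_nonneg _) h2 2)
    simp only [padicJ, hL, hR, integral_zero, mul_zero]
  obtain ⟨hm1, hζC⟩ := hcase
  -- normal form of the unit vector
  set w' : Fin (d + 2) → ℚ_[p] := (p : ℚ_[p]) ^ m • w with hw'
  have hw'1 : ‖w'‖ = 1 := by
    rw [hw', norm_smul, Padic.norm_p_zpow, hwm, zpow_neg, inv_mul_cancel₀ hpm.ne']
  have hζ' : stdForm b w' = ((p : ℚ_[p]) ^ m) ^ 2 * ζ := stdForm_smul b _ w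
  have hζ'n : ‖stdForm b w'‖ ≤ ((p : ℝ)⁻¹) ^ 2 := by
    rw [hζ', norm_mul, norm_pow, Padic.norm_p_zpow, zpow_neg]
    -- The factor `p` in the threshold makes the form value of the unit vector divisible by `p ^ 2`,
    -- as the normal form requires.
    have h1 : p * C ≤ (p : ℝ) ^ m := htC.trans hm1
    have h2 : ((p : ℝ) ^ m)⁻¹ * C ≤ (p : ℝ)⁻¹ := by
      rw [inv_mul_le_iff₀ hpm, ← div_eq_mul_inv, le_div_iff₀ hpR]; linarith
    calc (((p : ℝ) ^ m)⁻¹) ^ 2 * ‖ζ‖ ≤ (((p : ℝ) ^ m)⁻¹) ^ 2 * C ^ 2 := by gcongr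
      _ = (((p : ℝ) ^ m)⁻¹ * C) ^ 2 := by ring
      _ ≤ _ := pow_le_pow_left₀ (by positivity) h2 2
  obtain ⟨k₀, hk₀, hk₀w⟩ := exists_padicK_normal_form hp2 hd b hb hsplit w' hw'1 hζ'n
  set w₀ : Fin (d + 2) → ℚ_[p] := mkVec 1 0 (stdForm b w' / 2) with hw₀
  have hw₀1 : ‖w₀‖ = 1 := by rw [← hk₀w, norm_padicK_mulVec hk₀, hw'1]
  have hqw₀ : stdForm b w₀ = ((p : ℚ_[p]) ^ m) ^ 2 * ζ := by
    rw [← hk₀w, ((mem_padicK_iff b _).1 hk₀).1 w', hζ']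
  have hww₀ : w = (k₀⁻¹).1.mulVec ((p : ℚ_[p]) ^ (-m) • w₀) := by
    rw [Matrix.mulVec_smul, ← hk₀w, Matrix.mulVec_mulVec, ← Matrix.SpecialLinearGroup.coe_mul,
      inv_mul_cancel, Matrix.SpecialLinearGroup.coe_one, Matrix.one_mulVec, hw', smul_smul,
      ← zpow_add₀ hp0]
    simp
  -- Right invariance replaces `w` by `p ^ (-m) w₀` in the same orbit.
  have hint1 : ∫ k : padicK p b, φ ((padicDiag p d t).1.mulVec (k.1.1.mulVec w)) ∂μ
      = ∫ k : padicK p b,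
        φ ((padicDiag p d t).1.mulVec ((p : ℚ_[p]) ^ (-m) • k.1.1.mulVec w₀)) ∂μ := by
    rw [← integral_mul_right_of_isProbability μ (fun k : padicK p b =>
        φ ((padicDiag p d t).1.mulVec ((p : ℚ_[p]) ^ (-m) • k.1.1.mulVec w₀)))
      (⟨k₀, hk₀⟩⁻¹ : padicK p b)]
    congr 1
    funext k
    rw [Subgroup.coe_mul, Matrix.SpecialLinearGroup.coe_mul, ← Matrix.mulVec_mulVec,
      ← Matrix.mulVec_smul, ← Matrix.mulVec_smul]
    conv_lhs => rw [hww₀]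
    rfl
  set G : (Fin d → ℚ_[p]) → ℝ := fun y => φ (levelPoint b ((p : ℚ_[p]) ^ (t - m)) ζ y) with hG
  have hGc : Continuous G := hφ.comp (continuous_levelPoint b _ _)
  obtain ⟨D, hD⟩ := hφc.exists_bound_of_continuous hφ
  set F : (Fin d → ℚ_[p]) → ℝ := fun z => G ((p : ℚ_[p]) ^ (-m) • z) with hF
  have hFc : Continuous F := hGc.comp (continuous_const_smul _)
  have hpoint : ∀ k : padicK p b,
      φ ((padicDiag p d t).1.mulVec ((p : ℚ_[p]) ^ (-m) • k.1.1.mulVec w₀))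
        = {k : padicK p b | ‖(k.1.1.mulVec w₀) 0‖ = 1}.indicator
          (fun k => F (midVec (k.1.1.mulVec w₀))) k := by
    intro k
    set v := k.1.1.mulVec w₀ with hv
    set x : Fin (d + 2) → ℚ_[p] := (p : ℚ_[p]) ^ (-m) • v with hx
    have hqx : stdForm b x = ζ := by
      rw [hx, stdForm_smul, hv, ((mem_padicK_iff b _).1 k.2).1 w₀, hqw₀, ← mul_assoc, ← mul_pow,
        ← zpow_add₀ hp0]
      simp
    by_cases hk : ‖v 0‖ = 1
    · rw [Set.indicator_of_mem (show k ∈ {k : padicK p b | ‖(k.1.1.mulVec w₀) 0‖ = 1} from hk)]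
      have hv0 : v 0 ≠ 0 := by intro h; simp [h] at hk
      -- The unit invariance of `φ` normalises the first coordinate to exactly `p ^ (t - m)`. The
      -- argument becomes a level point whose middle coordinates are those of `p ^ (-m) v`.
      rw [← hinv (v 0)⁻¹ (inv_ne_zero hv0) (by rw [norm_inv, hk, inv_one])]
      simp only [hF, hG]
      congr 1
      have h0 : ((diagSL d (v 0)⁻¹ (inv_ne_zero hv0)).1.mulVec ((padicDiag p d t).1.mulVec x)) 0
          = (p : ℚ_[p]) ^ (t - m) := by
        rw [diagSL_mulVec, mkVec_zero, diagSL_mulVec, mkVec_zero, hx, Pi.smul_apply, smul_eq_mul,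
          sub_eq_add_neg, zpow_add₀ hp0]
        field_simp
      rw [eq_levelPoint b ((diagSL d (v 0)⁻¹ (inv_ne_zero hv0)).1.mulVec
        ((padicDiag p d t).1.mulVec x)) (by rw [h0]; exact zpow_ne_zero _ hp0), h0,
        stdForm_diagSL, stdForm_diagSL, hqx, diagSL_mulVec, midVec_mkVec, diagSL_mulVec,
        midVec_mkVec]
      rfl
    -- Where `φ` does not vanish the first coordinate carries the norm of `v`, which is `1`.
    · rw [Set.indicator_of_notMem (show k ∉ {k : padicK p b | ‖(k.1.1.mulVec w₀) 0‖ = 1} from hk)]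
      by_contra hne
      obtain ⟨h1, h2⟩ := hrC _ hne
      obtain ⟨-, h4, -⟩ := padicDiag_large ht hCt h1 h2
      refine hk ?_
      have hvn : ‖v‖ = 1 := by rw [hv, norm_padicK_mulVec k.2, hw₀1]
      rw [hx, norm_smul, Pi.smul_apply, norm_smul, hvn] at h4
      have hne : ‖(p : ℚ_[p]) ^ (-m)‖ ≠ 0 := norm_ne_zero_iff.2 (zpow_ne_zero _ hp0)
      exact (mul_left_cancel₀ hne h4).symm
  rw [hint1]
  simp only [hpoint]
  rw [integral_padicK_indicator hp2 b hb1 μ hw₀1.le hFc (fun y => hD _)]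
  -- The first coordinate of `k w₀` is `k_{11}` plus an element of norm less than one, so the set,
  -- and with it the constant, does not depend on `w`.
  have hset : {k : padicK p b | ‖(k.1.1.mulVec w₀) 0‖ = 1} = {k | ‖k.1.1 0 0‖ = 1} := by
    ext k
    have hk := ((mem_padicK_iff b _).1 k.2).2
    have h1 : (k.1.1.mulVec w₀) 0 = k.1.1 0 0 + k.1.1 0 (Fin.last (d + 1)) * (stdForm b w' / 2) := by
      rw [Matrix.mulVec, dotProduct, sum_coord]
      simp only [hw₀, mkVec_zero, mkVec_last, mkVec_mid']
      simp
    have h2 : ‖k.1.1 0 (Fin.last (d + 1)) * (stdForm b w' / 2)‖ < 1 := by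
      rw [norm_mul, norm_div, norm_two_padic hp2, div_one]
      refine (mul_le_of_le_one_left (norm_nonneg _) (hk _ _)).trans_lt (hζ'n.trans_lt ?_)
      exact pow_lt_one₀ (by positivity) hpi two_ne_zero
    simp only [Set.mem_ofPred_eq, h1]
    constructor
    · intro h
      by_contra hne
      have h3 : ‖k.1.1 0 0‖ < 1 := lt_of_le_of_ne (hk _ _) hne
      have := (IsUltrametricDist.norm_add_le_max (k.1.1 0 0)
        (k.1.1 0 (Fin.last (d + 1)) * (stdForm b w' / 2))).trans_lt (max_lt h3 h2)
      exact this.ne h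
    · intro h
      rw [IsUltrametricDist.norm_add_eq_max_of_norm_ne_norm (by rw [h]; exact h2.ne'), h]
      exact max_eq_left h2.le
  rw [hset]
  -- Where `F z ≠ 0`, one has `p ^ m ‖z‖ ≤ C ≤ p ^ m`, so `z` lies in `ℤ_p ^ d`.
  have hFB : ∫ s in Metric.closedBall 0 1, F s ∂padicHaarPi p d = ∫ s, F s ∂padicHaarPi p d := by
    refine setIntegral_eq_integral_of_forall_compl_eq_zero fun z hz => ?_
    by_contra hne
    refine hz ?_
    obtain ⟨-, h2⟩ := hrC _ hne
    rw [mem_closedBall_zero_iff]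
    have h3 : ‖(p : ℚ_[p]) ^ (-m) • z‖ ≤ C := by
      rw [pi_norm_le_iff_of_nonneg hC.le]
      intro i
      refine le_trans ?_ ((norm_le_pi_norm _ i.succ.castSucc).trans h2)
      rw [levelPoint_eq_mkVec, mkVec_mid']
    rw [norm_smul, Padic.norm_p_zpow, neg_neg] at h3
    have h4 : (p : ℝ) ^ m * ‖z‖ ≤ (p : ℝ) ^ m * 1 := by linarith
    exact le_of_mul_le_mul_left h4 hpm
  rw [hFB, hF, integral_padicHaarPi_smul_zpow, padicJ, hnorm, zpow_neg]
  have e1 : ((p : ℝ) ^ t) ≠ 0 := hpt.ne'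
  have e2 : ((p : ℝ) ^ m) ≠ 0 := hpm.ne'
  simp only [hG, div_pow, one_div, inv_pow]
  field_simp

/-- The constant is the inverse of the mass of `{|k_{11}| = 1}`. As the formula without `η` is
exact, the error comes only from replacing `η` at `k⁻¹ e_1` by its value at the direction of `w`.
That replacement matters only for `k` with `a_t k w` in the support, so the error is relative. -/
theorem exists_padic_local_asymptotic (hp2 : p ≠ 2) (hd : d = 1 ∨ d = 2)
    (hb : ∀ i, ‖b i‖ = 1 ∨ ‖b i‖ = (p : ℝ)⁻¹)
    (hsplit : ∀ i j : Fin d, i ≠ j → IsSquare (-(b i * b j)) → ¬ (‖b i‖ < 1 ∧ ‖b j‖ < 1)) :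
    ∃ c : ℝ, 0 < c ∧ ∀ (φ : (Fin (d + 2) → ℚ_[p]) → ℝ), Continuous φ → HasCompactSupport φ →
      tsupport φ ⊆ {x | x 0 ≠ 0} →
      (∀ (u : ℚ_[p]) (hu : u ≠ 0), ‖u‖ = 1 → ∀ x, φ ((diagSL d u hu).1.mulVec x) = φ x) →
      ∀ η : (Fin (d + 2) → ℚ_[p]) → ℝ, ContinuousOn η {x | ‖x‖ = 1} →
      (∀ u : ℚ_[p], ‖u‖ = 1 → ∀ x, ‖x‖ = 1 → η (u • x) = η x) →
      ∀ N : Set (Fin (d + 2) → ℚ_[p]), tsupport φ ⊆ N →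
      ∀ δ : ℝ, 0 < δ → ∃ t₀ : ℤ, 0 < t₀ ∧ ∀ t : ℤ, t₀ < t → ∀ w : Fin (d + 2) → ℚ_[p], w ≠ 0 →
        |padicJ p b φ ((p : ℚ_[p]) ^ (t - padicExp p w)) (stdForm b w) *
            η ((p : ℚ_[p]) ^ padicExp p w • w) -
          c * (((p : ℝ) ^ t) ^ d * ∫ k, φ ((padicDiag p d t).1.mulVec (k.1.1.mulVec w)) *
            η ((k.1⁻¹).1.mulVec (Pi.single 0 1)) ∂μ)|
        ≤ δ * (((p : ℝ) ^ t) ^ d * μ.real {k | (padicDiag p d t).1.mulVec (k.1.1.mulVec w) ∈ N}) := by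
  have hp0 : (p : ℚ_[p]) ≠ 0 := p_ne_zero_padic
  have hpR : (0 : ℝ) < p := Nat.cast_pos.2 hp.out.pos
  have hp1 : (1 : ℝ) < p := by exact_mod_cast hp.out.one_lt
  set κ := μ.real {k : padicK p b | ‖k.1.1 0 0‖ = 1} with hκ
  have hκ0 : 0 < κ := by
    have hopen : IsOpen {k : padicK p b | ‖k.1.1 0 0‖ = 1} := by
      have h1 : Continuous fun k : padicK p b => k.1.1 0 0 :=
        (continuous_apply 0).comp
          (Matrix.SpecialLinearGroup.continuous_apply _ continuous_subtype_val 0)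
      exact isClopen_norm_eq_one.isOpen.preimage h1
    have hne : {k : padicK p b | ‖k.1.1 0 0‖ = 1}.Nonempty := ⟨1, by simp⟩
    exact ENNReal.toReal_pos (hopen.measure_pos μ hne).ne' (measure_ne_top _ _)
  refine ⟨κ⁻¹, inv_pos.2 hκ0, ?_⟩
  intro φ hφ hφc hφs hinv η hη hηu N hN δ hδ
  obtain ⟨r, hr, C, hC, hrC'⟩ := exists_support_bounds hφc hφs
  have hrC : ∀ x, φ x ≠ 0 → r ≤ ‖x 0‖ ∧ ‖x‖ ≤ C := fun x hx => hrC' x (subset_tsupport φ hx)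
  obtain ⟨D', hD'⟩ := hφc.exists_bound_of_continuous hφ
  set D := max D' 1 with hDdef
  have hD : ∀ x, ‖φ x‖ ≤ D := fun x => (hD' x).trans (le_max_left _ _)
  have hD0 : 0 < D := lt_of_lt_of_le one_pos (le_max_right _ _)
  -- Chosen so that `κ⁻¹ D δ₁ = δ`.
  set δ₁ := κ * δ / D with hδ₁
  have hδ₁0 : 0 < δ₁ := by positivity
  -- uniform continuity on the unit sphere
  have hsph : {x : Fin (d + 2) → ℚ_[p] | ‖x‖ = 1} = Metric.sphere 0 1 := by ext x; simp
  have hcomp : IsCompact {x : Fin (d + 2) → ℚ_[p] | ‖x‖ = 1} := by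
    rw [hsph]; exact isCompact_sphere _ _
  obtain ⟨ρ, hρ, hunif⟩ := Metric.uniformContinuousOn_iff.1
    (hcomp.uniformContinuousOn_of_continuous hη) δ₁ hδ₁0
  -- the threshold
  obtain ⟨n, hn⟩ := pow_unbounded_of_one_lt (max (p * C / r) (C / (ρ * r))) hp1
  refine ⟨n + 1, by positivity, fun t ht w hw => ?_⟩
  have ht0 : 0 ≤ t := by omega
  have hnt : (p : ℝ) ^ n ≤ (p : ℝ) ^ t := by
    rw [← zpow_natCast]
    exact zpow_le_zpow_right₀ hp1.le (by omega)
  have hpt : (0 : ℝ) < (p : ℝ) ^ t := by positivity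
  have htC : p * C ≤ r * (p : ℝ) ^ t := by
    have := ((le_max_left _ _).trans_lt hn).trans_le hnt
    rw [div_lt_iff₀ hr] at this; linarith
  have htρ : C < ρ * (r * (p : ℝ) ^ t) := by
    have := ((le_max_right _ _).trans_lt hn).trans_le hnt
    rw [div_lt_iff₀ (by positivity)] at this; linarith
  have hCt : C < r * (p : ℝ) ^ t := lt_of_lt_of_le (by nlinarith) htC
  set w' : Fin (d + 2) → ℚ_[p] := (p : ℚ_[p]) ^ padicExp p w • w with hw'
  have hwm : ‖w‖ = (p : ℝ) ^ padicExp p w := norm_eq_zpow_padicExp p w hw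
  have hpm : (0 : ℝ) < (p : ℝ) ^ padicExp p w := by positivity
  have hw'1 : ‖w'‖ = 1 := by
    rw [hw', norm_smul, Padic.norm_p_zpow, hwm, zpow_neg, inv_mul_cancel₀ hpm.ne']
  have hexact := padic_orbit_integral b μ hp2 hd hb hsplit hφ hφc hinv hC hrC ht0 htC hw
  have hunit : ∀ k : padicK p b,
      ‖((k.1⁻¹).1.mulVec (Pi.single 0 1) : Fin (d + 2) → ℚ_[p])‖ = 1 := by
    intro k
    rw [norm_padicK_mulVec (inv_mem k.2), Pi.norm_single]; simp
  have hclose : ∀ k : padicK p b, φ ((padicDiag p d t).1.mulVec (k.1.1.mulVec w)) ≠ 0 →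
      |η w' - η ((k.1⁻¹).1.mulVec (Pi.single 0 1))| ≤ δ₁ := by
    intro k hk
    obtain ⟨h1, h2⟩ := hrC _ hk
    obtain ⟨h3, h4, h5, h6⟩ := padicDiag_large ht0 hCt h1 h2
    set x := k.1.1.mulVec w with hx
    have hxw : ‖x‖ = (p : ℝ) ^ padicExp p w := by rw [hx, norm_padicK_mulVec k.2, hwm]
    -- This is the first coordinate of `p ^ m k w`, a unit since `x_1` carries the norm. Unit
    -- invariance of `η` allows `u e_1` in place of `e_1`, and `w'` is within `C p ^ (-m) < ρ` of
    -- `k⁻¹ (u e_1)`.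
    set u := (p : ℚ_[p]) ^ padicExp p w * x 0 with hu
    have hu1 : ‖u‖ = 1 := by
      rw [hu, norm_mul, ← h4, hxw, Padic.norm_p_zpow, zpow_neg, inv_mul_cancel₀ hpm.ne']
    rw [← hηu u hu1 _ (hunit k), ← Matrix.mulVec_smul]
    have hkw' : w' = (k.1⁻¹).1.mulVec ((p : ℚ_[p]) ^ padicExp p w • x) := by
      rw [hx, Matrix.mulVec_smul, Matrix.mulVec_mulVec, ← Matrix.SpecialLinearGroup.coe_mul,
        inv_mul_cancel, Matrix.SpecialLinearGroup.coe_one, Matrix.one_mulVec]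
    have hdist : dist w' ((k.1⁻¹).1.mulVec (u • Pi.single 0 1)) < ρ := by
      rw [dist_eq_norm, hkw', ← Matrix.mulVec_sub, norm_padicK_mulVec (inv_mem k.2)]
      have hvec : (p : ℚ_[p]) ^ padicExp p w • x - u • (Pi.single 0 1 : Fin (d + 2) → ℚ_[p])
          = (p : ℚ_[p]) ^ padicExp p w • mkVec 0 (midVec x) (x (Fin.last (d + 1))) := by
        apply vec_ext
        · simp [hu]
        · intro i
          simp only [Pi.sub_apply, Pi.smul_apply, mkVec_mid', Pi.single_eq_of_ne (mid_ne_zero i),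
            smul_zero, sub_zero]
          rfl
        · simp
      have hle : ‖mkVec 0 (midVec x) (x (Fin.last (d + 1)))‖ ≤ C :=
        norm_mkVec_le (by simpa using hC.le) h5 h6
      rw [hvec, norm_smul, Padic.norm_p_zpow, zpow_neg, inv_mul_lt_iff₀ hpm]
      refine hle.trans_lt (htρ.trans_le ?_)
      rw [mul_comm]
      refine mul_le_mul_of_nonneg_right ?_ hρ.le
      rw [← hxw, h4]; exact h3
    have hmem : ‖((k.1⁻¹).1.mulVec (u • Pi.single 0 1) : Fin (d + 2) → ℚ_[p])‖ = 1 := by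
      rw [Matrix.mulVec_smul, norm_smul, hu1, one_mul, hunit k]
    have := hunif w' hw'1 _ hmem hdist
    rw [Real.dist_eq] at this
    exact this.le
  -- measurability
  have hcw : Continuous fun k : padicK p b => (padicDiag p d t).1.mulVec (k.1.1.mulVec w) :=
    continuous_const.matrix_mulVec (continuous_padicK_mulVec b w)
  have hc1 : Continuous fun k : padicK p b => φ ((padicDiag p d t).1.mulVec (k.1.1.mulVec w)) :=
    hφ.comp hcw
  have hc2 : Continuous fun k : padicK p b => η ((k.1⁻¹).1.mulVec (Pi.single 0 1)) := by
    refine hη.comp_continuous ?_ hunit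
    exact continuous_SL_mulVec (continuous_inv.comp continuous_subtype_val) continuous_const
  have hi1 : Integrable (fun k : padicK p b =>
      φ ((padicDiag p d t).1.mulVec (k.1.1.mulVec w)) * η w') μ :=
    (hc1.mul continuous_const).integrable_of_hasCompactSupport (HasCompactSupport.of_compactSpace _)
  have hi2 : Integrable (fun k : padicK p b => φ ((padicDiag p d t).1.mulVec (k.1.1.mulVec w)) *
      η ((k.1⁻¹).1.mulVec (Pi.single 0 1))) μ :=
    (hc1.mul hc2).integrable_of_hasCompactSupport (HasCompactSupport.of_compactSpace _)
  have hJ : padicJ p b φ ((p : ℚ_[p]) ^ (t - padicExp p w)) (stdForm b w)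
      = κ⁻¹ * (((p : ℝ) ^ t) ^ d *
        ∫ k, φ ((padicDiag p d t).1.mulVec (k.1.1.mulVec w)) ∂μ) := by
    rw [hexact, inv_mul_cancel_left₀ hκ0.ne']
  have hdiff : padicJ p b φ ((p : ℚ_[p]) ^ (t - padicExp p w)) (stdForm b w) * η w' -
      κ⁻¹ * (((p : ℝ) ^ t) ^ d * ∫ k, φ ((padicDiag p d t).1.mulVec (k.1.1.mulVec w)) *
            η ((k.1⁻¹).1.mulVec (Pi.single 0 1)) ∂μ)
      = κ⁻¹ * (((p : ℝ) ^ t) ^ d * ∫ k, φ ((padicDiag p d t).1.mulVec (k.1.1.mulVec w)) *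
            (η w' - η ((k.1⁻¹).1.mulVec (Pi.single 0 1))) ∂μ) := by
    simp only [mul_sub]
    rw [integral_sub hi1 hi2, integral_mul_const, hJ]
    ring
  rw [hdiff]
  set E : Set (padicK p b) := (fun k => (padicDiag p d t).1.mulVec (k.1.1.mulVec w)) ⁻¹' tsupport φ
    with hE
  have hEm : MeasurableSet E := ((isClosed_tsupport φ).preimage hcw).measurableSet
  have hbound : |∫ k, φ ((padicDiag p d t).1.mulVec (k.1.1.mulVec w)) *
      (η w' - η ((k.1⁻¹).1.mulVec (Pi.single 0 1))) ∂μ| ≤ D * δ₁ * μ.real E := by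
    have h1 : ∀ k : padicK p b, ‖φ ((padicDiag p d t).1.mulVec (k.1.1.mulVec w)) *
        (η w' - η ((k.1⁻¹).1.mulVec (Pi.single 0 1)))‖ ≤ E.indicator (fun _ => D * δ₁) k := by
      intro k
      by_cases hk : φ ((padicDiag p d t).1.mulVec (k.1.1.mulVec w)) = 0
      · rw [hk, zero_mul, norm_zero]
        exact Set.indicator_nonneg (fun _ _ => by positivity) _
      · have hkE : k ∈ E := subset_tsupport φ hk
        rw [Set.indicator_of_mem hkE, norm_mul]
        exact mul_le_mul (hD _) (hclose k hk) (norm_nonneg _) hD0.le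
    have h2 := norm_integral_le_of_norm_le ((integrable_const (D * δ₁)).indicator hEm)
      (Filter.Eventually.of_forall h1) (μ := μ)
    rw [integral_indicator hEm, setIntegral_const, smul_eq_mul] at h2
    rw [← Real.norm_eq_abs]
    linarith
  have hmono : μ.real E ≤ μ.real {k | (padicDiag p d t).1.mulVec (k.1.1.mulVec w) ∈ N} :=
    measureReal_mono (fun k hk => hN hk)
  rw [abs_mul, abs_mul, abs_of_pos (inv_pos.2 hκ0), abs_of_pos (pow_pos hpt d)]
  calc κ⁻¹ * (((p : ℝ) ^ t) ^ d * |∫ k, φ ((padicDiag p d t).1.mulVec (k.1.1.mulVec w)) *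
      (η w' - η ((k.1⁻¹).1.mulVec (Pi.single 0 1))) ∂μ|)
      ≤ κ⁻¹ * (((p : ℝ) ^ t) ^ d * (D * δ₁ *
        μ.real {k | (padicDiag p d t).1.mulVec (k.1.1.mulVec w) ∈ N})) := by
        have := hbound.trans (mul_le_mul_of_nonneg_left hmono (by positivity : 0 ≤ D * δ₁))
        gcongr
    _ = _ := by
        rw [hδ₁]; field_simp

end PadicLocal

/-! ### Orbits of `K_∞` -/

section RealGeometry

variable {d : ℕ}

/-- The symmetric matrix of `stdForm a`, as a map. -/
def formMap (a : Fin d → ℝ) (x : Fin (d + 2) → ℝ) : Fin (d + 2) → ℝ :=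
  mkVec (x (Fin.last (d + 1))) (fun i => a i * midVec x i) (x 0)

theorem dotProduct_coord (x y : Fin (d + 2) → ℝ) :
    x ⬝ᵥ y = x 0 * y 0 + ∑ i, midVec x i * midVec y i
      + x (Fin.last (d + 1)) * y (Fin.last (d + 1)) :=
  sum_coord _

theorem dotProduct_formMap (a : Fin d → ℝ) (x y : Fin (d + 2) → ℝ) :
    x ⬝ᵥ formMap a y = x 0 * y (Fin.last (d + 1)) + ∑ i, a i * (midVec x i * midVec y i)
      + x (Fin.last (d + 1)) * y 0 := by
  rw [dotProduct_coord, formMap, mkVec_zero, mkVec_last, midVec_mkVec]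
  congr 2
  exact Finset.sum_congr rfl fun i _ => by ring

theorem dotProduct_formMap_comm (a : Fin d → ℝ) (x y : Fin (d + 2) → ℝ) :
    x ⬝ᵥ formMap a y = y ⬝ᵥ formMap a x := by
  rw [dotProduct_formMap, dotProduct_formMap]
  have : ∀ i, a i * (midVec x i * midVec y i) = a i * (midVec y i * midVec x i) := fun i => by ring
  simp only [this]
  ring

theorem stdForm_eq_dotProduct (a : Fin d → ℝ) (x : Fin (d + 2) → ℝ) :
    stdForm a x = x ⬝ᵥ formMap a x := by
  rw [dotProduct_formMap, stdForm]
  have : ∀ i, a i * (midVec x i * midVec x i) = a i * x i.succ.castSucc ^ 2 :=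
    fun i => by simp only [midVec]; ring
  simp only [this]
  ring

theorem formMap_add (a : Fin d → ℝ) (x y : Fin (d + 2) → ℝ) :
    formMap a (x + y) = formMap a x + formMap a y := by
  refine vec_ext ?_ (fun i => ?_) ?_
  · simp [formMap]
  · simp only [formMap, mkVec_mid', Pi.add_apply, midVec]; ring
  · simp [formMap]

theorem formMap_smul (a : Fin d → ℝ) (c : ℝ) (x : Fin (d + 2) → ℝ) :
    formMap a (c • x) = c • formMap a x := by
  refine vec_ext ?_ (fun i => ?_) ?_
  · simp [formMap]
  · simp only [formMap, mkVec_mid', Pi.smul_apply, midVec, smul_eq_mul]; ring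
  · simp [formMap]

theorem formMap_sub (a : Fin d → ℝ) (x y : Fin (d + 2) → ℝ) :
    formMap a (x - y) = formMap a x - formMap a y := by
  rw [sub_eq_add_neg, formMap_add, ← neg_one_smul ℝ y, formMap_smul, neg_one_smul,
    ← sub_eq_add_neg]

/-- As `a_i = ±1`, the matrix `S` of the form is a symmetric involution. So `ℝ^n` is the orthogonal
sum of its eigenspaces, the components of `x` are `(x ± S x) / 2`, and `posSq`, `negSq` are twice
their squared lengths. -/
theorem formMap_formMap {a : Fin d → ℝ} (ha : ∀ i, a i = 1 ∨ a i = -1) (x : Fin (d + 2) → ℝ) :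
    formMap a (formMap a x) = x := by
  refine vec_ext ?_ (fun i => ?_) ?_
  · simp [formMap]
  · simp only [formMap, mkVec_mid', midVec_mkVec]
    rcases ha i with h | h <;> rw [h] <;> simp [midVec]
  · simp [formMap]

/-- Matrices preserving both `stdForm a` and the Euclidean norm. -/
def IsFormOrthogonal (a : Fin d → ℝ) (k : Matrix (Fin (d + 2)) (Fin (d + 2)) ℝ) : Prop :=
  (∀ x, stdForm a (k.mulVec x) = stdForm a x) ∧ k * k.transpose = 1

theorem IsFormOrthogonal.mul {a : Fin d → ℝ} {k l : Matrix (Fin (d + 2)) (Fin (d + 2)) ℝ}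
    (hk : IsFormOrthogonal a k) (hl : IsFormOrthogonal a l) : IsFormOrthogonal a (k * l) := by
  refine ⟨fun x => by rw [← Matrix.mulVec_mulVec, hk.1, hl.1], ?_⟩
  rw [Matrix.transpose_mul, Matrix.mul_assoc, ← Matrix.mul_assoc l, hl.2, Matrix.one_mul, hk.2]

theorem IsFormOrthogonal.dotProduct_mulVec {a : Fin d → ℝ}
    {k : Matrix (Fin (d + 2)) (Fin (d + 2)) ℝ} (hk : IsFormOrthogonal a k)
    (x y : Fin (d + 2) → ℝ) : k.mulVec x ⬝ᵥ k.mulVec y = x ⬝ᵥ y := by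
  have h : k.transpose * k = 1 := mul_eq_one_comm.1 hk.2
  rw [Matrix.dotProduct_mulVec, ← Matrix.mulVec_transpose, Matrix.mulVec_mulVec, h,
    Matrix.one_mulVec]

theorem IsFormOrthogonal.det_eq {a : Fin d → ℝ}
    {k : Matrix (Fin (d + 2)) (Fin (d + 2)) ℝ} (hk : IsFormOrthogonal a k) :
    k.det = 1 ∨ k.det = -1 := by
  have h := congrArg Matrix.det hk.2
  rw [Matrix.det_mul, Matrix.det_transpose, Matrix.det_one] at h
  exact mul_self_eq_one_iff.1 h

theorem IsFormOrthogonal.dotProduct_formMap_mulVec {a : Fin d → ℝ}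
    {k : Matrix (Fin (d + 2)) (Fin (d + 2)) ℝ} (hk : IsFormOrthogonal a k)
    (x y : Fin (d + 2) → ℝ) :
    k.mulVec x ⬝ᵥ formMap a (k.mulVec y) = x ⬝ᵥ formMap a y := by
  have hpol : ∀ x y, 2 * (x ⬝ᵥ formMap a y) = stdForm a (x + y) - stdForm a x - stdForm a y := by
    intro x y
    simp only [stdForm_eq_dotProduct, formMap_add, dotProduct_add, add_dotProduct]
    rw [dotProduct_formMap_comm a y x]; ring
  have h := hpol (k.mulVec x) (k.mulVec y)
  rw [← Matrix.mulVec_add, hk.1, hk.1, hk.1, ← hpol] at h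
  linarith

/-- Preserving both bilinear forms means commuting with `S`: the difference of the two sides is
Euclidean orthogonal to the image of `k`, which is everything. -/
theorem IsFormOrthogonal.formMap_mulVec {a : Fin d → ℝ}
    {k : Matrix (Fin (d + 2)) (Fin (d + 2)) ℝ} (hk : IsFormOrthogonal a k)
    (x : Fin (d + 2) → ℝ) : formMap a (k.mulVec x) = k.mulVec (formMap a x) := by
  have h : ∀ z, k.mulVec z ⬝ᵥ (formMap a (k.mulVec x) - k.mulVec (formMap a x)) = 0 := by
    intro z
    rw [dotProduct_sub, hk.dotProduct_formMap_mulVec, hk.dotProduct_mulVec, sub_self]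
  have h2 := h (k.transpose.mulVec (formMap a (k.mulVec x) - k.mulVec (formMap a x)))
  rw [Matrix.mulVec_mulVec, hk.2, Matrix.one_mulVec, dotProduct_self_eq_zero] at h2
  exact sub_eq_zero.1 h2

/-- The reflection in the hyperplane orthogonal to `u`. -/
noncomputable def reflMatrix (u : Fin (d + 2) → ℝ) : Matrix (Fin (d + 2)) (Fin (d + 2)) ℝ :=
  1 - (2 / (u ⬝ᵥ u)) • Matrix.vecMulVec u u

theorem reflMatrix_mulVec (u x : Fin (d + 2) → ℝ) :
    (reflMatrix u).mulVec x = x - (2 * (u ⬝ᵥ x) / (u ⬝ᵥ u)) • u := by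
  rw [reflMatrix, Matrix.sub_mulVec, Matrix.one_mulVec, Matrix.smul_mulVec,
    Matrix.vecMulVec_mulVec]
  congr 1
  funext i
  simp
  ring

/-- A reflection in an eigenvector of `S` commutes with `S`, hence preserves the form along with the
Euclidean norm. -/
theorem reflMatrix_isFormOrthogonal {a : Fin d → ℝ} (u : Fin (d + 2) → ℝ) {e : ℝ}
    (hu : formMap a u = e • u) : IsFormOrthogonal a (reflMatrix u) := by
  constructor
  · intro x
    rw [reflMatrix_mulVec]
    simp only [stdForm_eq_dotProduct, formMap_sub, formMap_smul, hu, dotProduct_sub,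
      sub_dotProduct, dotProduct_smul, smul_dotProduct, smul_eq_mul]
    rw [← dotProduct_formMap_comm a x u, hu, dotProduct_smul, smul_eq_mul, dotProduct_comm x u]
    -- For `u = 0` the quotient `2 / (u ⬝ᵥ u)` is `0` and the matrix is the identity.
    by_cases h : u ⬝ᵥ u = 0
    · rw [h]; simp
    · field_simp; ring
  · have ht : (reflMatrix u).transpose = reflMatrix u := by
      simp [reflMatrix, Matrix.transpose_sub, Matrix.transpose_vecMulVec]
    rw [ht]
    refine Matrix.ext_of_mulVec_single fun i => ?_
    rw [← Matrix.mulVec_mulVec, Matrix.one_mulVec, reflMatrix_mulVec, reflMatrix_mulVec,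
      dotProduct_sub, dotProduct_smul, smul_eq_mul]
    set y : Fin (d + 2) → ℝ := Pi.single i 1
    by_cases h : u ⬝ᵥ u = 0
    · have hu0 : u = 0 := dotProduct_self_eq_zero.1 h
      rw [hu0]; simp
    · have : 2 * (u ⬝ᵥ y - 2 * (u ⬝ᵥ y) / (u ⬝ᵥ u) * (u ⬝ᵥ u)) / (u ⬝ᵥ u)
          = -(2 * (u ⬝ᵥ y) / (u ⬝ᵥ u)) := by field_simp; ring
      rw [this, neg_smul]; simp

/-- The first invariant of the orbits of `realK a`. -/
def posSq (a : Fin d → ℝ) (x : Fin (d + 2) → ℝ) : ℝ := x ⬝ᵥ x + x ⬝ᵥ formMap a x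

/-- The second invariant of the orbits of `realK a`. -/
def negSq (a : Fin d → ℝ) (x : Fin (d + 2) → ℝ) : ℝ := x ⬝ᵥ x - x ⬝ᵥ formMap a x

theorem posSq_eq (a : Fin d → ℝ) (x : Fin (d + 2) → ℝ) :
    posSq a x = (x 0 + x (Fin.last (d + 1))) ^ 2 + ∑ i, (1 + a i) * midVec x i ^ 2 := by
  rw [posSq, dotProduct_formMap, dotProduct_coord]
  have : ∀ i, (1 + a i) * midVec x i ^ 2
      = midVec x i * midVec x i + a i * (midVec x i * midVec x i) := fun i => by ring
  simp only [this, Finset.sum_add_distrib]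
  ring

theorem negSq_eq (a : Fin d → ℝ) (x : Fin (d + 2) → ℝ) :
    negSq a x = (x 0 - x (Fin.last (d + 1))) ^ 2 + ∑ i, (1 - a i) * midVec x i ^ 2 := by
  rw [negSq, dotProduct_formMap, dotProduct_coord]
  have : ∀ i, (1 - a i) * midVec x i ^ 2
      = midVec x i * midVec x i - a i * (midVec x i * midVec x i) := fun i => by ring
  simp only [this, Finset.sum_sub_distrib]
  ring

theorem posSq_nonneg {a : Fin d → ℝ} (ha : ∀ i, a i = 1 ∨ a i = -1) (x : Fin (d + 2) → ℝ) :
    0 ≤ posSq a x := by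
  rw [posSq_eq]
  refine add_nonneg (sq_nonneg _) (Finset.sum_nonneg fun i _ => ?_)
  rcases ha i with h | h <;> rw [h] <;> norm_num
  positivity

theorem negSq_nonneg {a : Fin d → ℝ} (ha : ∀ i, a i = 1 ∨ a i = -1) (x : Fin (d + 2) → ℝ) :
    0 ≤ negSq a x := by
  rw [negSq_eq]
  refine add_nonneg (sq_nonneg _) (Finset.sum_nonneg fun i _ => ?_)
  rcases ha i with h | h <;> rw [h] <;> norm_num
  positivity

theorem IsFormOrthogonal.posSq_mulVec {a : Fin d → ℝ}
    {k : Matrix (Fin (d + 2)) (Fin (d + 2)) ℝ} (hk : IsFormOrthogonal a k)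
    (x : Fin (d + 2) → ℝ) : posSq a (k.mulVec x) = posSq a x := by
  rw [posSq, hk.dotProduct_mulVec, hk.dotProduct_formMap_mulVec, posSq]

theorem IsFormOrthogonal.negSq_mulVec {a : Fin d → ℝ}
    {k : Matrix (Fin (d + 2)) (Fin (d + 2)) ℝ} (hk : IsFormOrthogonal a k)
    (x : Fin (d + 2) → ℝ) : negSq a (k.mulVec x) = negSq a x := by
  rw [negSq, hk.dotProduct_mulVec, hk.dotProduct_formMap_mulVec, negSq]

/-- Two vectors with the same invariants are exchanged by a form-orthogonal matrix. -/
theorem exists_isFormOrthogonal {a : Fin d → ℝ} (ha : ∀ i, a i = 1 ∨ a i = -1)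
    (x y : Fin (d + 2) → ℝ) (hp : posSq a x = posSq a y) (hn : negSq a x = negSq a y) :
    ∃ k, IsFormOrthogonal a k ∧ k.mulVec x = y := by
  set z := x - y with hz
  -- `u` and `v` are the eigencomponents of `x - y`. Equality of the lengths of the components of
  -- `x` and `y` amounts to `2 (u ⬝ᵥ x) = u ⬝ᵥ u` and its analogue for `v`, so the reflection in `u`
  -- subtracts `u` from `x`, and the reflection in `v` then subtracts `v`.
  set u := (1 / 2 : ℝ) • (z + formMap a z) with hu
  set v := (1 / 2 : ℝ) • (z - formMap a z) with hv
  have hSu : formMap a u = (1 : ℝ) • u := by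
    rw [hu, formMap_smul, formMap_add, formMap_formMap ha, add_comm z, one_smul]
  have hSv : formMap a v = (-1 : ℝ) • v := by
    rw [hv, formMap_smul, formMap_sub, formMap_formMap ha, smul_comm, neg_one_smul, neg_sub]
  have huv : u + v = z := by
    rw [hu, hv, ← smul_add, add_add_sub_cancel, ← two_smul ℝ z, smul_smul]; norm_num
  have hdot : ∀ s t : Fin (d + 2) → ℝ, formMap a s ⬝ᵥ t = s ⬝ᵥ formMap a t := fun s t => by
    rw [dotProduct_comm, dotProduct_formMap_comm]
  have hyx := dotProduct_comm y x
  have hyx' := dotProduct_formMap_comm a y x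
  rw [posSq, posSq] at hp
  rw [negSq, negSq] at hn
  have h1 : 2 * (u ⬝ᵥ x) = u ⬝ᵥ u := by
    simp only [hu, hz, formMap_sub, dotProduct_sub, sub_dotProduct, dotProduct_add,
      add_dotProduct, dotProduct_smul, smul_dotProduct, smul_eq_mul, hdot, formMap_formMap ha]
    linarith
  have h2 : 2 * (v ⬝ᵥ (x - u)) = v ⬝ᵥ v := by
    simp only [hv, hu, hz, formMap_sub, dotProduct_sub, sub_dotProduct, dotProduct_add,
      dotProduct_smul, smul_dotProduct, smul_eq_mul, hdot, formMap_formMap ha]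
    linarith
  have hrefl : ∀ u x : Fin (d + 2) → ℝ, 2 * (u ⬝ᵥ x) = u ⬝ᵥ u →
      (reflMatrix u).mulVec x = x - u := by
    intro u x h
    rw [reflMatrix_mulVec, h]
    by_cases h0 : u ⬝ᵥ u = 0
    · rw [dotProduct_self_eq_zero.1 h0]; simp
    · rw [div_self h0, one_smul]
  refine ⟨reflMatrix v * reflMatrix u,
    (reflMatrix_isFormOrthogonal v hSv).mul (reflMatrix_isFormOrthogonal u hSu), ?_⟩
  rw [← Matrix.mulVec_mulVec, hrefl u x h1, hrefl v _ h2, sub_sub, huv, hz, sub_sub_cancel]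

theorem exists_realK_of_mid_eq_zero (hd : 0 < d) {a : Fin d → ℝ} (ha : ∀ i, a i = 1 ∨ a i = -1)
    (x y : Fin (d + 2) → ℝ) (hy : midVec y = 0) (hp : posSq a x = posSq a y)
    (hn : negSq a x = negSq a y) : ∃ k ∈ realK a, k.1.mulVec x = y := by
  obtain ⟨k, hk, hkx⟩ := exists_isFormOrthogonal ha x y hp hn
  rcases hk.det_eq with h | h
  · exact ⟨⟨k, h⟩, hk, hkx⟩
  -- A determinant `-1` is corrected by a sign change of one middle coordinate, which fixes `y`.
  · set e : Fin (d + 2) → ℝ := Pi.single (⟨0, hd⟩ : Fin d).succ.castSucc 1 with he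
    set D : Matrix (Fin (d + 2)) (Fin (d + 2)) ℝ :=
      Matrix.diagonal (mkVec 1 (Function.update (1 : Fin d → ℝ) ⟨0, hd⟩ (-1)) 1) with hD
    have hDx : ∀ x, D.mulVec x = mkVec (x 0)
        (fun i => Function.update (1 : Fin d → ℝ) ⟨0, hd⟩ (-1) i * midVec x i)
        (x (Fin.last (d + 1))) := by
      intro x
      refine vec_ext ?_ (fun i => ?_) ?_
      · rw [Matrix.mulVec_diagonal]; simp
      · rw [Matrix.mulVec_diagonal, mkVec_mid', mkVec_mid', midVec]
      · rw [Matrix.mulVec_diagonal]; simp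
    have hsq : ∀ i, Function.update (1 : Fin d → ℝ) ⟨0, hd⟩ (-1) i ^ 2 = 1 := by
      intro i
      by_cases hi : i = ⟨0, hd⟩
      · subst hi; simp
      · simp [Function.update_of_ne hi]
    have hDO : IsFormOrthogonal a D := by
      constructor
      · intro x
        rw [hDx, stdForm_mkVec, stdForm]
        simp only [mul_pow, hsq, one_mul, midVec]
      · rw [hD, Matrix.diagonal_transpose, Matrix.diagonal_mul_diagonal, ← Matrix.diagonal_one]
        congr 1
        refine funext (forall_coord ?_ (fun i => ?_) ?_)
        · simp
        · rw [mkVec_mid', ← pow_two, hsq]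
        · simp
    have hDdet : D.det = -1 := by
      rw [hD, Matrix.det_diagonal, prod_coord]
      simp only [mkVec_zero, mkVec_last, mkVec_mid']
      rw [Finset.prod_update_of_mem (Finset.mem_univ _)]
      simp
    refine ⟨⟨D * k, by rw [Matrix.det_mul, h, hDdet]; norm_num⟩, hDO.mul hk, ?_⟩
    rw [← Matrix.mulVec_mulVec, hkx, hDx, hy]
    conv_rhs => rw [eq_mkVec y, hy]
    congr 1
    funext i; simp

/-- `realK a` acts transitively on the sets on which both invariants are constant. -/
theorem exists_realK (hd : 0 < d) {a : Fin d → ℝ} (ha : ∀ i, a i = 1 ∨ a i = -1)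
    (x y : Fin (d + 2) → ℝ) (hp : posSq a x = posSq a y) (hn : negSq a x = negSq a y) :
    ∃ k ∈ realK a, k.1.mulVec x = y := by
  -- Every orbit contains a vector without middle coordinates: solve `(x_1 + x_n) ^ 2 = posSq` and
  -- `(x_1 - x_n) ^ 2 = negSq`.
  set n : Fin (d + 2) → ℝ := mkVec ((Real.sqrt (posSq a x) + Real.sqrt (negSq a x)) / 2) 0
    ((Real.sqrt (posSq a x) - Real.sqrt (negSq a x)) / 2) with hnd
  have hn1 : posSq a n = posSq a x := by
    rw [posSq_eq, hnd, mkVec_zero, mkVec_last, midVec_mkVec]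
    ring_nf
    simp [Real.sq_sqrt (posSq_nonneg ha x)]
  have hn2 : negSq a n = negSq a x := by
    rw [negSq_eq, hnd, mkVec_zero, mkVec_last, midVec_mkVec]
    ring_nf
    simp [Real.sq_sqrt (negSq_nonneg ha x)]
  obtain ⟨k, hk, hkx⟩ := exists_realK_of_mid_eq_zero hd ha x n (by rw [hnd, midVec_mkVec])
    hn1.symm hn2.symm
  obtain ⟨l, hl, hly⟩ := exists_realK_of_mid_eq_zero hd ha y n (by rw [hnd, midVec_mkVec])
    (hp.symm.trans hn1.symm) (hn.symm.trans hn2.symm)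
  refine ⟨l⁻¹ * k, mul_mem (inv_mem hl) hk, ?_⟩
  rw [Matrix.SpecialLinearGroup.coe_mul, ← Matrix.mulVec_mulVec, hkx, ← hly, Matrix.mulVec_mulVec,
    ← Matrix.SpecialLinearGroup.coe_mul, inv_mul_cancel, Matrix.SpecialLinearGroup.coe_one,
    Matrix.one_mulVec]

instance compactSpace_realK (a : Fin d → ℝ) : CompactSpace (realK a) := by
  refine isCompact_iff_compactSpace.1 ?_
  have hsub : (realK a : Set (Matrix.SpecialLinearGroup (Fin (d + 2)) ℝ))
      ⊆ {k | ∀ i j, ‖k.1 i j‖ ≤ 1} := by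
    intro k hk i j
    have h1 := congrFun (congrFun hk.2 i) i
    rw [Matrix.mul_apply, Matrix.one_apply_eq] at h1
    simp only [Matrix.transpose_apply] at h1
    have h2 : k.1 i j * k.1 i j ≤ 1 :=
      (Finset.single_le_sum (f := fun l => k.1 i l * k.1 i l)
        (fun l _ => mul_self_nonneg _) (Finset.mem_univ j)).trans h1.le
    exact abs_le_one_iff_mul_self_le_one.2 h2
  refine (isCompact_SL_norm_le (d + 2)).of_isClosed_subset ?_ hsub
  have h : (realK a : Set (Matrix.SpecialLinearGroup (Fin (d + 2)) ℝ))
      = (stdSO a : Set _) ∩ {k | k.1 * k.1.transpose = 1} := rfl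
  rw [h]
  refine (isClosed_stdSO a).inter (isClosed_eq ?_ continuous_const)
  exact continuous_subtype_val.matrix_mul continuous_subtype_val.matrix_transpose

end RealGeometry

/-! ### Integrals over `K_∞` as Lebesgue integrals -/

section ShellMap

variable {d : ℕ}

/-- The projection of `x` to the orbit with invariants `P ^ 2` and `M ^ 2`. -/
noncomputable def shellMap (a : Fin d → ℝ) (P M : ℝ) (x : Fin (d + 2) → ℝ) : Fin (d + 2) → ℝ :=
  (P / Real.sqrt (posSq a x)) • ((1 / 2 : ℝ) • (x + formMap a x)) +
    (M / Real.sqrt (negSq a x)) • ((1 / 2 : ℝ) • (x - formMap a x))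

theorem IsFormOrthogonal.shellMap_mulVec {a : Fin d → ℝ}
    {k : Matrix (Fin (d + 2)) (Fin (d + 2)) ℝ} (hk : IsFormOrthogonal a k) (P M : ℝ)
    (x : Fin (d + 2) → ℝ) : shellMap a P M (k.mulVec x) = k.mulVec (shellMap a P M x) := by
  simp only [shellMap, hk.posSq_mulVec, hk.negSq_mulVec, hk.formMap_mulVec, Matrix.mulVec_add,
    Matrix.mulVec_sub, Matrix.mulVec_smul]

theorem dotProduct_shellMap {a : Fin d → ℝ} (ha : ∀ i, a i = 1 ∨ a i = -1) (P M : ℝ)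
    {x : Fin (d + 2) → ℝ} (hp : 0 < posSq a x) (hn : 0 < negSq a x) :
    posSq a (shellMap a P M x) = P ^ 2 ∧ negSq a (shellMap a P M x) = M ^ 2 := by
  have hdot : ∀ s t : Fin (d + 2) → ℝ, formMap a s ⬝ᵥ t = s ⬝ᵥ formMap a t := fun s t => by
    rw [dotProduct_comm, dotProduct_formMap_comm]
  have hP : (P / Real.sqrt (posSq a x)) ^ 2 * posSq a x = P ^ 2 := by
    rw [div_pow, Real.sq_sqrt hp.le]; field_simp
  have hM : (M / Real.sqrt (negSq a x)) ^ 2 * negSq a x = M ^ 2 := by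
    rw [div_pow, Real.sq_sqrt hn.le]; field_simp
  rw [← hP, ← hM]
  generalize hα : P / Real.sqrt (posSq a x) = α
  generalize hβ : M / Real.sqrt (negSq a x) = β
  simp only [posSq, negSq, shellMap] at hα hβ ⊢
  rw [hα, hβ]
  simp only [formMap_add, formMap_smul, formMap_sub, formMap_formMap ha, dotProduct_add,
    add_dotProduct, dotProduct_smul, smul_dotProduct, smul_eq_mul, dotProduct_sub, sub_dotProduct,
    hdot]
  constructor <;> ring

theorem continuous_formMap (a : Fin d → ℝ) : Continuous (formMap a) :=
  continuous_mkVec (continuous_apply _)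
    (continuous_pi fun i => continuous_const.mul (continuous_apply i.succ.castSucc))
    (continuous_apply _)

theorem continuous_posSq (a : Fin d → ℝ) : Continuous (posSq a) :=
  (continuous_id.dotProduct continuous_id).add (continuous_id.dotProduct (continuous_formMap a))

theorem continuous_negSq (a : Fin d → ℝ) : Continuous (negSq a) :=
  (continuous_id.dotProduct continuous_id).sub (continuous_id.dotProduct (continuous_formMap a))

theorem measurable_shellMap (a : Fin d → ℝ) (P M : ℝ) : Measurable (shellMap a P M) := by
  have h1 := (continuous_formMap a).measurable
  have h2 := (continuous_posSq a).measurable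
  have h3 := (continuous_negSq a).measurable
  unfold shellMap
  fun_prop

/-- A continuous function supported in `[0, 1]` and positive inside. -/
def bump (s : ℝ) : ℝ := max 0 (s * (1 - s))

theorem continuous_bump : Continuous bump := by unfold bump; fun_prop

theorem bump_nonneg (s : ℝ) : 0 ≤ bump s := le_max_left _ _

theorem bump_pos {s : ℝ} (h0 : 0 < s) (h1 : s < 1) : 0 < bump s :=
  lt_max_of_lt_right (mul_pos h0 (by linarith))

theorem of_bump_ne_zero {s : ℝ} (h : bump s ≠ 0) : 0 < s ∧ s < 1 := by
  have h1 : 0 < s * (1 - s) := by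
    by_contra hc
    exact h (max_eq_left (not_lt.1 hc))
  constructor <;> nlinarith

/-- A continuous weight of compact support, invariant under `realK a`. -/
def orbitWeight (a : Fin d → ℝ) (x : Fin (d + 2) → ℝ) : ℝ := bump (posSq a x) * bump (negSq a x)

theorem continuous_orbitWeight (a : Fin d → ℝ) : Continuous (orbitWeight a) :=
  (continuous_bump.comp (continuous_posSq a)).mul (continuous_bump.comp (continuous_negSq a))

theorem norm_le_one_of_orbitWeight_ne_zero {a : Fin d → ℝ} {x : Fin (d + 2) → ℝ}
    (h : orbitWeight a x ≠ 0) : ‖x‖ ≤ 1 := by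
  have h1 := (of_bump_ne_zero (left_ne_zero_of_mul h)).2
  have h2 := (of_bump_ne_zero (right_ne_zero_of_mul h)).2
  have h3 : x ⬝ᵥ x ≤ 1 := by rw [posSq] at h1; rw [negSq] at h2; linarith
  rw [pi_norm_le_iff_of_nonneg zero_le_one]
  intro j
  have h4 : x j * x j ≤ 1 :=
    (Finset.single_le_sum (f := fun l => x l * x l)
        (fun l _ => mul_self_nonneg _) (Finset.mem_univ j)).trans h3
  exact abs_le_one_iff_mul_self_le_one.2 h4

theorem hasCompactSupport_orbitWeight (a : Fin d → ℝ) : HasCompactSupport (orbitWeight a) := by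
  refine HasCompactSupport.intro (isCompact_closedBall 0 1) fun x hx => ?_
  by_contra h
  exact hx (mem_closedBall_zero_iff.2 (norm_le_one_of_orbitWeight_ne_zero h))

theorem integrable_orbitWeight (a : Fin d → ℝ) : Integrable (orbitWeight a) :=
  (continuous_orbitWeight a).integrable_of_hasCompactSupport (hasCompactSupport_orbitWeight a)

theorem orbitWeight_nonneg (a : Fin d → ℝ) (x : Fin (d + 2) → ℝ) : 0 ≤ orbitWeight a x :=
  mul_nonneg (bump_nonneg _) (bump_nonneg _)

theorem integral_orbitWeight_pos (a : Fin d → ℝ) : 0 < ∫ x, orbitWeight a x := by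
  refine (continuous_orbitWeight a).integral_pos_of_hasCompactSupport_nonneg_nonzero
    (hasCompactSupport_orbitWeight a) (orbitWeight_nonneg a) (x := mkVec (1 / 2) 0 0) ?_
  have h1 : posSq a (mkVec (1 / 2) 0 0) = 1 / 4 := by
    rw [posSq_eq, mkVec_zero, mkVec_last, midVec_mkVec]; norm_num
  have h2 : negSq a (mkVec (1 / 2) 0 0) = 1 / 4 := by
    rw [negSq_eq, mkVec_zero, mkVec_last, midVec_mkVec]; norm_num
  rw [orbitWeight, h1, h2]
  exact (mul_pos (bump_pos (by norm_num) (by norm_num)) (bump_pos (by norm_num) (by norm_num))).ne'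

theorem measurePreserving_SL_mulVec {n : ℕ} (k : Matrix.SpecialLinearGroup (Fin n) ℝ) :
    MeasurePreserving (fun x : Fin n → ℝ => k.1.mulVec x) := by
  refine ⟨(continuous_const.matrix_mulVec continuous_id).measurable, ?_⟩
  have h := Real.map_matrix_volume_pi_eq_smul_volume_pi (M := k.1) (by rw [k.2]; exact one_ne_zero)
  rw [k.2, inv_one, abs_one, ENNReal.ofReal_one, one_smul] at h
  exact h

theorem continuous_realK_mulVec (a : Fin d → ℝ) (w : Fin (d + 2) → ℝ) :
    Continuous fun k : realK a => k.1.1.mulVec w :=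
  continuous_SL_mulVec continuous_subtype_val continuous_const

variable (a : Fin d → ℝ) [MeasurableSpace (realK a)] [BorelSpace (realK a)]
  (μ : Measure (realK a)) [μ.IsHaarMeasure] [IsProbabilityMeasure μ]

/-- An integral over `realK a` is an integral over the space. -/
theorem integral_realK_eq (hd : 0 < d) (ha : ∀ i, a i = 1 ∨ a i = -1)
    {G : (Fin (d + 2) → ℝ) → ℝ} (hG : Continuous G) {C : ℝ} (hC : ∀ x, ‖G x‖ ≤ C)
    (w : Fin (d + 2) → ℝ) :
    (∫ x, orbitWeight a x) * ∫ k, G (k.1.1.mulVec w) ∂μ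
      = ∫ x, orbitWeight a x *
          G (shellMap a (Real.sqrt (posSq a w)) (Real.sqrt (negSq a w)) x) := by
  set T := shellMap a (Real.sqrt (posSq a w)) (Real.sqrt (negSq a w)) with hT
  have hTm : Measurable T := measurable_shellMap a _ _
  have hinv : ∀ k : realK a, ∀ x, orbitWeight a (k.1.1.mulVec x) = orbitWeight a x := by
    intro k x
    have hk : IsFormOrthogonal a k.1.1 := k.2
    rw [orbitWeight, hk.posSq_mulVec, hk.negSq_mulVec, orbitWeight]
  -- Substitute `k x` for `x`: Lebesgue measure and the weight are invariant, and `T` is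
  -- equivariant.
  have h1 : ∀ k : realK a, ∫ x, orbitWeight a x * G (k.1.1.mulVec (T x))
      = ∫ x, orbitWeight a x * G (T x) := by
    intro k
    have hk : IsFormOrthogonal a k.1.1 := k.2
    have hmp := measurePreserving_SL_mulVec k.1
    have hm : Measurable fun x => orbitWeight a x * G (T x) :=
      (continuous_orbitWeight a).measurable.mul (hG.measurable.comp hTm)
    have h2 := integral_map (μ := volume) hmp.measurable.aemeasurable hm.aestronglyMeasurable
    rw [hmp.map_eq] at h2
    rw [h2]
    congr 1
    funext x
    rw [hinv k, hT, hk.shellMap_mulVec]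
  -- Where the weight is non-zero, both invariants of `x` are positive, so `T x` lies on the orbit
  -- of `w`. Right invariance then makes the inner integral independent of `x`.
  have h2 : ∀ x, orbitWeight a x * ∫ k : realK a, G (k.1.1.mulVec (T x)) ∂μ
      = orbitWeight a x * ∫ k, G (k.1.1.mulVec w) ∂μ := by
    intro x
    by_cases hx : orbitWeight a x = 0
    · rw [hx, zero_mul, zero_mul]
    · have hp := (of_bump_ne_zero (left_ne_zero_of_mul hx)).1
      have hn := (of_bump_ne_zero (right_ne_zero_of_mul hx)).1
      obtain ⟨e1, e2⟩ := dotProduct_shellMap ha (Real.sqrt (posSq a w)) (Real.sqrt (negSq a w)) hp hn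
      rw [Real.sq_sqrt (posSq_nonneg ha w)] at e1
      rw [Real.sq_sqrt (negSq_nonneg ha w)] at e2
      obtain ⟨l, hl, hlw⟩ := exists_realK hd ha w (T x) e1.symm e2.symm
      rw [← hlw]
      congr 1
      rw [← integral_mul_right_of_isProbability μ (fun k : realK a => G (k.1.1.mulVec w))
        (⟨l, hl⟩ : realK a)]
      congr 1
      funext k
      rw [Subgroup.coe_mul, Matrix.SpecialLinearGroup.coe_mul, ← Matrix.mulVec_mulVec]
  have hcont : Continuous fun q : realK a × (Fin (d + 2) → ℝ) => G (q.1.1.1.mulVec q.2) :=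
    hG.comp (continuous_SL_mulVec (continuous_subtype_val.comp continuous_fst) continuous_snd)
  have hmeas : Measurable fun q : realK a × (Fin (d + 2) → ℝ) =>
      orbitWeight a q.2 * G (q.1.1.1.mulVec (T q.2)) :=
    ((continuous_orbitWeight a).measurable.comp measurable_snd).mul
      (hcont.measurable.comp (measurable_fst.prodMk (hTm.comp measurable_snd)))
  have hint : Integrable (fun q : realK a × (Fin (d + 2) → ℝ) =>
      orbitWeight a q.2 * G (q.1.1.1.mulVec (T q.2))) (μ.prod volume) := by
    refine Integrable.mono' (g := fun q => C * orbitWeight a q.2)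
      (((integrable_orbitWeight a).comp_snd μ).const_mul C) hmeas.aestronglyMeasurable
      (Filter.Eventually.of_forall fun q => ?_)
    rw [norm_mul, Real.norm_of_nonneg (orbitWeight_nonneg a _), mul_comm]
    exact mul_le_mul_of_nonneg_right (hC _) (orbitWeight_nonneg a _)
  calc (∫ x, orbitWeight a x) * ∫ k, G (k.1.1.mulVec w) ∂μ
      = ∫ x, orbitWeight a x * ∫ k, G (k.1.1.mulVec w) ∂μ := (integral_mul_const _ _).symm
    _ = ∫ x, orbitWeight a x * (∫ k : realK a, G (k.1.1.mulVec (T x)) ∂μ) := by simp only [h2]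
    _ = ∫ x, ∫ k : realK a, orbitWeight a x * G (k.1.1.mulVec (T x)) ∂μ := by
        simp only [integral_const_mul]
    _ = ∫ k : realK a, (∫ x, orbitWeight a x * G (k.1.1.mulVec (T x))) ∂μ :=
        (integral_integral_swap
          (f := fun (k : realK a) x => orbitWeight a x * G (k.1.1.mulVec (T x))) hint).symm
    _ = ∫ x, orbitWeight a x * G (T x) := by
        rw [integral_congr_ae (Filter.Eventually.of_forall h1)]
        simp

end ShellMap

/-! ### Coordinates separating the two invariants -/

section SplitCoordinates

variable {d : ℕ}

/-- The value `s` or `t`, according to the sign of `a i`. -/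
noncomputable def coordSel (a : Fin d → ℝ) (s t : ℝ) (i : Fin d) : ℝ := if a i = 1 then s else t

/-- Coordinates on the space in which the two invariants are sums of squares. -/
noncomputable def splitEquiv (d : ℕ) : ((ℝ × ℝ) × (Fin d → ℝ)) ≃ₗ[ℝ] (Fin (d + 2) → ℝ) where
  toFun q := mkVec ((q.1.1 + q.1.2) / 2) q.2 ((q.1.1 - q.1.2) / 2)
  invFun x := ((x 0 + x (Fin.last (d + 1)), x 0 - x (Fin.last (d + 1))), midVec x)
  map_add' p q := by
    refine vec_ext ?_ (fun i => ?_) ?_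
    · simp; ring
    · simp only [mkVec_mid', Pi.add_apply, Prod.snd_add]
    · simp; ring
  map_smul' c q := by
    refine vec_ext ?_ (fun i => ?_) ?_
    · simp; ring
    · simp only [mkVec_mid', Pi.smul_apply, Prod.smul_snd, RingHom.id_apply]
    · simp; ring
  left_inv q := by
    ext
    · simp; ring
    · simp; ring
    · simp
  right_inv x := by
    refine vec_ext ?_ (fun i => ?_) ?_
    · simp
    · simp only [mkVec_mid', midVec]
    · simp

theorem splitEquiv_apply (s t : ℝ) (y : Fin d → ℝ) :
    splitEquiv d ((s, t), y) = mkVec ((s + t) / 2) y ((s - t) / 2) := rfl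

theorem posSq_splitEquiv (a : Fin d → ℝ) (s t : ℝ) (y : Fin d → ℝ) :
    posSq a (splitEquiv d ((s, t), y)) = s ^ 2 + ∑ i, (1 + a i) * y i ^ 2 := by
  rw [splitEquiv_apply, posSq_eq, mkVec_zero, mkVec_last, midVec_mkVec]; ring

theorem negSq_splitEquiv (a : Fin d → ℝ) (s t : ℝ) (y : Fin d → ℝ) :
    negSq a (splitEquiv d ((s, t), y)) = t ^ 2 + ∑ i, (1 - a i) * y i ^ 2 := by
  rw [splitEquiv_apply, negSq_eq, mkVec_zero, mkVec_last, midVec_mkVec]; ring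

/-- A linear isomorphism carries Haar measure to a multiple of Haar measure. The value of the
multiple is immaterial, as it is absorbed in the final constant. -/
theorem exists_splitEquiv_const (d : ℕ) : ∃ c : ℝ, 0 < c ∧
    (∀ g : (Fin (d + 2) → ℝ) → ℝ, ∫ x, g x = c * ∫ q, g (splitEquiv d q)) ∧
    ∀ g : (Fin (d + 2) → ℝ) → ℝ, Integrable g → Integrable fun q => g (splitEquiv d q) := by
  set e := (splitEquiv d).toContinuousLinearEquiv with he
  have h2 : (volume : Measure (ℝ × ℝ)).IsAddHaarMeasure :=
    inferInstanceAs ((volume : Measure ℝ).prod volume).IsAddHaarMeasure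
  have h3 : (volume : Measure ((ℝ × ℝ) × (Fin d → ℝ))).IsAddHaarMeasure :=
    Measure.prod.instIsAddHaarMeasure (volume : Measure (ℝ × ℝ)) (volume : Measure (Fin d → ℝ))
  have hh : (volume.map e).IsAddHaarMeasure := e.isAddHaarMeasure_map volume
  have h := Measure.isAddLeftInvariant_eq_smul (volume.map e) (volume : Measure (Fin (d + 2) → ℝ))
  have hpos := Measure.addHaarScalarFactor_pos_of_isAddHaarMeasure (volume.map e)
    (volume : Measure (Fin (d + 2) → ℝ))
  set κ := Measure.addHaarScalarFactor (volume.map e) (volume : Measure (Fin (d + 2) → ℝ)) with hκ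
  have hemb : MeasurableEmbedding e := e.toHomeomorph.measurableEmbedding
  have hκ0 : (0 : ℝ) < κ := NNReal.coe_pos.2 hpos
  refine ⟨(κ : ℝ)⁻¹, inv_pos.2 hκ0, fun g => ?_, fun g hg => ?_⟩
  · have h1 := hemb.integral_map (μ := volume) g
    rw [h, integral_smul_nnreal_measure, NNReal.smul_def, smul_eq_mul] at h1
    change _ = _ * ∫ q, g (e q)
    rw [← h1, inv_mul_cancel_left₀ hκ0.ne']
  · have h1 : Integrable g (volume.map e) := by
      rw [h]; exact hg.smul_measure_nnreal
    exact (hemb.integrable_map_iff).1 h1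

theorem shellMap_splitEquiv {a : Fin d → ℝ} (ha : ∀ i, a i = 1 ∨ a i = -1) (P M s t : ℝ)
    (y : Fin d → ℝ) :
    shellMap a P M (splitEquiv d ((s, t), y)) =
      splitEquiv d ((P / Real.sqrt (posSq a (splitEquiv d ((s, t), y))) * s,
          M / Real.sqrt (negSq a (splitEquiv d ((s, t), y))) * t),
        fun i => coordSel a (P / Real.sqrt (posSq a (splitEquiv d ((s, t), y))))
          (M / Real.sqrt (negSq a (splitEquiv d ((s, t), y)))) i * y i) := by
  rw [shellMap]
  generalize P / Real.sqrt (posSq a (splitEquiv d ((s, t), y))) = α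
  generalize M / Real.sqrt (negSq a (splitEquiv d ((s, t), y))) = β
  rw [splitEquiv_apply, splitEquiv_apply]
  refine vec_ext ?_ (fun i => ?_) ?_
  · simp [formMap]; ring
  · simp only [formMap, mkVec_mid', midVec_mkVec, Pi.add_apply, Pi.smul_apply, Pi.sub_apply,
      smul_eq_mul, coordSel]
    rcases ha i with h | h
    · rw [if_pos h, h]; ring
    · rw [if_neg (by rw [h]; norm_num), h]; ring
  · simp [formMap]; ring

/-- The square of the length of `(1, h τ)`, the sum being over the `i` with `a i = 1`. -/
def gnomonPos (a : Fin d → ℝ) (h : ℝ) (τ : Fin d → ℝ) : ℝ := 1 + h ^ 2 * ∑ i, (1 + a i) * τ i ^ 2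

/-- The square of the length of `(1, h τ)`, the sum being over the `i` with `a i = -1`. -/
def gnomonNeg (a : Fin d → ℝ) (h : ℝ) (τ : Fin d → ℝ) : ℝ := 1 + h ^ 2 * ∑ i, (1 - a i) * τ i ^ 2

theorem one_le_gnomonPos {a : Fin d → ℝ} (ha : ∀ i, a i = 1 ∨ a i = -1) (h : ℝ) (τ : Fin d → ℝ) :
    1 ≤ gnomonPos a h τ := by
  refine le_add_of_nonneg_right (mul_nonneg (sq_nonneg _) (Finset.sum_nonneg fun i _ => ?_))
  refine mul_nonneg ?_ (sq_nonneg _)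
  rcases ha i with h | h <;> rw [h] <;> norm_num

theorem one_le_gnomonNeg {a : Fin d → ℝ} (ha : ∀ i, a i = 1 ∨ a i = -1) (h : ℝ) (τ : Fin d → ℝ) :
    1 ≤ gnomonNeg a h τ := by
  refine le_add_of_nonneg_right (mul_nonneg (sq_nonneg _) (Finset.sum_nonneg fun i _ => ?_))
  refine mul_nonneg ?_ (sq_nonneg _)
  rcases ha i with h | h <;> rw [h] <;> norm_num

theorem posSq_splitEquiv_gnomon {a : Fin d → ℝ} (ha : ∀ i, a i = 1 ∨ a i = -1) (s t h : ℝ)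
    (τ : Fin d → ℝ) :
    posSq a (splitEquiv d ((s, t), fun i => coordSel a s t i * h * τ i))
      = s ^ 2 * gnomonPos a h τ := by
  rw [posSq_splitEquiv, gnomonPos, mul_add, mul_one, Finset.mul_sum, Finset.mul_sum]
  congr 1
  refine Finset.sum_congr rfl fun i _ => ?_
  rcases ha i with h | h
  · rw [coordSel, if_pos h]; ring
  · rw [h]; ring

theorem negSq_splitEquiv_gnomon {a : Fin d → ℝ} (ha : ∀ i, a i = 1 ∨ a i = -1) (s t h : ℝ)
    (τ : Fin d → ℝ) :
    negSq a (splitEquiv d ((s, t), fun i => coordSel a s t i * h * τ i))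
      = t ^ 2 * gnomonNeg a h τ := by
  rw [negSq_splitEquiv, gnomonNeg, mul_add, mul_one, Finset.mul_sum, Finset.mul_sum]
  congr 1
  refine Finset.sum_congr rfl fun i _ => ?_
  rcases ha i with h | h
  · rw [h]; ring
  · rw [coordSel, if_neg (by rw [h]; norm_num)]; ring

/-- With the middle coordinates measured in units of `h s` or `h t`, the projection to the orbit
forgets `s` and `t`. Thus `f` will depend on `τ` alone, while `s` and `t` enter only the weight and
the Jacobian. -/
theorem shellMap_splitEquiv_gnomon {a : Fin d → ℝ} (ha : ∀ i, a i = 1 ∨ a i = -1) (P M h : ℝ)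
    {s t : ℝ} (hs : 0 < s) (ht : 0 < t) (τ : Fin d → ℝ) :
    shellMap a P M (splitEquiv d ((s, t), fun i => coordSel a s t i * h * τ i)) =
      splitEquiv d ((P / Real.sqrt (gnomonPos a h τ), M / Real.sqrt (gnomonNeg a h τ)),
        fun i => coordSel a (P / Real.sqrt (gnomonPos a h τ)) (M / Real.sqrt (gnomonNeg a h τ)) i
          * h * τ i) := by
  have h1 := Real.sqrt_pos.2 (zero_lt_one.trans_le (one_le_gnomonPos ha h τ))
  have h2 := Real.sqrt_pos.2 (zero_lt_one.trans_le (one_le_gnomonNeg ha h τ))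
  rw [shellMap_splitEquiv ha, posSq_splitEquiv_gnomon ha, negSq_splitEquiv_gnomon ha,
    Real.sqrt_mul (sq_nonneg s), Real.sqrt_mul (sq_nonneg t), Real.sqrt_sq hs.le,
    Real.sqrt_sq ht.le]
  congr 2
  · congr 1
    · field_simp
    · field_simp
  · funext i
    unfold coordSel
    split_ifs
    · field_simp
    · field_simp

theorem integral_pi_scale (D : Fin d → ℝ) (hD : ∀ i, 0 < D i) (g : (Fin d → ℝ) → ℝ) :
    ∫ y, g y = (∏ i, D i) * ∫ τ : Fin d → ℝ, g fun i => D i * τ i := by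
  have hdet : (Matrix.diagonal D).det ≠ 0 := by
    rw [Matrix.det_diagonal]; exact (Finset.prod_pos fun i _ => hD i).ne'
  have h := Real.smul_map_diagonal_volume_pi (D := D) hdet
  rw [Matrix.det_diagonal, abs_of_pos (Finset.prod_pos fun i _ => hD i)] at h
  conv_lhs => rw [← h]
  rw [integral_smul_measure, ENNReal.toReal_ofReal (Finset.prod_nonneg fun i _ => (hD i).le),
    smul_eq_mul]
  congr 1
  have heq : ⇑(Matrix.toLin' (Matrix.diagonal D))
      = Homeomorph.piCongrRight fun i => Homeomorph.mulLeft₀ (D i) (hD i).ne' := by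
    funext τ i
    rw [Matrix.toLin'_apply, Matrix.mulVec_diagonal]; rfl
  rw [heq, (Homeomorph.measurableEmbedding _).integral_map]
  rfl

end SplitCoordinates

/-! ### The integrand of an orbital integral, regular at `h = 0` -/

section RealKernel

variable {d : ℕ}

/-- A version of `f (levelPoint a R ζ Y)` without a singularity at `R = 0`, for `f` supported in
`{r₀ ≤ x_1}`. -/
noncomputable def regLevel (a : Fin d → ℝ) (r₀ : ℝ) (f : (Fin (d + 2) → ℝ) → ℝ) (R ζ : ℝ)
    (Y : Fin d → ℝ) : ℝ :=
  f (mkVec R Y ((ζ - ∑ i, a i * Y i ^ 2) / (2 * max R r₀)))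

theorem regLevel_of_le {a : Fin d → ℝ} {r₀ : ℝ} {f : (Fin (d + 2) → ℝ) → ℝ}
    {R : ℝ} (hR : r₀ ≤ R) (ζ : ℝ) (Y : Fin d → ℝ) :
    regLevel a r₀ f R ζ Y = f (levelPoint a R ζ Y) := by
  rw [regLevel, max_eq_left hR, levelPoint_eq_mkVec]

/-- For `R < r₀` both sides vanish, since `f` vanishes at points with first coordinate below `r₀`.
-/
theorem regLevel_eq_levelPoint {a : Fin d → ℝ} {r₀ : ℝ} {f : (Fin (d + 2) → ℝ) → ℝ}
    (hf : ∀ x, f x ≠ 0 → r₀ ≤ x 0) (R ζ : ℝ) (Y : Fin d → ℝ) :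
    regLevel a r₀ f R ζ Y = f (levelPoint a R ζ Y) := by
  by_cases hR : r₀ ≤ R
  · exact regLevel_of_le hR ζ Y
  · have h : ∀ Z, f (mkVec R Y Z) = 0 := fun Z => by
      by_contra hne
      have := hf _ hne
      rw [mkVec_zero] at this
      exact hR this
    rw [regLevel, levelPoint_eq_mkVec, h, h]

theorem eq_regLevel {a : Fin d → ℝ} {r₀ : ℝ} (hr₀ : 0 < r₀) {f : (Fin (d + 2) → ℝ) → ℝ}
    (hf : ∀ x, f x ≠ 0 → r₀ ≤ x 0) (z : Fin (d + 2) → ℝ) :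
    f z = regLevel a r₀ f (z 0) (stdForm a z) (midVec z) := by
  rw [regLevel_eq_levelPoint hf]
  by_cases h : z 0 = 0
  · have h1 : f z = 0 := by
      by_contra hne
      have := hf _ hne
      rw [h] at this
      exact absurd this (not_le.2 hr₀)
    have h2 : f (levelPoint a (z 0) (stdForm a z) (midVec z)) = 0 := by
      by_contra hne
      have := hf _ hne
      rw [levelPoint_eq_mkVec, mkVec_zero, h] at this
      exact absurd this (not_le.2 hr₀)
    rw [h1, h2]
  · rw [← eq_levelPoint a z h]

/-- The integrand of an orbital integral; here `θ = (h, r, ζ)`. -/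
noncomputable def orbitKernel (a : Fin d → ℝ) (r₀ : ℝ) (f : (Fin (d + 2) → ℝ) → ℝ) (θ : ℝ × ℝ × ℝ)
    (q : ℝ × ℝ) (τ : Fin d → ℝ) : ℝ :=
  (∏ i, coordSel a q.1 q.2 i) *
    (bump (q.1 ^ 2 * gnomonPos a θ.1 τ) * bump (q.2 ^ 2 * gnomonNeg a θ.1 τ)) *
    regLevel a r₀ f
      ((Real.sqrt (θ.2.1 ^ 2 + θ.1 ^ 2 * θ.2.2) / Real.sqrt (gnomonPos a θ.1 τ) +
        Real.sqrt (θ.2.1 ^ 2 - θ.1 ^ 2 * θ.2.2) / Real.sqrt (gnomonNeg a θ.1 τ)) / 2) θ.2.2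
      (fun i => coordSel a
        (Real.sqrt (θ.2.1 ^ 2 + θ.1 ^ 2 * θ.2.2) / Real.sqrt (gnomonPos a θ.1 τ))
        (Real.sqrt (θ.2.1 ^ 2 - θ.1 ^ 2 * θ.2.2) / Real.sqrt (gnomonNeg a θ.1 τ)) i * τ i)

theorem continuous_coordSel {X : Type*} [TopologicalSpace X] (a : Fin d → ℝ) {s t : X → ℝ}
    (hs : Continuous s) (ht : Continuous t) (i : Fin d) :
    Continuous fun x => coordSel a (s x) (t x) i := by
  unfold coordSel
  split_ifs
  · exact hs
  · exact ht

theorem continuous_regLevel {X : Type*} [TopologicalSpace X] (a : Fin d → ℝ) {r₀ : ℝ}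
    (hr₀ : 0 < r₀) {f : (Fin (d + 2) → ℝ) → ℝ} (hf : Continuous f) {R ζ : X → ℝ}
    {Y : X → Fin d → ℝ} (hR : Continuous R) (hζ : Continuous ζ) (hY : Continuous Y) :
    Continuous fun x => regLevel a r₀ f (R x) (ζ x) (Y x) := by
  unfold regLevel
  refine hf.comp (continuous_mkVec hR hY ?_)
  refine Continuous.div (by fun_prop) (by fun_prop) fun x => ?_
  have : 0 < max (R x) r₀ := lt_max_of_lt_right hr₀
  positivity

/-- All denominators are bounded below, by `1` for the square roots and by `2 r₀` in the level
point, so continuity holds up to and including `h = 0`. -/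
theorem continuous_orbitKernel {a : Fin d → ℝ} (ha : ∀ i, a i = 1 ∨ a i = -1) {r₀ : ℝ}
    (hr₀ : 0 < r₀) {f : (Fin (d + 2) → ℝ) → ℝ} (hf : Continuous f) :
    Continuous fun x : ((ℝ × ℝ × ℝ) × (ℝ × ℝ)) × (Fin d → ℝ) =>
      orbitKernel a r₀ f x.1.1 x.1.2 x.2 := by
  have hg1 : Continuous fun x : ((ℝ × ℝ × ℝ) × (ℝ × ℝ)) × (Fin d → ℝ) =>
      gnomonPos a x.1.1.1 x.2 := by unfold gnomonPos; fun_prop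
  have hg2 : Continuous fun x : ((ℝ × ℝ × ℝ) × (ℝ × ℝ)) × (Fin d → ℝ) =>
      gnomonNeg a x.1.1.1 x.2 := by unfold gnomonNeg; fun_prop
  have hc1 : Continuous fun x : ((ℝ × ℝ × ℝ) × (ℝ × ℝ)) × (Fin d → ℝ) =>
      Real.sqrt (x.1.1.2.1 ^ 2 + x.1.1.1 ^ 2 * x.1.1.2.2) / Real.sqrt (gnomonPos a x.1.1.1 x.2) :=
    Continuous.div (by fun_prop) (Real.continuous_sqrt.comp hg1) fun x =>
      (Real.sqrt_pos.2 (zero_lt_one.trans_le (one_le_gnomonPos ha _ _))).ne'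
  have hc2 : Continuous fun x : ((ℝ × ℝ × ℝ) × (ℝ × ℝ)) × (Fin d → ℝ) =>
      Real.sqrt (x.1.1.2.1 ^ 2 - x.1.1.1 ^ 2 * x.1.1.2.2) / Real.sqrt (gnomonNeg a x.1.1.1 x.2) :=
    Continuous.div (by fun_prop) (Real.continuous_sqrt.comp hg2) fun x =>
      (Real.sqrt_pos.2 (zero_lt_one.trans_le (one_le_gnomonNeg ha _ _))).ne'
  unfold orbitKernel
  refine Continuous.mul (Continuous.mul ?_ (Continuous.mul ?_ ?_)) ?_
  · exact continuous_finsetProd _ fun i _ => continuous_coordSel a (by fun_prop) (by fun_prop) i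
  · exact continuous_bump.comp (by fun_prop)
  · exact continuous_bump.comp (by fun_prop)
  · refine continuous_regLevel a hr₀ hf ((hc1.add hc2).div_const 2) (by fun_prop) ?_
    exact continuous_pi fun i => (continuous_coordSel a hc1 hc2 i).mul (by fun_prop)

theorem stdForm_splitEquiv_gnomon {a : Fin d → ℝ} (ha : ∀ i, a i = 1 ∨ a i = -1) (P M h : ℝ)
    (τ : Fin d → ℝ) :
    stdForm a (splitEquiv d ((P / Real.sqrt (gnomonPos a h τ), M / Real.sqrt (gnomonNeg a h τ)),
        fun i => coordSel a (P / Real.sqrt (gnomonPos a h τ)) (M / Real.sqrt (gnomonNeg a h τ)) i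
          * h * τ i)) = (P ^ 2 - M ^ 2) / 2 := by
  have h1 := zero_lt_one.trans_le (one_le_gnomonPos ha h τ)
  have h2 := zero_lt_one.trans_le (one_le_gnomonNeg ha h τ)
  have hs : ∀ x, stdForm a x = (posSq a x - negSq a x) / 2 := fun x => by
    rw [stdForm_eq_dotProduct, posSq, negSq]; ring
  rw [hs, posSq_splitEquiv_gnomon ha, negSq_splitEquiv_gnomon ha, div_pow, div_pow,
    Real.sq_sqrt h1.le, Real.sq_sqrt h2.le, div_mul_cancel₀ _ h1.ne', div_mul_cancel₀ _ h2.ne']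

/-- A vector contracted into the support has a large component in the direction of `e_1`. -/
theorem pos_of_diagSL_support {r₀ C h : ℝ} (hh : 0 < h) (hhC : h ^ 2 * C < r₀)
    {x : Fin (d + 2) → ℝ} (h0 : r₀ ≤ ((diagSL d h hh.ne').1.mulVec x) 0)
    (hC : ‖(diagSL d h hh.ne').1.mulVec x‖ ≤ C) :
    |x (Fin.last (d + 1))| < x 0 ∧ r₀ ≤ h * x 0 ∧ |x (Fin.last (d + 1))| ≤ h * C := by
  have hl := (norm_le_pi_norm _ (Fin.last (d + 1))).trans hC
  rw [diagSL_mulVec] at h0 hl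
  rw [mkVec_zero] at h0
  rw [mkVec_last, Real.norm_eq_abs, abs_mul, abs_inv, abs_of_pos hh, inv_mul_le_iff₀ hh] at hl
  refine ⟨?_, h0, hl⟩
  have h1 : h * (h * C) < h * x 0 := by nlinarith
  exact hl.trans_lt (lt_of_mul_lt_mul_left h1 hh.le)

/-- The integral is taken in the coordinates `(s, t, y)` with `y_i = h τ_i` times `s` or `t`, whose
Jacobian supplies `h ^ d`. From `r ^ 2 = h ^ 2 |w| ^ 2` the radii of the orbit, multiplied by `h`,
become `√(r ^ 2 ± h ^ 2 ζ)`. The support of `f` forces `s, t > 0` and the weight forces `s, t ≤ 1`.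
-/
theorem integral_shell_eq {a : Fin d → ℝ} (ha : ∀ i, a i = 1 ∨ a i = -1)
    {cL : ℝ} (hcL : (∀ g : (Fin (d + 2) → ℝ) → ℝ, ∫ x, g x = cL * ∫ q, g (splitEquiv d q)) ∧
      ∀ g : (Fin (d + 2) → ℝ) → ℝ, Integrable g → Integrable fun q => g (splitEquiv d q))
    {f : (Fin (d + 2) → ℝ) → ℝ} (hf : Continuous f) {D : ℝ} (hD : ∀ x, ‖f x‖ ≤ D)
    {r₀ C : ℝ} (hr₀ : 0 < r₀) (hrC : ∀ x, f x ≠ 0 → r₀ ≤ x 0 ∧ ‖x‖ ≤ C)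
    {h : ℝ} (hh : 0 < h) (hhC : h ^ 2 * C < r₀) (w : Fin (d + 2) → ℝ) {r : ℝ}
    (hr : r ^ 2 = h ^ 2 * (w ⬝ᵥ w)) :
    ∫ x, orbitWeight a x * f ((diagSL d h hh.ne').1.mulVec
        (shellMap a (Real.sqrt (posSq a w)) (Real.sqrt (negSq a w)) x))
      = cL * (h ^ d * ∫ q in Set.Icc (0 : ℝ) 1 ×ˢ Set.Icc (0 : ℝ) 1,
          ∫ τ, orbitKernel a r₀ f (h, r, stdForm a w) q τ) := by
  set P := Real.sqrt (posSq a w) with hP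
  set M := Real.sqrt (negSq a w) with hM
  have hP0 : 0 ≤ P := Real.sqrt_nonneg _
  have hM0 : 0 ≤ M := Real.sqrt_nonneg _
  have hP' : Real.sqrt (r ^ 2 + h ^ 2 * stdForm a w) = h * P := by
    rw [hr, ← mul_add, stdForm_eq_dotProduct, Real.sqrt_mul (sq_nonneg h), Real.sqrt_sq hh.le]
    rfl
  have hM' : Real.sqrt (r ^ 2 - h ^ 2 * stdForm a w) = h * M := by
    rw [hr, ← mul_sub, stdForm_eq_dotProduct, Real.sqrt_mul (sq_nonneg h), Real.sqrt_sq hh.le]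
    rfl
  have hPM : (P ^ 2 - M ^ 2) / 2 = stdForm a w := by
    rw [hP, hM, Real.sq_sqrt (posSq_nonneg ha w), Real.sq_sqrt (negSq_nonneg ha w), posSq, negSq,
      stdForm_eq_dotProduct]
    ring
  set g : (Fin (d + 2) → ℝ) → ℝ := fun x => orbitWeight a x *
    f ((diagSL d h hh.ne').1.mulVec (shellMap a P M x)) with hg
  have hgm : Measurable g :=
    (continuous_orbitWeight a).measurable.mul ((hf.comp
      (continuous_const.matrix_mulVec continuous_id)).measurable.comp (measurable_shellMap a P M))
  have hgi : Integrable g := by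
    refine Integrable.mono' ((integrable_orbitWeight a).const_mul D) hgm.aestronglyMeasurable
      (Filter.Eventually.of_forall fun x => ?_)
    rw [hg, norm_mul, Real.norm_of_nonneg (orbitWeight_nonneg a _), mul_comm]
    exact mul_le_mul_of_nonneg_right (hD _) (orbitWeight_nonneg a _)
  have hfib : ∀ q : ℝ × ℝ, ∫ y, g (splitEquiv d (q, y))
      = (Set.Icc (0 : ℝ) 1 ×ˢ Set.Icc (0 : ℝ) 1).indicator
        (fun q => h ^ d * ∫ τ, orbitKernel a r₀ f (h, r, stdForm a w) q τ) q := by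
    rintro ⟨s, t⟩
    by_cases hst : 0 < s ∧ s ≤ 1 ∧ 0 < t ∧ t ≤ 1
    · obtain ⟨hs, hs1, ht, ht1⟩ := hst
      rw [Set.indicator_of_mem (show (s, t) ∈ Set.Icc (0 : ℝ) 1 ×ˢ Set.Icc (0 : ℝ) 1 from
        ⟨⟨hs.le, hs1⟩, ⟨ht.le, ht1⟩⟩)]
      have hsel : ∀ i, 0 < coordSel a s t i * h := fun i => by
        refine mul_pos ?_ hh
        unfold coordSel; split_ifs <;> assumption
      rw [integral_pi_scale _ hsel, Finset.prod_mul_distrib, Finset.prod_const, Finset.card_univ,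
        Fintype.card_fin, mul_comm (∏ i, coordSel a s t i), mul_assoc, ← integral_const_mul]
      congr 2
      funext τ
      rw [hg]
      simp only [orbitKernel]
      rw [shellMap_splitEquiv_gnomon ha P M h hs ht, orbitWeight, posSq_splitEquiv_gnomon ha,
        negSq_splitEquiv_gnomon ha, hP', hM', mul_assoc (∏ i, coordSel a s t i)]
      congr 2
      -- The last coordinate, expanded by `h⁻¹`, is eliminated in favour of the invariant form
      -- value; only the first and middle coordinates of the contraction remain.
      rw [eq_regLevel (a := a) hr₀ (fun x hx => (hrC x hx).1), stdForm_diagSL,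
        stdForm_splitEquiv_gnomon ha, hPM, diagSL_mulVec, mkVec_zero, midVec_mkVec,
        splitEquiv_apply, mkVec_zero, midVec_mkVec]
      congr 1
      · ring
      · funext i
        unfold coordSel
        split_ifs <;> ring
    · have hz : ∀ y, g (splitEquiv d ((s, t), y)) = 0 := by
        intro y
        by_contra hne
        refine hst ?_
        have hω := left_ne_zero_of_mul hne
        have hfz := right_ne_zero_of_mul hne
        have hp := of_bump_ne_zero (left_ne_zero_of_mul hω)
        have hn := of_bump_ne_zero (right_ne_zero_of_mul hω)
        have hs2 : s ^ 2 ≤ posSq a (splitEquiv d ((s, t), y)) := by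
          rw [posSq_splitEquiv]
          refine le_add_of_nonneg_right (Finset.sum_nonneg fun i _ => mul_nonneg ?_ (sq_nonneg _))
          rcases ha i with h | h <;> rw [h] <;> norm_num
        have ht2 : t ^ 2 ≤ negSq a (splitEquiv d ((s, t), y)) := by
          rw [negSq_splitEquiv]
          refine le_add_of_nonneg_right (Finset.sum_nonneg fun i _ => mul_nonneg ?_ (sq_nonneg _))
          rcases ha i with h | h <;> rw [h] <;> norm_num
        obtain ⟨h1, h2⟩ := hrC _ hfz
        -- The projected vector has `|x_n| < x_1`, so `x_1 ± x_n > 0`; these are non-negative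
        -- multiples of `s` and `t`.
        have h3 := (pos_of_diagSL_support hh hhC h1 h2).1
        rw [shellMap_splitEquiv ha, splitEquiv_apply, mkVec_zero, mkVec_last, abs_lt] at h3
        have hα : 0 ≤ P / Real.sqrt (posSq a (splitEquiv d ((s, t), y))) := by positivity
        have hβ : 0 ≤ M / Real.sqrt (negSq a (splitEquiv d ((s, t), y))) := by positivity
        refine ⟨?_, by nlinarith [hp.2], ?_, by nlinarith [hn.2]⟩
        · by_contra hs
          have := mul_nonpos_of_nonneg_of_nonpos hα (not_lt.1 hs)
          linarith [h3.1]
        · by_contra ht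
          have := mul_nonpos_of_nonneg_of_nonpos hβ (not_lt.1 ht)
          linarith [h3.2]
      simp only [hz, integral_zero]
      by_cases hmem : (s, t) ∈ Set.Icc (0 : ℝ) 1 ×ˢ Set.Icc (0 : ℝ) 1
      · rw [Set.indicator_of_mem hmem]
        obtain ⟨⟨hs0, hs1⟩, ⟨ht0, ht1⟩⟩ := hmem
        -- What is left of the square is an edge `s = 0` or `t = 0`, where a factor `bump 0 = 0`
        -- occurs.
        have hk : ∀ τ, orbitKernel a r₀ f (h, r, stdForm a w) (s, t) τ = 0 := by
          intro τ
          rcases hs0.eq_or_lt with hs | hs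
          · have : s = 0 := hs.symm
            subst this
            simp [orbitKernel, bump]
          · rcases ht0.eq_or_lt with ht | ht
            · have : t = 0 := ht.symm
              subst this
              simp [orbitKernel, bump]
            · exact absurd ⟨hs, hs1, ht, ht1⟩ hst
        simp [hk]
      · rw [Set.indicator_of_notMem hmem]
  rw [hcL.1 g]
  congr 1
  have hint := hcL.2 g hgi
  rw [Measure.volume_eq_prod] at hint ⊢
  rw [integral_prod _ hint]
  simp only [hfib]
  rw [integral_indicator (measurableSet_Icc.prod measurableSet_Icc), integral_const_mul]

end RealKernel

/-! ### Uniform limit of the orbital integrals -/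

section RealUniform

variable {d : ℕ}

/-- Summing `hYτ` over `i` gives `P S / (1 + h ^ 2 S) ≤ 2 d C ^ 2` for `S = ∑ c_j τ_j ^ 2`. Since
`h` is small compared with `P`, this can be solved for `S`: `S · r₀ ^ 2 / 4 ≤ 2 d C ^ 2`. -/
theorem abs_le_of_sum_sq_bound {c : Fin d → ℝ} (hc : ∀ i, 0 ≤ c i ∧ c i ≤ 2) {r₀ C h P : ℝ}
    (hr₀ : 0 < r₀) (hC : 0 < C) (hP : r₀ ^ 2 / 2 ≤ P) (hh : 2 * d * C ^ 2 * h ^ 2 ≤ r₀ ^ 2 / 4)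
    {τ Y : Fin d → ℝ} (hY : ∀ i, |Y i| ≤ C)
    (hYτ : ∀ i, c i * Y i ^ 2 = P / (1 + h ^ 2 * ∑ j, c j * τ j ^ 2) * (c i * τ i ^ 2))
    {i : Fin d} (hi : c i = 2) : |τ i| ≤ 4 * d * C / r₀ := by
  set S := ∑ j, c j * τ j ^ 2 with hS
  have hS0 : 0 ≤ S := Finset.sum_nonneg fun j _ => mul_nonneg (hc j).1 (sq_nonneg _)
  have hg : 0 < 1 + h ^ 2 * S := by positivity
  have h1 : P / (1 + h ^ 2 * S) * S ≤ 2 * d * C ^ 2 := by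
    calc P / (1 + h ^ 2 * S) * S = ∑ j, c j * Y j ^ 2 := by
          simp only [hYτ, ← Finset.mul_sum, ← hS]
      _ ≤ ∑ _j : Fin d, 2 * C ^ 2 := Finset.sum_le_sum fun j _ => by
          have : Y j ^ 2 ≤ C ^ 2 := sq_le_sq' (neg_le_of_abs_le (hY j)) (le_of_abs_le (hY j))
          exact mul_le_mul (hc j).2 this (sq_nonneg _) zero_le_two
      _ = 2 * d * C ^ 2 := by
          rw [Finset.sum_const, Finset.card_univ, Fintype.card_fin, nsmul_eq_mul]; ring
  rw [div_mul_eq_mul_div, div_le_iff₀ hg] at h1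
  have h2 : S * (r₀ ^ 2 / 4) ≤ 2 * d * C ^ 2 := by nlinarith
  have h3 : 2 * τ i ^ 2 ≤ S := by
    rw [← hi]
    exact Finset.single_le_sum (f := fun j => c j * τ j ^ 2)
      (fun j _ => mul_nonneg (hc j).1 (sq_nonneg _)) (Finset.mem_univ i)
  have hd1 : (1 : ℝ) ≤ d := by exact_mod_cast Nat.succ_le_of_lt (Fin.pos i)
  refine abs_le_of_sq_le_sq ?_ (by positivity)
  rw [div_pow, le_div_iff₀ (by positivity)]
  have h4 : τ i ^ 2 * r₀ ^ 2 ≤ 4 * d * C ^ 2 := by nlinarith [sq_nonneg r₀]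
  nlinarith [sq_nonneg C, mul_nonneg (sub_nonneg.2 hd1) (sq_nonneg C)]

/-- The integrand of an orbital integral is supported in a fixed ball. -/
theorem norm_le_of_orbitKernel_ne_zero {a : Fin d → ℝ} (ha : ∀ i, a i = 1 ∨ a i = -1)
    {f : (Fin (d + 2) → ℝ) → ℝ} {r₀ C : ℝ} (hr₀ : 0 < r₀) (hC : 0 < C)
    (hfC : ∀ x, f x ≠ 0 → ‖x‖ ≤ C) {h r ζ : ℝ} (hr : r₀ ≤ r)
    (hζ : h ^ 2 * |ζ| ≤ r₀ ^ 2 / 2) (hh : 2 * d * C ^ 2 * h ^ 2 ≤ r₀ ^ 2 / 4)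
    {q : ℝ × ℝ} {τ : Fin d → ℝ} (hne : orbitKernel a r₀ f (h, r, ζ) q τ ≠ 0) :
    ‖τ‖ ≤ 4 * d * C / r₀ := by
  have hb := abs_le.1 (le_refl |ζ|)
  have hP : r₀ ^ 2 / 2 ≤ r ^ 2 + h ^ 2 * ζ := by nlinarith [sq_nonneg h]
  have hM : r₀ ^ 2 / 2 ≤ r ^ 2 - h ^ 2 * ζ := by nlinarith [sq_nonneg h]
  have hf := hfC _ (right_ne_zero_of_mul hne)
  dsimp only at hf
  set Y : Fin d → ℝ := fun i => coordSel a
        (Real.sqrt (r ^ 2 + h ^ 2 * ζ) / Real.sqrt (gnomonPos a h τ))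
        (Real.sqrt (r ^ 2 - h ^ 2 * ζ) / Real.sqrt (gnomonNeg a h τ)) i * τ i with hYdef
  have hY : ∀ i, |Y i| ≤ C := fun i => by
    have := (norm_le_pi_norm _ i.succ.castSucc).trans hf
    rwa [mkVec_mid'] at this
  have hgp := one_le_gnomonPos ha h τ
  have hgn := one_le_gnomonNeg ha h τ
  have hsq : ∀ {P g : ℝ}, r₀ ^ 2 / 2 ≤ P → 1 ≤ g → ∀ x : ℝ,
      (Real.sqrt P / Real.sqrt g * x) ^ 2 = P / g * x ^ 2 := fun {P g} h1 h2 x => by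
    rw [mul_pow, div_pow, Real.sq_sqrt (by nlinarith [sq_nonneg r₀]), Real.sq_sqrt (by linarith)]
  rw [pi_norm_le_iff_of_nonneg (by positivity)]
  intro i
  rw [Real.norm_eq_abs]
  have hne1 : ∀ j, a j = -1 → ¬ a j = 1 := fun j h => by rw [h]; norm_num
  rcases ha i with hi | hi
  · refine abs_le_of_sum_sq_bound (c := fun j => 1 + a j) (fun j => ?_) hr₀ hC hP hh hY
      (fun j => ?_) (i := i) (by rw [hi]; norm_num)
    · rcases ha j with h | h <;> rw [h] <;> norm_num
    · rcases ha j with hj | hj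
      · simp only [hYdef, coordSel, if_pos hj]
        rw [hsq hP hgp, gnomonPos]; ring
      · simp only [hj]; ring
  · refine abs_le_of_sum_sq_bound (c := fun j => 1 - a j) (fun j => ?_) hr₀ hC hM hh hY
      (fun j => ?_) (i := i) (by rw [hi]; norm_num)
    · rcases ha j with h | h <;> rw [h] <;> norm_num
    · rcases ha j with hj | hj
      · simp only [hj]; ring
      · simp only [hYdef, coordSel, if_neg (hne1 j hj)]
        rw [hsq hM hgn, gnomonNeg]; ring

/-- The orbital integral in the coordinates of `orbitKernel`, truncated to the ball of radius
`B`. -/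
noncomputable def orbitIntegral (a : Fin d → ℝ) (r₀ B : ℝ) (f : (Fin (d + 2) → ℝ) → ℝ)
    (θ : ℝ × ℝ × ℝ) : ℝ :=
  ∫ q in Set.Icc (0 : ℝ) 1 ×ˢ Set.Icc (0 : ℝ) 1, ∫ τ in Metric.closedBall (0 : Fin d → ℝ) B,
    orbitKernel a r₀ f θ q τ

theorem continuous_orbitIntegral {a : Fin d → ℝ} (ha : ∀ i, a i = 1 ∨ a i = -1) {r₀ : ℝ}
    (hr₀ : 0 < r₀) (B : ℝ) {f : (Fin (d + 2) → ℝ) → ℝ} (hf : Continuous f) :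
    Continuous (orbitIntegral a r₀ B f) := by
  have h1 : Continuous fun x : (ℝ × ℝ × ℝ) × (ℝ × ℝ) =>
      ∫ τ in Metric.closedBall (0 : Fin d → ℝ) B, orbitKernel a r₀ f x.1 x.2 τ :=
    continuous_parametric_integral_of_continuous
      (f := fun (x : (ℝ × ℝ × ℝ) × (ℝ × ℝ)) τ => orbitKernel a r₀ f x.1 x.2 τ)
      (continuous_orbitKernel ha hr₀ hf) (isCompact_closedBall _ _)
  exact continuous_parametric_integral_of_continuous
      (f := fun (θ : ℝ × ℝ × ℝ) (q : ℝ × ℝ) =>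
        ∫ τ in Metric.closedBall (0 : Fin d → ℝ) B, orbitKernel a r₀ f θ q τ)
      h1 (isCompact_Icc.prod isCompact_Icc)

theorem orbitIntegral_eq {a : Fin d → ℝ} (ha : ∀ i, a i = 1 ∨ a i = -1)
    {f : (Fin (d + 2) → ℝ) → ℝ} {r₀ C : ℝ} (hr₀ : 0 < r₀) (hC : 0 < C)
    (hfC : ∀ x, f x ≠ 0 → ‖x‖ ≤ C) {h r ζ : ℝ} (hr : r₀ ≤ r)
    (hζ : h ^ 2 * |ζ| ≤ r₀ ^ 2 / 2) (hh : 2 * d * C ^ 2 * h ^ 2 ≤ r₀ ^ 2 / 4) :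
    orbitIntegral a r₀ (4 * d * C / r₀) f (h, r, ζ) =
      ∫ q in Set.Icc (0 : ℝ) 1 ×ˢ Set.Icc (0 : ℝ) 1, ∫ τ, orbitKernel a r₀ f (h, r, ζ) q τ := by
  unfold orbitIntegral
  congr 1
  funext q
  refine setIntegral_eq_integral_of_forall_compl_eq_zero fun τ hτ => ?_
  by_contra hne
  exact hτ (mem_closedBall_zero_iff.2 (norm_le_of_orbitKernel_ne_zero ha hr₀ hC hfC hr hζ hh hne))

/-- The total mass of the weight that the coordinates of `orbitKernel` carry in the limit. -/
noncomputable def weightMass (a : Fin d → ℝ) : ℝ :=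
  ∫ q in Set.Icc (0 : ℝ) 1 ×ˢ Set.Icc (0 : ℝ) 1,
    (∏ i, coordSel a q.1 q.2 i) * (bump (q.1 ^ 2) * bump (q.2 ^ 2))

theorem weightMass_pos (a : Fin d → ℝ) : 0 < weightMass a := by
  set F : ℝ × ℝ → ℝ := fun q => (∏ i, coordSel a q.1 q.2 i) * (bump (q.1 ^ 2) * bump (q.2 ^ 2))
  have hcont : Continuous F :=
    (continuous_finsetProd _ fun i _ =>
      continuous_coordSel a continuous_fst continuous_snd i).mul
      ((continuous_bump.comp (by fun_prop)).mul (continuous_bump.comp (by fun_prop)))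
  have hK : IsCompact (Set.Icc (0 : ℝ) 1 ×ˢ Set.Icc (0 : ℝ) 1) := isCompact_Icc.prod isCompact_Icc
  have hnn : ∀ q ∈ Set.Icc (0 : ℝ) 1 ×ˢ Set.Icc (0 : ℝ) 1, 0 ≤ F q := by
    rintro ⟨s, t⟩ ⟨hs, ht⟩
    refine mul_nonneg (Finset.prod_nonneg fun i _ => ?_) (mul_nonneg (bump_nonneg _) (bump_nonneg _))
    unfold coordSel; split_ifs
    · exact hs.1
    · exact ht.1
  have hm : MeasurableSet (Set.Icc (0 : ℝ) 1 ×ˢ Set.Icc (0 : ℝ) 1) :=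
    measurableSet_Icc.prod measurableSet_Icc
  refine (setIntegral_pos_iff_support_of_nonneg_ae ((ae_restrict_iff' hm).2
    (Filter.Eventually.of_forall hnn)) (hcont.continuousOn.integrableOn_compact hK)).2 ?_
  have hsub : Set.Ioo (0 : ℝ) 1 ×ˢ Set.Ioo (0 : ℝ) 1
      ⊆ Function.support F ∩ Set.Icc (0 : ℝ) 1 ×ˢ Set.Icc (0 : ℝ) 1 := by
    rintro ⟨s, t⟩ ⟨hs, ht⟩
    refine ⟨?_, ⟨hs.1.le, hs.2.le⟩, ⟨ht.1.le, ht.2.le⟩⟩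
    refine mul_ne_zero (Finset.prod_ne_zero_iff.2 fun i _ => ?_) (mul_pos (bump_pos ?_ ?_)
      (bump_pos ?_ ?_)).ne'
    · unfold coordSel; split_ifs
      · exact hs.1.ne'
      · exact ht.1.ne'
    · exact pow_pos hs.1 2
    · exact pow_lt_one₀ hs.1.le hs.2 two_ne_zero
    · exact pow_pos ht.1 2
    · exact pow_lt_one₀ ht.1.le ht.2 two_ne_zero
  exact ((isOpen_Ioo.prod isOpen_Ioo).measure_pos volume
    ⟨(1 / 2, 1 / 2), by norm_num⟩).trans_le (measure_mono hsub)

/-- At `h = 0` both gnomonic factors are `1` and both radii equal `r`, so the kernel is the weight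
in `(s, t)` times `f` at the level point over `r τ`. Substituting `y = r τ` produces the factor `r ^
(-d)` of `realJ`. -/
theorem orbitIntegral_zero {a : Fin d → ℝ} (ha : ∀ i, a i = 1 ∨ a i = -1)
    {f : (Fin (d + 2) → ℝ) → ℝ} {r₀ C : ℝ} (hr₀ : 0 < r₀) (hC : 0 < C)
    (hfC : ∀ x, f x ≠ 0 → ‖x‖ ≤ C) {r : ℝ} (ζ : ℝ) (hr : r₀ ≤ r) :
    orbitIntegral a r₀ (4 * d * C / r₀) f (0, r, ζ) = weightMass a * realJ a f r ζ := by
  have hr0 : 0 < r := hr₀.trans_le hr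
  rw [orbitIntegral_eq ha hr₀ hC hfC hr (by rw [zero_pow two_ne_zero, zero_mul]; positivity)
    (by rw [zero_pow two_ne_zero, mul_zero]; positivity), weightMass, ← integral_mul_const]
  congr 1
  funext q
  have hk : ∀ τ, orbitKernel a r₀ f (0, r, ζ) q τ
      = (∏ i, coordSel a q.1 q.2 i) * (bump (q.1 ^ 2) * bump (q.2 ^ 2)) *
        f (levelPoint a r ζ fun i => r * τ i) := by
    intro τ
    rw [orbitKernel]
    simp only [gnomonPos, gnomonNeg, zero_pow two_ne_zero, zero_mul, add_zero, sub_zero, mul_one,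
      Real.sqrt_one, div_one, Real.sqrt_sq hr0.le, add_self_div_two, coordSel, ite_self]
    rw [regLevel_of_le hr]
  simp only [hk]
  rw [integral_const_mul, realJ, integral_pi_scale (fun _ : Fin d => r) (fun _ => hr0)
    (fun y => f (levelPoint a r ζ y)), Finset.prod_const, Finset.card_univ, Fintype.card_fin]
  field_simp

/-- `realJ` is continuous in its two parameters. -/
theorem continuousOn_realJ {a : Fin d → ℝ} (ha : ∀ i, a i = 1 ∨ a i = -1)
    {f : (Fin (d + 2) → ℝ) → ℝ} (hf : Continuous f) (hfc : HasCompactSupport f) :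
    ContinuousOn (fun p : ℝ × ℝ => realJ a f p.1 p.2) {p | 0 < p.1} := by
  obtain ⟨C, hC, hC'⟩ := hfc.isCompact.isBounded.exists_pos_norm_le
  have hfC : ∀ x, f x ≠ 0 → ‖x‖ ≤ C := fun x hx => hC' x (subset_tsupport f hx)
  rintro ⟨r, ζ⟩ hr
  have hr' : 0 < r := hr
  have hr₀ : 0 < r / 2 := half_pos hr'
  refine ContinuousAt.continuousWithinAt ?_
  have hc : Continuous fun p : ℝ × ℝ =>
      -- Near the given point `realJ` is this continuous function; the cut-off `r / 2` keeps nearby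
      -- first parameters admissible.
      (weightMass a)⁻¹ * orbitIntegral a (r / 2) (4 * d * C / (r / 2)) f (0, p.1, p.2) :=
    continuous_const.mul ((continuous_orbitIntegral ha hr₀ _ hf).comp (by fun_prop))
  refine hc.continuousAt.congr ?_
  have : {p : ℝ × ℝ | r / 2 < p.1} ∈ nhds (r, ζ) :=
    (isOpen_lt continuous_const continuous_fst).mem_nhds (half_lt_self hr')
  filter_upwards [this] with p hp
  rw [orbitIntegral_zero ha hr₀ hC hfC _ (le_of_lt hp),
    inv_mul_cancel_left₀ (weightMass_pos a).ne']

theorem dotProduct_mkVec (r : ℝ) (y : Fin d → ℝ) (z : ℝ) :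
    mkVec r y z ⬝ᵥ mkVec r y z = r ^ 2 + ∑ i, y i ^ 2 + z ^ 2 := by
  rw [dotProduct, sum_coord]
  simp only [mkVec_zero, mkVec_last, mkVec_mid']
  simp only [sq]

theorem dotProduct_self_coord (x : Fin (d + 2) → ℝ) :
    x ⬝ᵥ x = x 0 ^ 2 + ∑ i, midVec x i ^ 2 + x (Fin.last (d + 1)) ^ 2 := by
  conv_lhs => rw [eq_mkVec x]
  rw [dotProduct_mkVec]

/-- The length of `x` in terms of the coordinates of its contraction `z`. -/
theorem dotProduct_contraction {h : ℝ} (hh : h ≠ 0) (x z : Fin (d + 2) → ℝ)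
    (hz : z = (diagSL d h hh).1.mulVec x) :
    h ^ 2 * (x ⬝ᵥ x)
      = z 0 ^ 2 + h ^ 2 * ∑ i, midVec z i ^ 2 + h ^ 4 * z (Fin.last (d + 1)) ^ 2 := by
  rw [hz, diagSL_mulVec, mkVec_zero, mkVec_last, midVec_mkVec, dotProduct_self_coord]
  field_simp

theorem abs_stdForm_le {a : Fin d → ℝ} (ha : ∀ i, a i = 1 ∨ a i = -1) {x : Fin (d + 2) → ℝ}
    {C : ℝ} (hx : ‖x‖ ≤ C) : |stdForm a x| ≤ (d + 2) * C ^ 2 := by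
  have hC : 0 ≤ C := (norm_nonneg x).trans hx
  have hc : ∀ j, |x j| ≤ C := fun j => (norm_le_pi_norm x j).trans hx
  have h1 : |2 * x 0 * x (Fin.last (d + 1))| ≤ 2 * C ^ 2 := by
    rw [abs_mul, abs_mul, abs_two, mul_assoc, sq]
    have := mul_le_mul (hc 0) (hc (Fin.last (d + 1))) (abs_nonneg _) hC
    linarith
  have h2 : |∑ i, a i * x i.succ.castSucc ^ 2| ≤ d * C ^ 2 := by
    calc |∑ i, a i * x i.succ.castSucc ^ 2| ≤ ∑ i, |a i * x i.succ.castSucc ^ 2| :=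
          Finset.abs_sum_le_sum_abs _ _
      _ ≤ ∑ _i : Fin d, C ^ 2 := Finset.sum_le_sum fun i _ => by
          have h3 : |a i| = 1 := by rcases ha i with h | h <;> rw [h] <;> norm_num
          rw [abs_mul, h3, one_mul, abs_pow]
          exact pow_le_pow_left₀ (abs_nonneg _) (hc _) 2
      _ = d * C ^ 2 := by
          rw [Finset.sum_const, Finset.card_univ, Fintype.card_fin, nsmul_eq_mul]
  have := abs_add_le (2 * x 0 * x (Fin.last (d + 1))) (∑ i, a i * x i.succ.castSucc ^ 2)
  rw [stdForm]
  linarith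

/-- A contraction into a bounded set nearly preserves the product of the length with `h`. -/
theorem contraction_length_bounds {h : ℝ} (hh : 0 < h) (hh1 : h ≤ 1) (x : Fin (d + 2) → ℝ)
    {r₀ C r : ℝ} (hr₀ : 0 < r₀) (hr0 : 0 ≤ r) (hr : r ^ 2 = h ^ 2 * (x ⬝ᵥ x))
    (hz0 : r₀ ≤ ((diagSL d h hh.ne').1.mulVec x) 0)
    (hzC : ‖(diagSL d h hh.ne').1.mulVec x‖ ≤ C) :
    ((diagSL d h hh.ne').1.mulVec x) 0 ≤ r ∧
      r - ((diagSL d h hh.ne').1.mulVec x) 0 ≤ h ^ 2 * ((d + 1) * C ^ 2 / r₀) := by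
  have hlen := dotProduct_contraction hh.ne' x _ rfl
  set z := (diagSL d h hh.ne').1.mulVec x
  rw [← hr] at hlen
  have hC : 0 ≤ C := (norm_nonneg z).trans hzC
  have hc : ∀ j, z j ^ 2 ≤ C ^ 2 := fun j => by
    rw [← sq_abs]
    exact pow_le_pow_left₀ (abs_nonneg _) ((norm_le_pi_norm z j).trans hzC) 2
  have hS0 : 0 ≤ ∑ i, midVec z i ^ 2 := Finset.sum_nonneg fun i _ => sq_nonneg _
  have hS : ∑ i, midVec z i ^ 2 ≤ d * C ^ 2 := by
    calc ∑ i, midVec z i ^ 2 ≤ ∑ _i : Fin d, C ^ 2 := Finset.sum_le_sum fun i _ => hc _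
      _ = d * C ^ 2 := by
          rw [Finset.sum_const, Finset.card_univ, Fintype.card_fin, nsmul_eq_mul]
  have hl := hc (Fin.last (d + 1))
  have hle : z 0 ≤ r := by
    refine le_of_sq_le_sq ?_ hr0
    nlinarith [mul_nonneg (sq_nonneg h) hS0, sq_nonneg (h ^ 2 * z (Fin.last (d + 1)))]
  refine ⟨hle, ?_⟩
  have h4 : h ^ 4 * z (Fin.last (d + 1)) ^ 2 ≤ h ^ 2 * C ^ 2 := by
    have : h ^ 4 ≤ h ^ 2 := pow_le_pow_of_le_one hh.le hh1 (by norm_num)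
    exact mul_le_mul this hl (sq_nonneg _) (sq_nonneg _)
  have h5 : r ^ 2 - z 0 ^ 2 ≤ h ^ 2 * ((d + 1) * C ^ 2) := by
    nlinarith [mul_le_mul_of_nonneg_left hS (sq_nonneg h)]
  -- `(r - z_1)(r + z_1)` has just been bounded, and `r + z_1 ≥ r₀`.
  rw [← mul_div_assoc, le_div_iff₀ hr₀]
  nlinarith

end RealUniform

/-! ### The asymptotic formula at the real place, absolute error -/

section RealAsymptotic

variable {d : ℕ}

/-- The transformation `diag(e^{-t}, 1, …, 1, e^t)`. -/
noncomputable abbrev realDiag (d : ℕ) (t : ℝ) : Matrix.SpecialLinearGroup (Fin (d + 2)) ℝ :=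
  diagSL d (Real.exp (-t)) (Real.exp_ne_zero _)

theorem euclNorm_sq {n : ℕ} (x : Fin n → ℝ) : euclNorm x ^ 2 = x ⬝ᵥ x := by
  rw [euclNorm, Real.sq_sqrt (Finset.sum_nonneg fun i _ => sq_nonneg _), dotProduct]
  simp only [sq]

theorem euclNorm_nonneg {n : ℕ} (x : Fin n → ℝ) : 0 ≤ euclNorm x := Real.sqrt_nonneg _

theorem real_support_bounds {f : (Fin (d + 2) → ℝ) → ℝ} (hfc : HasCompactSupport f)
    (hfs : tsupport f ⊆ {x | 0 < x 0}) :
    ∃ r > 0, ∃ C > 0, ∀ x, f x ≠ 0 → r ≤ x 0 ∧ ‖x‖ ≤ C := by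
  obtain ⟨r, hr, C, hC, h⟩ := exists_support_bounds hfc (hfs.trans fun x hx => ne_of_gt hx)
  refine ⟨r, hr, C, hC, fun x hx => ?_⟩
  have hx' := subset_tsupport f hx
  have h1 := h x hx'
  rw [Real.norm_of_nonneg (le_of_lt (hfs hx'))] at h1
  exact h1

theorem realJ_eq_zero_of {a : Fin d → ℝ} {f : (Fin (d + 2) → ℝ) → ℝ} {r ζ : ℝ}
    (h : ∀ y, f (levelPoint a r ζ y) = 0) : realJ a f r ζ = 0 := by
  simp [realJ, h]

theorem scaled_euclNorm_sq (w : Fin (d + 2) → ℝ) (t : ℝ) :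
    (euclNorm w / Real.exp t) ^ 2 = Real.exp (-t) ^ 2 * (w ⬝ᵥ w) := by
  rw [div_pow, euclNorm_sq, Real.exp_neg, inv_pow, div_eq_inv_mul]

variable (a : Fin d → ℝ) [MeasurableSpace (realK a)] [BorelSpace (realK a)]
  (μ : Measure (realK a)) [μ.IsHaarMeasure] [IsProbabilityMeasure μ]

theorem exists_eventually_exp_neg {P : ℝ → Prop} (h : ∀ᶠ x in nhds 0, P x) :
    ∃ T : ℝ, 0 < T ∧ ∀ t > T, P (Real.exp (-t)) := by
  obtain ⟨T, hT⟩ := Filter.eventually_atTop.1 (Real.tendsto_exp_neg_atTop_nhds_zero.eventually h)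
  exact ⟨max T 1, lt_max_of_lt_right one_pos, fun t ht => hT t ((le_max_left _ _).trans ht.le)⟩

/-- The orbital integral converges to `realJ`, uniformly in the vector. -/
theorem exists_real_uniform_asymptotic (hd : 0 < d) (ha : ∀ i, a i = 1 ∨ a i = -1) :
    ∃ c : ℝ, 0 < c ∧ ∀ f : (Fin (d + 2) → ℝ) → ℝ, Continuous f → HasCompactSupport f →
      tsupport f ⊆ {x | 0 < x 0} → ∀ δ > 0, ∃ T : ℝ, 0 < T ∧ ∀ t > T, ∀ w : Fin (d + 2) → ℝ,
        |realJ a f (euclNorm w / Real.exp t) (stdForm a w) -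
          c * (Real.exp t ^ d * ∫ k : realK a, f ((realDiag d t).1.mulVec (k.1.1.mulVec w)) ∂μ)|
          ≤ δ := by
  obtain ⟨cL, hcL0, hcL⟩ := exists_splitEquiv_const d
  have hZ := integral_orbitWeight_pos a
  set Zω := ∫ x, orbitWeight a x with hZω
  have hW := weightMass_pos a
  -- `Zω` is the total weight in `integral_realK_eq`, `cL` the Jacobian of the split coordinates,
  -- `weightMass a` the factor appearing at `h = 0`.
  refine ⟨Zω / (cL * weightMass a), by positivity, fun f hf hfc hfs δ hδ => ?_⟩
  obtain ⟨r₀, hr₀, C, hC, hrC⟩ := real_support_bounds hfc hfs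
  obtain ⟨D, hD⟩ := hfc.exists_bound_of_continuous hf
  -- For `h < 1` both sides vanish unless `r₀ ≤ r ≤ r₁` and `|ζ| ≤ Z`. This confines the parameters
  -- to a compact set and makes the limit uniform in `w`.
  set Z := (d + 2) * C ^ 2 with hZdef
  set r₁ := C + (d + 1) * C ^ 2 / r₀ with hr₁
  set B := 4 * d * C / r₀ with hB
  have hK : IsCompact (Set.Icc (0 : ℝ) 1 ×ˢ (Set.Icc r₀ r₁ ×ˢ Set.Icc (-Z) Z)) :=
    isCompact_Icc.prod (isCompact_Icc.prod isCompact_Icc)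
  have huc := hK.uniformContinuousOn_of_continuous
    (continuous_orbitIntegral ha hr₀ B hf).continuousOn
  obtain ⟨ρ, hρ, hunif⟩ := Metric.uniformContinuousOn_iff.1 huc (δ * weightMass a) (by positivity)
  have hev : ∀ᶠ h in nhds (0 : ℝ), h < 1 ∧ h < ρ ∧ h ^ 2 * Z < r₀ ^ 2 / 2 ∧
      2 * d * C ^ 2 * h ^ 2 < r₀ ^ 2 / 4 ∧ h ^ 2 * C < r₀ := by
    have key : ∀ {F : ℝ → ℝ} {b : ℝ}, Continuous F → F 0 < b → ∀ᶠ h in nhds 0, F h < b :=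
      fun {F b} hF hlt => (hF.tendsto 0).eventually_lt_const hlt
    refine (key continuous_id one_pos).and ((key continuous_id hρ).and ((key (by fun_prop) ?_).and
      ((key (by fun_prop) ?_).and (key (by fun_prop) ?_)))) <;> simp <;> positivity
  obtain ⟨T, hT0, hT⟩ := exists_eventually_exp_neg hev
  refine ⟨T, hT0, fun t ht w => ?_⟩
  obtain ⟨hh1, hhρ, hhZ, hhC, hhC'⟩ := hT t ht
  have hh : 0 < Real.exp (-t) := Real.exp_pos _
  have hr2 := scaled_euclNorm_sq w t
  have hr0 : 0 ≤ euclNorm w / Real.exp t := div_nonneg (euclNorm_nonneg w) (Real.exp_pos t).le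
  set r := euclNorm w / Real.exp t with hr
  have hEh : Real.exp t ^ d * Real.exp (-t) ^ d = 1 := by
    rw [← mul_pow, ← Real.exp_add, add_neg_cancel, Real.exp_zero, one_pow]
  have hdiag : ∀ x, (realDiag d t).1.mulVec x
      = (diagSL d (Real.exp (-t)) hh.ne').1.mulVec x := fun _ => rfl
  set h := Real.exp (-t) with hhdef
  by_cases hreg : (r₀ ≤ r ∧ r ≤ r₁) ∧ |stdForm a w| ≤ Z
  · obtain ⟨⟨hr₀r, hrr₁⟩, hζ⟩ := hreg
    have h1 := integral_realK_eq a μ hd ha (G := fun x => f ((realDiag d t).1.mulVec x))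
      (hf.comp (continuous_const.matrix_mulVec continuous_id)) (fun x => hD _) w
    have h2 := integral_shell_eq ha hcL hf hD hr₀ hrC hh hhC' w hr2
    rw [← orbitIntegral_eq ha hr₀ hC (fun x hx => (hrC x hx).2) hr₀r
      ((mul_le_mul_of_nonneg_left hζ (sq_nonneg h)).trans hhZ.le) hhC.le] at h2
    have h3 := orbitIntegral_zero ha hr₀ hC (fun x hx => (hrC x hx).2) (stdForm a w) hr₀r
    rw [← hB] at h2 h3
    have h4 := hunif (h, r, stdForm a w) ⟨⟨hh.le, hh1.le⟩, ⟨hr₀r, hrr₁⟩, abs_le.1 hζ⟩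
      (0, r, stdForm a w) ⟨⟨le_rfl, zero_le_one⟩, ⟨hr₀r, hrr₁⟩, abs_le.1 hζ⟩ (by
        rw [Prod.dist_eq, dist_self, max_eq_left dist_nonneg, Real.dist_eq, sub_zero,
          abs_of_pos hh]
        exact hhρ)
    have h5 : Zω * ∫ k : realK a, f ((realDiag d t).1.mulVec (k.1.1.mulVec w)) ∂μ
        = cL * (h ^ d * orbitIntegral a r₀ B f (h, r, stdForm a w)) := h1.trans h2
    -- The normalisation `e ^ (t d)` cancels the Jacobian `h ^ d`.
    have h6 : Zω / (cL * weightMass a) *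
        (Real.exp t ^ d * ∫ k : realK a, f ((realDiag d t).1.mulVec (k.1.1.mulVec w)) ∂μ)
        = orbitIntegral a r₀ B f (h, r, stdForm a w) / weightMass a := by
      calc _ = Real.exp t ^ d / (cL * weightMass a) *
            (Zω * ∫ k : realK a, f ((realDiag d t).1.mulVec (k.1.1.mulVec w)) ∂μ) := by ring
        _ = (Real.exp t ^ d * h ^ d) * (orbitIntegral a r₀ B f (h, r, stdForm a w)
              / weightMass a) := by
            rw [h5]; field_simp
        _ = _ := by rw [hEh, one_mul]
    rw [h6, abs_sub_comm]
    have h7 : realJ a f r (stdForm a w)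
        = orbitIntegral a r₀ B f (0, r, stdForm a w) / weightMass a := by
      rw [h3, mul_div_cancel_left₀ _ hW.ne']
    rw [h7, ← sub_div, abs_div, abs_of_pos hW, div_le_iff₀ hW]
    rw [Real.dist_eq] at h4
    exact h4.le
  · have hf0 : ∀ k : realK a, f ((realDiag d t).1.mulVec (k.1.1.mulVec w)) = 0 := by
      intro k
      by_contra hne
      have hk : IsFormOrthogonal a k.1.1 := k.2
      obtain ⟨h1, h2⟩ := hrC _ hne
      have h3 := contraction_length_bounds hh hh1.le (k.1.1.mulVec w) hr₀ hr0
        (by rw [hk.dotProduct_mulVec]; exact hr2) h1 h2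
      have h4 : ((realDiag d t).1.mulVec (k.1.1.mulVec w)) 0 ≤ C :=
        (le_abs_self _).trans ((norm_le_pi_norm _ 0).trans h2)
      have h5 := abs_stdForm_le ha h2
      rw [stdForm_diagSL, hk.1] at h5
      refine hreg ⟨⟨h1.trans h3.1, ?_⟩, h5⟩
      have h6 : h ^ 2 * ((d + 1) * C ^ 2 / r₀) ≤ (d + 1) * C ^ 2 / r₀ :=
        mul_le_of_le_one_left (by positivity) (pow_le_one₀ hh.le hh1.le)
      rw [hr₁]
      linarith [h3.2, hdiag (k.1.1.mulVec w)]
    have hJ0 : realJ a f r (stdForm a w) = 0 := by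
      refine realJ_eq_zero_of fun y => ?_
      by_contra hne
      obtain ⟨h1, h2⟩ := hrC _ hne
      have h3 : r ≤ C := by
        have := (le_abs_self _).trans ((norm_le_pi_norm _ 0).trans h2)
        rwa [levelPoint_eq_mkVec, mkVec_zero] at this
      rw [levelPoint_eq_mkVec, mkVec_zero] at h1
      have h4 := abs_stdForm_le ha h2
      rw [stdForm_levelPoint _ _ _ (hr₀.trans_le h1).ne'] at h4
      refine hreg ⟨⟨h1, h3.trans ?_⟩, h4⟩
      rw [hr₁]
      exact le_add_of_nonneg_right (by positivity)
    simp only [hf0, hJ0, integral_zero, mul_zero, sub_zero, abs_zero]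
    exact hδ.le

end RealAsymptotic

/-! ### The asymptotic formula at the real place, relative error -/

section RealLocal

variable {d : ℕ}

theorem norm_sq_le_dotProduct {n : ℕ} (x : Fin n → ℝ) : ‖x‖ ^ 2 ≤ x ⬝ᵥ x := by
  rw [← euclNorm_sq]
  refine pow_le_pow_left₀ (norm_nonneg _) ?_ 2
  refine (pi_norm_le_iff_of_nonneg (euclNorm_nonneg x)).2 fun i => ?_
  rw [Real.norm_eq_abs]
  refine Real.abs_le_sqrt ?_
  exact Finset.single_le_sum (f := fun j => x j ^ 2) (fun j _ => sq_nonneg _) (Finset.mem_univ i)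

theorem isCompact_euclSphere (n : ℕ) : IsCompact {x : Fin n → ℝ | euclNorm x = 1} := by
  refine Metric.isCompact_of_isClosed_isBounded ?_ ?_
  · exact isClosed_eq (by unfold euclNorm; fun_prop) continuous_const
  · refine (Metric.isBounded_closedBall (x := (0 : Fin n → ℝ)) (r := 1)).subset fun x hx => ?_
    have hx' : euclNorm x = 1 := hx
    have := norm_sq_le_dotProduct x
    rw [← euclNorm_sq, hx', one_pow] at this
    rw [mem_closedBall_zero_iff]
    nlinarith [norm_nonneg x]

theorem euclNorm_eq_one_iff {n : ℕ} (x : Fin n → ℝ) : euclNorm x = 1 ↔ x ⬝ᵥ x = 1 := by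
  rw [← euclNorm_sq]
  constructor
  · intro h; rw [h, one_pow]
  · intro h
    exact (pow_eq_one_iff_of_nonneg (euclNorm_nonneg x) two_ne_zero).1 h

theorem euclNorm_pos {n : ℕ} {x : Fin n → ℝ} (hx : x ≠ 0) : 0 < euclNorm x := by
  refine (euclNorm_nonneg x).lt_of_ne' fun h => hx ?_
  rw [← dotProduct_self_eq_zero, ← euclNorm_sq, h, zero_pow two_ne_zero]

theorem realJ_pos {a : Fin d → ℝ} {f : (Fin (d + 2) → ℝ) → ℝ} (hf : Continuous f)
    (hfc : HasCompactSupport f) (hf0 : ∀ x, 0 ≤ f x) {z : Fin (d + 2) → ℝ} (hz : 0 < z 0)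
    (hfz : f z ≠ 0) : 0 < realJ a f (z 0) (stdForm a z) := by
  obtain ⟨C, hC, hC'⟩ := hfc.isCompact.isBounded.exists_pos_norm_le
  refine mul_pos (by positivity) ?_
  have hcont : Continuous fun y => levelPoint a (z 0) (stdForm a z) y := by
    simp only [levelPoint_eq_mkVec]
    exact continuous_mkVec continuous_const continuous_id (by fun_prop)
  refine (hf.comp hcont).integral_pos_of_hasCompactSupport_nonneg_nonzero ?_ (fun y => hf0 _)
    (x := midVec z) ?_
  · refine HasCompactSupport.intro (isCompact_closedBall 0 C) fun y hy => ?_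
    by_contra hne
    refine hy (mem_closedBall_zero_iff.2 ((pi_norm_le_iff_of_nonneg hC.le).2 fun i => ?_))
    have := (norm_le_pi_norm _ i.succ.castSucc).trans (hC' _ (subset_tsupport f hne))
    rwa [levelPoint_eq_mkVec, mkVec_mid'] at this
  · have := eq_levelPoint a z hz.ne'
    rwa [← this]

theorem exists_cutoff {X : Type*} [TopologicalSpace X] [T2Space X] [LocallyCompactSpace X]
    {K U : Set X} (hK : IsCompact K) (hU : IsOpen U) (hKU : K ⊆ U) :
    ∃ f : X → ℝ, Continuous f ∧ HasCompactSupport f ∧ tsupport f ⊆ U ∧ (∀ x ∈ K, f x = 1) ∧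
      ∀ x, 0 ≤ f x ∧ f x ≤ 1 := by
  obtain ⟨f, h1, h2, h3, h4⟩ := exists_continuous_sum_one_of_isOpen_isCompact (n := 1)
    (s := fun _ => U) (fun _ => hU) hK (fun x hx => Set.mem_iUnion.2 ⟨0, hKU hx⟩)
  refine ⟨f 0, (f 0).continuous, h4 0, h1 0, fun x hx => ?_, fun x => h3 0 x⟩
  have := h2 hx
  simpa using this

theorem continuous_realDiag_mulVec (a : Fin d → ℝ) (t : ℝ) (w : Fin (d + 2) → ℝ) :
    Continuous fun k : realK a => (realDiag d t).1.mulVec (k.1.1.mulVec w) :=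
  continuous_const.matrix_mulVec (continuous_realK_mulVec a w)

variable (a : Fin d → ℝ) [MeasurableSpace (realK a)] [BorelSpace (realK a)]
  (μ : Measure (realK a)) [μ.IsHaarMeasure] [IsProbabilityMeasure μ]

/-- The set of `k` that move `w` into a neighbourhood of the support of `f` is large as soon as it
meets the support. -/
theorem exists_real_lower_bound (ha : ∀ i, a i = 1 ∨ a i = -1) {c : ℝ} (hc : 0 < c)
    (hunif : ∀ f : (Fin (d + 2) → ℝ) → ℝ, Continuous f → HasCompactSupport f →
      tsupport f ⊆ {x | 0 < x 0} → ∀ δ > 0, ∃ T : ℝ, 0 < T ∧ ∀ t > T, ∀ w : Fin (d + 2) → ℝ,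
        |realJ a f (euclNorm w / Real.exp t) (stdForm a w) -
          c * (Real.exp t ^ d * ∫ k : realK a, f ((realDiag d t).1.mulVec (k.1.1.mulVec w)) ∂μ)|
          ≤ δ)
    {f : (Fin (d + 2) → ℝ) → ℝ} (hfc : HasCompactSupport f)
    (hfs : tsupport f ⊆ {x | 0 < x 0}) {N : Set (Fin (d + 2) → ℝ)} (hN : IsOpen N)
    (hfN : tsupport f ⊆ N) :
    ∃ κ > 0, ∃ T : ℝ, 0 < T ∧ ∀ t > T, ∀ w : Fin (d + 2) → ℝ,
      (realJ a f (euclNorm w / Real.exp t) (stdForm a w) ≠ 0 ∨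
        ∃ k : realK a, f ((realDiag d t).1.mulVec (k.1.1.mulVec w)) ≠ 0) →
      κ ≤ Real.exp t ^ d * μ.real {k | (realDiag d t).1.mulVec (k.1.1.mulVec w) ∈ N} := by
  have hpos : IsOpen {x : Fin (d + 2) → ℝ | 0 < x 0} :=
    isOpen_lt continuous_const (continuous_apply 0)
  -- `F` lies between the indicators of `supp f` and `N`, so its orbital integral bounds the measure
  -- of the set from below, and `realJ a F` is positive at all `(z_1, q⁰(z))` with `z ∈ supp f`.
  obtain ⟨F, hF, hFc, hFs, hF1, hF01⟩ := exists_cutoff hfc.isCompact (hN.inter hpos)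
    (Set.subset_inter hfN hfs)
  obtain ⟨r₀, hr₀, C, hC, hrC⟩ := real_support_bounds hfc hfs
  set C' : Set (ℝ × ℝ) := (fun z : Fin (d + 2) → ℝ => (z 0, stdForm a z)) '' tsupport f with hC'
  have hC'c : IsCompact C' :=
    hfc.isCompact.image ((continuous_apply 0).prodMk (continuous_stdForm a))
  set U : Set (ℝ × ℝ) := {p | 0 < p.1} ∩ (fun p : ℝ × ℝ => realJ a F p.1 p.2) ⁻¹' Set.Ioi 0
    with hU
  have hUo : IsOpen U := (continuousOn_realJ ha hF hFc).isOpen_inter_preimage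
    (isOpen_lt continuous_const continuous_fst) isOpen_Ioi
  have hCU : C' ⊆ U := by
    rintro _ ⟨z, hz, rfl⟩
    exact ⟨hfs hz, realJ_pos hF hFc (fun x => (hF01 x).1) (hfs hz) (by rw [hF1 z hz]; norm_num)⟩
  -- Room is needed around `C'` because `r` differs from the first coordinate of `a_t k w` by a
  -- quantity of order `h ^ 2`.
  obtain ⟨ρ, hρ, hρU⟩ := hC'c.exists_cthickening_subset_open hUo hCU
  obtain ⟨κ, hκ, hκle⟩ := (hC'c.cthickening (r := ρ)).exists_forall_le'
    (f := fun p : ℝ × ℝ => realJ a F p.1 p.2) (a := 0)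
    ((continuousOn_realJ ha hF hFc).mono fun p hp => (hρU hp).1) (fun p hp => (hρU hp).2)
  obtain ⟨T₁, hT₁, hF'⟩ := hunif F hF hFc (hFs.trans Set.inter_subset_right) (κ / 2) (half_pos hκ)
  have hev : ∀ᶠ h in nhds (0 : ℝ), h < 1 ∧ h ^ 2 * ((d + 1) * C ^ 2 / r₀) < ρ := by
    have key : ∀ {G : ℝ → ℝ} {b : ℝ}, Continuous G → G 0 < b → ∀ᶠ h in nhds 0, G h < b :=
      fun {G b} hG hlt => (hG.tendsto 0).eventually_lt_const hlt
    exact (key continuous_id one_pos).and (key (by fun_prop) (by simpa using hρ))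
  obtain ⟨T₂, hT₂, hT₂'⟩ := exists_eventually_exp_neg hev
  -- `realJ a F ≥ κ` with approximation error `κ / 2` leaves `c e ^ (t d) ∫ F ≥ κ / 2`, and `∫ F` is
  -- at most the measure in question.
  refine ⟨κ / 2 / c, by positivity, max T₁ T₂, lt_max_of_lt_left hT₁, fun t ht w hcase => ?_⟩
  obtain ⟨hh1, hhρ⟩ := hT₂' t ((le_max_right _ _).trans_lt ht)
  set r := euclNorm w / Real.exp t with hr
  have hr0 : 0 ≤ r := div_nonneg (euclNorm_nonneg w) (Real.exp_pos t).le
  have hmem : (r, stdForm a w) ∈ Metric.cthickening ρ C' := by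
    rcases hcase with hJ | ⟨k, hk⟩
    · have : ∃ y, f (levelPoint a r (stdForm a w) y) ≠ 0 := by
        by_contra hne
        push Not at hne
        exact hJ (realJ_eq_zero_of hne)
      obtain ⟨y, hy⟩ := this
      refine Metric.self_subset_cthickening _ ⟨_, subset_tsupport f hy, ?_⟩
      have h1 := (hrC _ hy).1
      rw [levelPoint_eq_mkVec, mkVec_zero] at h1
      simp only
      rw [stdForm_levelPoint _ _ _ (hr₀.trans_le h1).ne', levelPoint_eq_mkVec, mkVec_zero]
    · have hk' : IsFormOrthogonal a k.1.1 := k.2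
      obtain ⟨h1, h2⟩ := hrC _ hk
      have h3 := contraction_length_bounds (Real.exp_pos (-t)) hh1.le (k.1.1.mulVec w) hr₀ hr0
        (by rw [hk'.dotProduct_mulVec]; exact scaled_euclNorm_sq w t) h1 h2
      refine Metric.mem_cthickening_of_dist_le _ _ _ _
        ⟨_, subset_tsupport f hk, rfl⟩ ?_
      dsimp only
      rw [stdForm_diagSL, hk'.1, Prod.dist_eq, dist_self, max_eq_left dist_nonneg, Real.dist_eq,
        abs_of_nonneg (sub_nonneg.2 h3.1)]
      exact h3.2.trans hhρ.le
  have h1 := hκle _ hmem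
  have h2 := (abs_le.1 (hF' t ((le_max_left _ _).trans_lt ht) w)).2
  have hcw := continuous_realDiag_mulVec a t w
  set E : Set (realK a) := {k | (realDiag d t).1.mulVec (k.1.1.mulVec w) ∈ N} with hE
  have hEm : MeasurableSet E := (hN.preimage hcw).measurableSet
  have h3 : ∫ k : realK a, F ((realDiag d t).1.mulVec (k.1.1.mulVec w)) ∂μ ≤ μ.real E := by
    have h4 : ∫ k : realK a, E.indicator (fun _ => (1 : ℝ)) k ∂μ = μ.real E := by
      rw [integral_indicator hEm, setIntegral_const, smul_eq_mul, mul_one]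
    rw [← h4]
    refine integral_mono ((hF.comp hcw).integrable_of_hasCompactSupport
      (HasCompactSupport.of_compactSpace _)) ((integrable_const _).indicator hEm) fun k => ?_
    by_cases hk : k ∈ E
    · rw [Set.indicator_of_mem hk]; exact (hF01 _).2
    · rw [Set.indicator_of_notMem hk]
      refine le_of_eq ?_
      by_contra hne
      exact hk (hFs (subset_tsupport F hne)).1
  rw [div_le_iff₀ hc]
  have h5 : c * (Real.exp t ^ d * ∫ k : realK a, F ((realDiag d t).1.mulVec (k.1.1.mulVec w)) ∂μ)
      ≤ c * (Real.exp t ^ d * μ.real E) := by gcongr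
  simp only at h1
  linarith

/-- The asymptotic formula at the real place, with an error relative to the measure of the
transformations that contribute. -/
theorem exists_real_local_asymptotic (hd : 0 < d) (ha : ∀ i, a i = 1 ∨ a i = -1) :
    ∃ c : ℝ, 0 < c ∧ ∀ f : (Fin (d + 2) → ℝ) → ℝ, Continuous f → HasCompactSupport f →
      tsupport f ⊆ {x | 0 < x 0} → ∀ ν : (Fin (d + 2) → ℝ) → ℝ,
      ContinuousOn ν {x | euclNorm x = 1} → ∀ N : Set (Fin (d + 2) → ℝ), IsOpen N →
      tsupport f ⊆ N → ∀ δ > 0, ∃ T : ℝ, 0 < T ∧ ∀ t > T, ∀ w : Fin (d + 2) → ℝ, w ≠ 0 →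
        |realJ a f (euclNorm w / Real.exp t) (stdForm a w) * ν ((euclNorm w)⁻¹ • w) -
          c * (Real.exp t ^ d * ∫ k : realK a, f ((realDiag d t).1.mulVec (k.1.1.mulVec w)) *
            ν ((k.1⁻¹).1.mulVec (Pi.single 0 1)) ∂μ)|
          ≤ δ * (Real.exp t ^ d *
            μ.real {k : realK a | (realDiag d t).1.mulVec (k.1.1.mulVec w) ∈ N}) := by
  obtain ⟨c, hc, hunif⟩ := exists_real_uniform_asymptotic a μ hd ha
  refine ⟨c, hc, fun f hf hfc hfs ν hν N hN hfN δ hδ => ?_⟩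
  obtain ⟨κ, hκ, T₁, hT₁, hlow⟩ := exists_real_lower_bound a μ ha hc hunif hfc hfs hN hfN
  obtain ⟨r₀, hr₀, C, hC, hrC⟩ := real_support_bounds hfc hfs
  obtain ⟨D', hD'⟩ := hfc.exists_bound_of_continuous hf
  obtain ⟨V', hV'⟩ := (isCompact_euclSphere (d + 2)).exists_bound_of_continuousOn hν
  set D := max D' 1 with hDdef
  set V := max V' 1 with hVdef
  have hD : ∀ x, ‖f x‖ ≤ D := fun x => (hD' x).trans (le_max_left _ _)
  have hV : ∀ x, euclNorm x = 1 → ‖ν x‖ ≤ V := fun x hx => (hV' x hx).trans (le_max_left _ _)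
  have hD0 : 0 < D := lt_of_lt_of_le one_pos (le_max_right _ _)
  have hV0 : 0 < V := lt_of_lt_of_le one_pos (le_max_right _ _)
  -- After multiplication by `|ν| ≤ V` this error is `δ κ / 2`, at most half the allowed relative
  -- error by the lower bound `κ`. The variation `ω` of `ν` accounts for the other half.
  obtain ⟨T₂, hT₂, hfT⟩ := hunif f hf hfc hfs (δ * κ / (2 * V)) (by positivity)
  set ω := δ / (2 * c * D) with hω
  have hω0 : 0 < ω := by positivity
  obtain ⟨ρ, hρ, hνρ⟩ := Metric.uniformContinuousOn_iff.1
    ((isCompact_euclSphere (d + 2)).uniformContinuousOn_of_continuous hν) ω hω0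
  have hev : ∀ᶠ h in nhds (0 : ℝ), h < 1 ∧
      h ^ 2 * (2 * ((d + 1) * C ^ 2 / r₀) / r₀) < ρ ^ 2 := by
    have key : ∀ {G : ℝ → ℝ} {b : ℝ}, Continuous G → G 0 < b → ∀ᶠ h in nhds 0, G h < b :=
      fun {G b} hG hlt => (hG.tendsto 0).eventually_lt_const hlt
    exact (key continuous_id one_pos).and (key (by fun_prop) (by simpa using pow_pos hρ 2))
  obtain ⟨T₃, hT₃, hT₃'⟩ := exists_eventually_exp_neg hev
  refine ⟨max T₁ (max T₂ T₃), lt_max_of_lt_left hT₁, fun t ht w hw => ?_⟩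
  have ht1 : t > T₁ := (le_max_left _ _).trans_lt ht
  have ht2 : t > T₂ := ((le_max_left _ _).trans (le_max_right _ _)).trans_lt ht
  have ht3 : t > T₃ := ((le_max_right _ _).trans (le_max_right _ _)).trans_lt ht
  obtain ⟨hh1, hhρ⟩ := hT₃' t ht3
  have hJ := hfT t ht2 w
  have hlow' := hlow t ht1 w
  have hwn := euclNorm_pos hw
  set u := (euclNorm w)⁻¹ • w with hu
  set r := euclNorm w / Real.exp t with hr
  have hr0 : 0 ≤ r := div_nonneg (euclNorm_nonneg w) (Real.exp_pos t).le
  have hE0 : 0 < Real.exp t ^ d := pow_pos (Real.exp_pos t) d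
  have hu1 : u ⬝ᵥ u = 1 := by
    rw [hu, smul_dotProduct, dotProduct_smul, ← euclNorm_sq, smul_eq_mul, smul_eq_mul]
    field_simp
  have hunit : ∀ k : realK a,
      euclNorm ((k.1⁻¹).1.mulVec (Pi.single 0 1) : Fin (d + 2) → ℝ) = 1 := by
    intro k
    have hk : IsFormOrthogonal a (k.1⁻¹).1 := (k⁻¹).2
    rw [euclNorm_eq_one_iff, hk.dotProduct_mulVec]
    simp
  have hcw := continuous_realDiag_mulVec a t w
  have hc1 : Continuous fun k : realK a => f ((realDiag d t).1.mulVec (k.1.1.mulVec w)) :=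
    hf.comp hcw
  have hc2 : Continuous fun k : realK a => ν ((k.1⁻¹).1.mulVec (Pi.single 0 1)) := by
    refine hν.comp_continuous ?_ hunit
    exact continuous_SL_mulVec (continuous_inv.comp continuous_subtype_val) continuous_const
  set E : Set (realK a) := {k | (realDiag d t).1.mulVec (k.1.1.mulVec w) ∈ N} with hE
  have hEm : MeasurableSet E := (hN.preimage hcw).measurableSet
  by_cases hcase : realJ a f r (stdForm a w) ≠ 0 ∨
        ∃ k : realK a, f ((realDiag d t).1.mulVec (k.1.1.mulVec w)) ≠ 0
  · have hκE := hlow' hcase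
    have hclose : ∀ k : realK a, f ((realDiag d t).1.mulVec (k.1.1.mulVec w)) ≠ 0 →
        |ν u - ν ((k.1⁻¹).1.mulVec (Pi.single 0 1))| ≤ ω := by
      intro k hk
      have hk' : IsFormOrthogonal a k.1.1 := k.2
      obtain ⟨h1, h2⟩ := hrC _ hk
      have h3 := contraction_length_bounds (Real.exp_pos (-t)) hh1.le (k.1.1.mulVec w) hr₀ hr0
        (by rw [hk'.dotProduct_mulVec]; exact scaled_euclNorm_sq w t) h1 h2
      have hz : ((realDiag d t).1.mulVec (k.1.1.mulVec w)) 0 = r * (k.1.1.mulVec u) 0 := by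
        rw [hu, Matrix.mulVec_smul, diagSL_mulVec, mkVec_zero, hr, Real.exp_neg, Pi.smul_apply,
          smul_eq_mul]
        field_simp
      set z₀ := ((realDiag d t).1.mulVec (k.1.1.mulVec w)) 0 with hz₀
      have hr₀r : r₀ ≤ r := h1.trans h3.1
      have hrpos : 0 < r := hr₀.trans_le hr₀r
      -- For unit vectors `|u - k⁻¹ e_1| ^ 2 = 2 (1 - (k u)_1)`, and `(k u)_1 = z₀ / r`, which
      -- differs from `1` by a quantity of order `h ^ 2`.
      have hdist : dist u ((k.1⁻¹).1.mulVec (Pi.single 0 1)) < ρ := by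
        rw [dist_eq_norm]
        refine lt_of_pow_lt_pow_left₀ 2 hρ.le ((norm_sq_le_dotProduct _).trans_lt ?_)
        have hkk : k.1.1.mulVec ((k.1⁻¹).1.mulVec (Pi.single 0 1)) = Pi.single 0 1 := by
          rw [Matrix.mulVec_mulVec, ← Matrix.SpecialLinearGroup.coe_mul, mul_inv_cancel,
            Matrix.SpecialLinearGroup.coe_one, Matrix.one_mulVec]
        rw [← hk'.dotProduct_mulVec, Matrix.mulVec_sub, hkk, sub_dotProduct, dotProduct_sub,
          dotProduct_sub, hk'.dotProduct_mulVec, hu1, dotProduct_single, single_dotProduct,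
          single_dotProduct, Pi.single_eq_same]
        have h4 : (k.1.1.mulVec u) 0 = z₀ / r := by rw [hz]; field_simp
        rw [h4]
        refine lt_of_le_of_lt ?_ hhρ
        have h5 : 1 - z₀ / r = (r - z₀) / r := by field_simp
        have h6 : (r - z₀) / r ≤ Real.exp (-t) ^ 2 * ((d + 1) * C ^ 2 / r₀) / r₀ := by
          refine div_le_div₀ (by positivity) h3.2 hr₀ hr₀r
        calc _ = 2 * (1 - z₀ / r) := by ring
          _ ≤ 2 * (Real.exp (-t) ^ 2 * ((d + 1) * C ^ 2 / r₀) / r₀) := by rw [h5]; gcongr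
          _ = _ := by ring
      have := hνρ u ((euclNorm_eq_one_iff u).2 hu1) _ (hunit k) hdist
      rw [Real.dist_eq] at this
      exact this.le
    set I := ∫ k : realK a, f ((realDiag d t).1.mulVec (k.1.1.mulVec w)) ∂μ with hI
    have hi1 : Integrable (fun k : realK a =>
        f ((realDiag d t).1.mulVec (k.1.1.mulVec w)) * ν u) μ :=
      (hc1.mul continuous_const).integrable_of_hasCompactSupport
        (HasCompactSupport.of_compactSpace _)
    have hi2 : Integrable (fun k : realK a => f ((realDiag d t).1.mulVec (k.1.1.mulVec w)) *
        ν ((k.1⁻¹).1.mulVec (Pi.single 0 1))) μ :=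
      (hc1.mul hc2).integrable_of_hasCompactSupport (HasCompactSupport.of_compactSpace _)
    have hdiff : realJ a f r (stdForm a w) * ν u - c * (Real.exp t ^ d *
          ∫ k : realK a, f ((realDiag d t).1.mulVec (k.1.1.mulVec w)) *
            ν ((k.1⁻¹).1.mulVec (Pi.single 0 1)) ∂μ)
        = (realJ a f r (stdForm a w) - c * (Real.exp t ^ d * I)) * ν u + c * (Real.exp t ^ d *
          ∫ k : realK a, f ((realDiag d t).1.mulVec (k.1.1.mulVec w)) *
            (ν u - ν ((k.1⁻¹).1.mulVec (Pi.single 0 1))) ∂μ) := by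
      simp only [mul_sub]
      rw [integral_sub hi1 hi2, integral_mul_const, ← hI]
      ring
    have hbound : |∫ k : realK a, f ((realDiag d t).1.mulVec (k.1.1.mulVec w)) *
        (ν u - ν ((k.1⁻¹).1.mulVec (Pi.single 0 1))) ∂μ| ≤ D * ω * μ.real E := by
      have h1 : ∀ k : realK a, ‖f ((realDiag d t).1.mulVec (k.1.1.mulVec w)) *
          (ν u - ν ((k.1⁻¹).1.mulVec (Pi.single 0 1)))‖ ≤ E.indicator (fun _ => D * ω) k := by
        intro k
        by_cases hk : f ((realDiag d t).1.mulVec (k.1.1.mulVec w)) = 0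
        · rw [hk, zero_mul, norm_zero]
          exact Set.indicator_nonneg (fun _ _ => by positivity) _
        · have hkE : k ∈ E := hfN (subset_tsupport f hk)
          rw [Set.indicator_of_mem hkE, norm_mul]
          exact mul_le_mul (hD _) (hclose k hk) (norm_nonneg _) hD0.le
      have h2 := norm_integral_le_of_norm_le ((integrable_const (D * ω)).indicator hEm)
        (Filter.Eventually.of_forall h1) (μ := μ)
      rw [integral_indicator hEm, setIntegral_const, smul_eq_mul] at h2
      rw [← Real.norm_eq_abs]
      linarith
    rw [hdiff]
    refine (abs_add_le _ _).trans ?_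
    have ht1 : |(realJ a f r (stdForm a w) - c * (Real.exp t ^ d * I)) * ν u|
        ≤ δ / 2 * (Real.exp t ^ d * μ.real E) := by
      rw [abs_mul]
      calc _ ≤ δ * κ / (2 * V) * V :=
            mul_le_mul hJ (hV u ((euclNorm_eq_one_iff u).2 hu1)) (abs_nonneg _) (by positivity)
        _ = δ / 2 * κ := by field_simp
        _ ≤ _ := by gcongr
    have ht2 : |c * (Real.exp t ^ d * ∫ k : realK a,
          f ((realDiag d t).1.mulVec (k.1.1.mulVec w)) *
            (ν u - ν ((k.1⁻¹).1.mulVec (Pi.single 0 1))) ∂μ)|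
        ≤ δ / 2 * (Real.exp t ^ d * μ.real E) := by
      rw [abs_mul, abs_mul, abs_of_pos hc, abs_of_pos hE0]
      calc _ ≤ c * (Real.exp t ^ d * (D * ω * μ.real E)) := by gcongr
        _ = _ := by rw [hω]; field_simp
    linarith
  · push Not at hcase
    obtain ⟨hJ0, hf0⟩ := hcase
    simp only [hJ0, hf0, zero_mul, integral_zero, mul_zero, sub_zero, abs_zero]
    positivity

end RealLocal

/-! ### Haar measure on `K` and products of estimates -/

section ProductMeasure

instance secondCountable_subgroup {G : Type*} [Group G] [TopologicalSpace G]
    [SecondCountableTopology G] (H : Subgroup G) : SecondCountableTopology H :=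
  TopologicalSpace.Subtype.secondCountableTopology (H : Set G)

variable {Sf : Finset ℕ} [∀ p : Sf, Fact (p : ℕ).Prime] {d : ℕ}

/-- `sK a b` as a product of groups. -/
def sKEquiv (a : Fin d → ℝ) (b : ∀ p : Sf, Fin d → ℚ_[(p : ℕ)]) :
    (realK a × ∀ p : Sf, padicK (p : ℕ) (b p)) ≃ₜ* sK a b where
  toFun x := ⟨(x.1.1, fun p => (x.2 p).1), x.1.2, fun p _ => (x.2 p).2⟩
  invFun k := (⟨k.1.1, k.2.1⟩, fun p => ⟨k.1.2 p, k.2.2 p (Set.mem_univ p)⟩)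
  left_inv _ := rfl
  right_inv _ := rfl
  map_mul' _ _ := rfl
  continuous_toFun := by
    refine Continuous.subtype_mk (Continuous.prodMk ?_ ?_) _
    · exact continuous_subtype_val.comp continuous_fst
    · exact continuous_pi fun p =>
        continuous_subtype_val.comp ((continuous_apply p).comp continuous_snd)
  continuous_invFun := by
    refine Continuous.prodMk ?_ ?_
    · exact (continuous_fst.comp continuous_subtype_val).subtype_mk _
    · exact continuous_pi fun p =>
        ((continuous_apply p).comp (continuous_snd.comp continuous_subtype_val)).subtype_mk _

variable (a : Fin d → ℝ) (b : ∀ p : Sf, Fin d → ℚ_[(p : ℕ)])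

instance compactSpace_sK : CompactSpace (sK a b) :=
  (sKEquiv a b).toHomeomorph.compactSpace

variable [MeasurableSpace (sK a b)] [BorelSpace (sK a b)]
  (m : Measure (sK a b)) [m.IsHaarMeasure] [IsProbabilityMeasure m]
  [MeasurableSpace (realK a)] [BorelSpace (realK a)]
  (μ : Measure (realK a)) [μ.IsHaarMeasure] [IsProbabilityMeasure μ]
  [∀ p : Sf, MeasurableSpace (padicK (p : ℕ) (b p))]
  [∀ p : Sf, BorelSpace (padicK (p : ℕ) (b p))]
  (μp : ∀ p : Sf, Measure (padicK (p : ℕ) (b p))) [∀ p, (μp p).IsHaarMeasure]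
  [∀ p, IsProbabilityMeasure (μp p)]

/-- The image of the product measure is a Haar probability measure, and there is only one. -/
theorem map_sKEquiv : (μ.prod (Measure.pi μp)).map (sKEquiv a b) = m := by
  have h1 : IsProbabilityMeasure ((μ.prod (Measure.pi μp)).map (sKEquiv a b)) :=
    Measure.isProbabilityMeasure_map (sKEquiv a b).continuous.measurable.aemeasurable
  have h2 : ((μ.prod (Measure.pi μp)).map (sKEquiv a b)).IsHaarMeasure :=
    (sKEquiv a b).toMulEquiv.isHaarMeasure_map _ (sKEquiv a b).continuous
      (sKEquiv a b).symm.continuous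
  exact Measure.isHaarMeasure_eq_of_isProbabilityMeasure _ _

theorem integral_sK_prod (F : Matrix.SpecialLinearGroup (Fin (d + 2)) ℝ → ℝ)
    (G : ∀ p : Sf, Matrix.SpecialLinearGroup (Fin (d + 2)) ℚ_[(p : ℕ)] → ℝ) :
    ∫ k : sK a b, F k.1.1 * ∏ p, G p (k.1.2 p) ∂m
      = (∫ k : realK a, F k.1 ∂μ) * ∏ p, ∫ k : padicK (p : ℕ) (b p), G p k.1 ∂(μp p) := by
  rw [← map_sKEquiv a b m μ μp]
  change ∫ k : sK a b, F k.1.1 * ∏ p, G p (k.1.2 p)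
    ∂((μ.prod (Measure.pi μp)).map (sKEquiv a b).toHomeomorph) = _
  rw [((sKEquiv a b).toHomeomorph.measurableEmbedding).integral_map,
    ← integral_fintype_prod_eq_prod (fun (p : Sf) (k : padicK (p : ℕ) (b p)) => G p k.1),
    ← integral_prod_mul]
  rfl

theorem measureReal_sK_prod (E : Set (Matrix.SpecialLinearGroup (Fin (d + 2)) ℝ))
    (E' : ∀ p : Sf, Set (Matrix.SpecialLinearGroup (Fin (d + 2)) ℚ_[(p : ℕ)])) :
    m.real {k : sK a b | k.1.1 ∈ E ∧ ∀ p : Sf, k.1.2 p ∈ E' p}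
      = μ.real {k : realK a | k.1 ∈ E} *
        ∏ p : Sf, (μp p).real {k : padicK (p : ℕ) (b p) | k.1 ∈ E' p} := by
  have h1 : (sKEquiv a b) ⁻¹' {k : sK a b | k.1.1 ∈ E ∧ ∀ p : Sf, k.1.2 p ∈ E' p}
      = {k : realK a | k.1 ∈ E} ×ˢ
        Set.univ.pi fun p : Sf => {k : padicK (p : ℕ) (b p) | k.1 ∈ E' p} := by
    ext x
    simp [sKEquiv]
  have h2 : m {k : sK a b | k.1.1 ∈ E ∧ ∀ p : Sf, k.1.2 p ∈ E' p}
      = μ {k : realK a | k.1 ∈ E} *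
        ∏ p : Sf, (μp p) {k : padicK (p : ℕ) (b p) | k.1 ∈ E' p} := by
    rw [← Measure.pi_pi, ← Measure.prod_prod, ← h1]
    conv_lhs => rw [← map_sKEquiv a b m μ μp]
    exact (sKEquiv a b).toHomeomorph.measurableEmbedding.map_apply _ _
  simp only [Measure.real, h2, ENNReal.toReal_mul, ENNReal.toReal_prod]

end ProductMeasure

/-- Replace the factors one at a time. Each `|A i|` is at most `(M i + δ) D i`, so every `D i`
survives as a factor and the error remains relative to `∏ D i`. -/
theorem abs_prod_sub_prod_le {ι : Type*} (s : Finset ι) {A B D M : ι → ℝ} {δ : ℝ} (hδ : 0 ≤ δ)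
    (hM : ∀ i, 0 ≤ M i) (hD : ∀ i, 0 ≤ D i) (h1 : ∀ i, |A i - B i| ≤ δ * D i)
    (h2 : ∀ i, |B i| ≤ M i * D i) :
    |∏ i ∈ s, A i - ∏ i ∈ s, B i|
      ≤ (∏ i ∈ s, (M i + δ) - ∏ i ∈ s, M i) * ∏ i ∈ s, D i := by
  classical
  have hA : ∀ i, |A i| ≤ (M i + δ) * D i := fun i => by
    have := abs_sub_abs_le_abs_sub (A i) (B i)
    linarith [h1 i, h2 i]
  induction s using Finset.induction_on with
  | empty => simp
  | insert j s hj ih =>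
    simp only [Finset.prod_insert hj]
    have e : A j * ∏ i ∈ s, A i - B j * ∏ i ∈ s, B i
        = (A j - B j) * ∏ i ∈ s, A i + B j * (∏ i ∈ s, A i - ∏ i ∈ s, B i) := by ring
    have h3 : |∏ i ∈ s, A i| ≤ (∏ i ∈ s, (M i + δ)) * ∏ i ∈ s, D i := by
      rw [Finset.abs_prod, ← Finset.prod_mul_distrib]
      exact Finset.prod_le_prod (fun i _ => abs_nonneg _) fun i _ => hA i
    have h4 : 0 ≤ ∏ i ∈ s, D i := Finset.prod_nonneg fun i _ => hD i
    have h5 : 0 ≤ M j * D j := mul_nonneg (hM j) (hD j)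
    rw [e]
    refine (abs_add_le _ _).trans ?_
    rw [abs_mul, abs_mul]
    have h6 := mul_le_mul (h1 j) h3 (abs_nonneg _) (mul_nonneg hδ (hD j))
    have h7 := mul_le_mul (h2 j) ih (abs_nonneg _) h5
    refine (add_le_add h6 h7).trans (le_of_eq ?_)
    ring

theorem exists_prod_add_sub_lt {ι : Type*} [Fintype ι] (M : ι → ℝ) {ε : ℝ} (hε : 0 < ε) :
    ∃ δ > 0, ∏ i, (M i + δ) - ∏ i, M i < ε := by
  have hc : Continuous fun δ : ℝ => ∏ i, (M i + δ) - ∏ i, M i := by fun_prop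
  have h := (hc.tendsto 0).eventually_lt_const (u := ε) (by simpa using hε)
  obtain ⟨ρ, hρ, hρ'⟩ := Metric.eventually_nhds_iff.1 h
  refine ⟨ρ / 2, half_pos hρ, hρ' ?_⟩
  rw [Real.dist_eq, sub_zero, abs_of_pos (half_pos hρ)]
  exact half_lt_self hρ

theorem abs_integral_mul_le {X : Type*} [MeasurableSpace X] (μ : Measure X) [IsFiniteMeasure μ]
    {F G : X → ℝ} {E : Set X} (hE : MeasurableSet E) {C V : ℝ} (hC : 0 ≤ C) (hV : 0 ≤ V)
    (hF : ∀ x, |F x| ≤ C) (hFE : ∀ x, F x ≠ 0 → x ∈ E) (hG : ∀ x, |G x| ≤ V) :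
    |∫ x, F x * G x ∂μ| ≤ C * V * μ.real E := by
  have h1 : ∀ x, ‖F x * G x‖ ≤ E.indicator (fun _ => C * V) x := by
    intro x
    by_cases hx : F x = 0
    · rw [hx, zero_mul, norm_zero]
      exact Set.indicator_nonneg (fun _ _ => mul_nonneg hC hV) _
    · rw [Set.indicator_of_mem (hFE x hx), norm_mul]
      exact mul_le_mul (hF x) (hG x) (norm_nonneg _) hC
  have h2 := norm_integral_le_of_norm_le ((integrable_const (C * V)).indicator hE)
    (Filter.Eventually.of_forall h1) (μ := μ)
  rw [integral_indicator hE, setIntegral_const, smul_eq_mul] at h2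
  rw [← Real.norm_eq_abs]
  linarith

/-! ### The asymptotic formula over all places for one vector -/

section SAsymptotic

variable {Sf : Finset ℕ} [∀ p : Sf, Fact (p : ℕ).Prime] {d : ℕ}

/-- A non-square modulo `p` is in particular non-zero modulo `p`, so `u₀` is a unit. -/
theorem norm_of_isStdPadicCoeff {p : ℕ} [hp : Fact p.Prime] {u₀ : ℤ}
    (hu₀ : ¬ IsSquare (u₀ : ZMod p)) {x : ℚ_[p]} (hx : IsStdPadicCoeff p u₀ x) :
    ‖x‖ = 1 ∨ ‖x‖ = (p : ℝ)⁻¹ := by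
  have hu : ‖(u₀ : ℚ_[p])‖ = 1 := by
    refine le_antisymm (Padic.norm_int_le_one u₀) (not_lt.1 fun h => hu₀ ?_)
    rw [Padic.norm_intCast_lt_one_iff] at h
    rw [(ZMod.intCast_zmod_eq_zero_iff_dvd u₀ p).2 h]
    exact IsSquare.zero
  obtain ⟨s, hs, hxs⟩ := hx
  have hn : ‖x‖ = ‖s‖ := by rcases hxs with h | h <;> simp [h]
  rw [hn]
  rcases hs with h | h | h | h
  · left; rw [h, norm_one]
  · left; rw [h, hu]
  · right; rw [h, Padic.norm_p]
  · right; rw [h, norm_mul, hu, Padic.norm_p, mul_one]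

theorem sAct_mul {n : ℕ} (g h : SGroup Sf n) (v : SSpace Sf n) :
    sAct (g * h) v = sAct g (sAct h v) := by
  refine Prod.ext ?_ (funext fun p => ?_)
  · exact (Matrix.mulVec_mulVec v.1 g.1.1 h.1.1).symm
  · exact (Matrix.mulVec_mulVec (v.2 p) (g.2 p).1 (h.2 p).1).symm

theorem sAct_one {n : ℕ} (v : SSpace Sf n) : sAct (1 : SGroup Sf n) v = v :=
  Prod.ext (Matrix.one_mulVec _) (funext fun _ => Matrix.one_mulVec _)

variable (a : Fin d → ℝ) (b : ∀ p : Sf, Fin d → ℚ_[(p : ℕ)])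
  [MeasurableSpace (sK a b)] [BorelSpace (sK a b)]
  (m : Measure (sK a b)) [m.IsHaarMeasure] [IsProbabilityMeasure m]

/-- The asymptotic formula over all places for a single vector, with an error relative to the
measure of the transformations that contribute. -/
theorem exists_S_local_asymptotic
    [MeasurableSpace (realK a)] [BorelSpace (realK a)]
    (μ : Measure (realK a)) [μ.IsHaarMeasure] [IsProbabilityMeasure μ]
    [∀ p : Sf, MeasurableSpace (padicK (p : ℕ) (b p))]
    [∀ p : Sf, BorelSpace (padicK (p : ℕ) (b p))]
    (μp : ∀ p : Sf, Measure (padicK (p : ℕ) (b p))) [∀ p, (μp p).IsHaarMeasure]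
    [∀ p, IsProbabilityMeasure (μp p)]
    (hp2 : ∀ p : Sf, (p : ℕ) ≠ 2) (hd : d = 1 ∨ d = 2)
    (ha : ∀ i, a i = 1 ∨ a i = -1)
    (hb : ∀ (p : Sf) i, ‖b p i‖ = 1 ∨ ‖b p i‖ = ((p : ℕ) : ℝ)⁻¹)
    (hsplit : ∀ (p : Sf) (i j : Fin d), i ≠ j → IsSquare (-(b p i * b p j)) →
      ¬ (‖b p i‖ < 1 ∧ ‖b p j‖ < 1)) :
    ∃ c : ℝ, 0 < c ∧ ∀ (f : (Fin (d + 2) → ℝ) → ℝ)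
      (φ : ∀ p : Sf, (Fin (d + 2) → ℚ_[(p : ℕ)]) → ℝ),
      Continuous f → HasCompactSupport f → tsupport f ⊆ {x | 0 < x 0} →
      (∀ p, Continuous (φ p)) → (∀ p, HasCompactSupport (φ p)) →
      (∀ p, tsupport (φ p) ⊆ {x | x 0 ≠ 0}) →
      (∀ (p : Sf) (u : ℚ_[(p : ℕ)]) (hu : u ≠ 0), ‖u‖ = 1 →
        ∀ x, φ p ((diagSL d u hu).1.mulVec x) = φ p x) →
      ∀ (ν : (Fin (d + 2) → ℝ) → ℝ) (η : ∀ p : Sf, (Fin (d + 2) → ℚ_[(p : ℕ)]) → ℝ),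
      ContinuousOn ν {x | euclNorm x = 1} → (∀ p, ContinuousOn (η p) {x | ‖x‖ = 1}) →
      (∀ (p : Sf) (u : ℚ_[(p : ℕ)]), ‖u‖ = 1 → ∀ x, ‖x‖ = 1 → η p (u • x) = η p x) →
      ∀ (N : Set (Fin (d + 2) → ℝ)) (N' : ∀ p : Sf, Set (Fin (d + 2) → ℚ_[(p : ℕ)])),
      IsOpen N → (∀ p, IsOpen (N' p)) → tsupport f ⊆ N → (∀ p, tsupport (φ p) ⊆ N' p) →
      ∀ ε > 0, ∃ t₀ : ℝ × (Sf → ℤ), 0 < t₀.1 ∧ (∀ p, 0 < t₀.2 p) ∧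
        ∀ t : ℝ × (Sf → ℤ), t₀.1 < t.1 → (∀ p, t₀.2 p < t.2 p) →
        ∀ w : SSpace Sf (d + 2), w.1 ≠ 0 → (∀ p, w.2 p ≠ 0) →
          |sJ a b f φ t w (stdForm a w.1, fun p => stdForm (b p) (w.2 p)) * sProd ν η (sUnit w)
            - c * (sVol Sf t ^ d * ∫ k : sK a b, sProd f φ (sAct (sDiag Sf d t * k.1) w) *
              sProd ν η (sAct k.1⁻¹ (sE1 Sf d)) ∂m)|
          ≤ ε * (sVol Sf t ^ d * m.real {k : sK a b |
              (sAct (sDiag Sf d t * k.1) w).1 ∈ N ∧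
                ∀ p, (sAct (sDiag Sf d t * k.1) w).2 p ∈ N' p}) := by
  have hd0 : 0 < d := by omega
  obtain ⟨cr, hcr, hreal⟩ := exists_real_local_asymptotic a μ hd0 ha
  have hpad := fun p : Sf => exists_padic_local_asymptotic (b p) (μp p) (hp2 p) hd (hb p) (hsplit p)
  choose cp hcp hpadic using hpad
  refine ⟨cr * ∏ p, cp p, mul_pos hcr (Finset.prod_pos fun p _ => hcp p), ?_⟩
  intro f φ hf hfc hfs hφ hφc hφs hφu ν η hν hη hηu N N' hN hN' hfN hφN ε hε
  -- bounds
  obtain ⟨D, hD⟩ := hfc.exists_bound_of_continuous hf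
  obtain ⟨V, hV⟩ := (isCompact_euclSphere (d + 2)).exists_bound_of_continuousOn hν
  choose Dp hDp using fun p => (hφc p).exists_bound_of_continuous (hφ p)
  have hsph : ∀ p : Sf, IsCompact {x : Fin (d + 2) → ℚ_[(p : ℕ)] | ‖x‖ = 1} := fun p => by
    have : {x : Fin (d + 2) → ℚ_[(p : ℕ)] | ‖x‖ = 1} = Metric.sphere 0 1 := by ext x; simp
    rw [this]; exact isCompact_sphere _ _
  choose Vp hVp using fun p => (hsph p).exists_bound_of_continuousOn (hη p)
  have hD0 : 0 ≤ D := (norm_nonneg _).trans (hD 0)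
  have hDp0 : ∀ p, 0 ≤ Dp p := fun p => (norm_nonneg _).trans (hDp p 0)
  have hunit : ∀ k : realK a,
      euclNorm ((k.1⁻¹).1.mulVec (Pi.single 0 1) : Fin (d + 2) → ℝ) = 1 := by
    intro k
    have hk : IsFormOrthogonal a (k.1⁻¹).1 := (k⁻¹).2
    rw [euclNorm_eq_one_iff, hk.dotProduct_mulVec]
    simp
  have hunitp : ∀ (p : Sf) (k : padicK (p : ℕ) (b p)),
      ‖((k.1⁻¹).1.mulVec (Pi.single 0 1) : Fin (d + 2) → ℚ_[(p : ℕ)])‖ = 1 := by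
    intro p k
    rw [norm_padicK_mulVec (inv_mem k.2), Pi.norm_single]; simp
  have hV0 : 0 ≤ V := (norm_nonneg _).trans (hV _ (hunit 1))
  have hVp0 : ∀ p, 0 ≤ Vp p := fun p => (norm_nonneg _).trans (hVp p _ (hunitp p 1))
  -- The places are indexed by `Option Sf`, with `none` the real one. `M` bounds each local integral
  -- term relative to the local measure, as `abs_prod_sub_prod_le` requires.
  set M : Option Sf → ℝ := fun o => o.elim (cr * (D * V)) fun p => cp p * (Dp p * Vp p) with hM
  obtain ⟨δ, hδ, hδε⟩ := exists_prod_add_sub_lt M hε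
  obtain ⟨T, hT, hT'⟩ := hreal f hf hfc hfs ν hν N hN hfN δ hδ
  choose Tp hTp hTp' using fun p =>
    hpadic p (φ p) (hφ p) (hφc p) (hφs p) (hφu p) (η p) (hη p) (hηu p) (N' p) (hφN p) δ hδ
  refine ⟨(T, Tp), hT, hTp, fun t ht htp w hw hwp => ?_⟩
  have hE : 0 < Real.exp t.1 := Real.exp_pos _
  have hEp : ∀ p : Sf, 0 < ((p : ℕ) : ℝ) ^ t.2 p := fun p =>
    zpow_pos (Nat.cast_pos.2 (Fact.out : (p : ℕ).Prime).pos) _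
  -- the local quantities
  set A : Option Sf → ℝ := fun o => o.elim
    (realJ a f (euclNorm w.1 / Real.exp t.1) (stdForm a w.1) * ν ((euclNorm w.1)⁻¹ • w.1))
    fun p => padicJ (p : ℕ) (b p) (φ p)
      (((p : ℕ) : ℚ_[(p : ℕ)]) ^ (t.2 p - padicExp (p : ℕ) (w.2 p))) (stdForm (b p) (w.2 p)) *
      η p (((p : ℕ) : ℚ_[(p : ℕ)]) ^ padicExp (p : ℕ) (w.2 p) • w.2 p) with hA
  set I := ∫ k : realK a, f ((realDiag d t.1).1.mulVec (k.1.1.mulVec w.1)) *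
            ν ((k.1⁻¹).1.mulVec (Pi.single 0 1)) ∂μ with hI
  set Ip : Sf → ℝ := fun p => ∫ k : padicK (p : ℕ) (b p),
    φ p ((padicDiag p d (t.2 p)).1.mulVec (k.1.1.mulVec (w.2 p))) *
            η p ((k.1⁻¹).1.mulVec (Pi.single 0 1)) ∂(μp p) with hIp
  set S := μ.real {k : realK a | (realDiag d t.1).1.mulVec (k.1.1.mulVec w.1) ∈ N} with hS
  set Sp : Sf → ℝ := fun p => (μp p).real {k : padicK (p : ℕ) (b p) |
    (padicDiag p d (t.2 p)).1.mulVec (k.1.1.mulVec (w.2 p)) ∈ N' p} with hSp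
  set B : Option Sf → ℝ := fun o => o.elim (cr * (Real.exp t.1 ^ d * I))
    fun p => cp p * ((((p : ℕ) : ℝ) ^ t.2 p) ^ d * Ip p) with hB
  set R : Option Sf → ℝ := fun o => o.elim (Real.exp t.1 ^ d * S)
    fun p => (((p : ℕ) : ℝ) ^ t.2 p) ^ d * Sp p with hR
  have hM0 : ∀ o, 0 ≤ M o := by
    rintro (_ | p)
    · exact mul_nonneg hcr.le (mul_nonneg hD0 hV0)
    · exact mul_nonneg (hcp p).le (mul_nonneg (hDp0 p) (hVp0 p))
  have hR0 : ∀ o, 0 ≤ R o := by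
    rintro (_ | p)
    · exact mul_nonneg (pow_nonneg hE.le _) measureReal_nonneg
    · exact mul_nonneg (pow_nonneg (hEp p).le _) measureReal_nonneg
  have hAB : ∀ o, |A o - B o| ≤ δ * R o := by
    rintro (_ | p)
    · exact hT' t.1 ht w.1 hw
    · exact hTp' p (t.2 p) (htp p) (w.2 p) (hwp p)
  have hBM : ∀ o, |B o| ≤ M o * R o := by
    rintro (_ | p)
    · have h1 : |I| ≤ D * V * S := abs_integral_mul_le μ
        (hN.preimage (continuous_realDiag_mulVec a t.1 w.1)).measurableSet hD0 hV0
        (fun k => hD _) (fun k hk => hfN (subset_tsupport f hk)) (fun k => hV _ (hunit k))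
      change |cr * (Real.exp t.1 ^ d * I)| ≤ cr * (D * V) * (Real.exp t.1 ^ d * S)
      rw [abs_mul, abs_mul, abs_of_pos hcr, abs_of_pos (pow_pos hE d)]
      calc _ ≤ cr * (Real.exp t.1 ^ d * (D * V * S)) := by gcongr
        _ = _ := by ring
    · have h1 : |Ip p| ≤ Dp p * Vp p * Sp p := abs_integral_mul_le (μp p)
        ((hN' p).preimage (continuous_const.matrix_mulVec
          (continuous_padicK_mulVec (b p) (w.2 p)))).measurableSet (hDp0 p) (hVp0 p)
        (fun k => hDp p _) (fun k hk => hφN p (subset_tsupport (φ p) hk))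
        (fun k => hVp p _ (hunitp p k))
      change |cp p * ((((p : ℕ) : ℝ) ^ t.2 p) ^ d * Ip p)|
        ≤ cp p * (Dp p * Vp p) * ((((p : ℕ) : ℝ) ^ t.2 p) ^ d * Sp p)
      rw [abs_mul, abs_mul, abs_of_pos (hcp p), abs_of_pos (pow_pos (hEp p) d)]
      calc _ ≤ cp p * ((((p : ℕ) : ℝ) ^ t.2 p) ^ d * (Dp p * Vp p * Sp p)) := by
            have := hcp p
            have := hEp p
            gcongr
        _ = _ := by ring
  have hmain := abs_prod_sub_prod_le Finset.univ hδ.le hM0 hR0 hAB hBM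
  have hprodA : ∏ o, A o = sJ a b f φ t w (stdForm a w.1, fun p => stdForm (b p) (w.2 p)) *
      sProd ν η (sUnit w) := by
    rw [Fintype.prod_option]
    simp only [hA, Option.elim, sJ, sProd, sUnit, Finset.prod_mul_distrib]
    ring
  have hprodB : ∏ o, B o = (cr * ∏ p, cp p) * (sVol Sf t ^ d *
      ∫ k : sK a b, sProd f φ (sAct (sDiag Sf d t * k.1) w) *
              sProd ν η (sAct k.1⁻¹ (sE1 Sf d)) ∂m) := by
    have h1 : ∫ k : sK a b, sProd f φ (sAct (sDiag Sf d t * k.1) w) *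
              sProd ν η (sAct k.1⁻¹ (sE1 Sf d)) ∂m = I * ∏ p, Ip p := by
      rw [hI, hIp]
      have := integral_sK_prod a b m μ μp
        (fun k => f ((realDiag d t.1).1.mulVec (k.1.mulVec w.1)) *
          ν ((k⁻¹).1.mulVec (Pi.single 0 1)))
        (fun p k => φ p ((padicDiag p d (t.2 p)).1.mulVec (k.1.mulVec (w.2 p))) *
            η p ((k⁻¹).1.mulVec (Pi.single 0 1)))
      rw [← this]
      congr 1
      funext k
      rw [sAct_mul]
      simp only [sProd, Finset.prod_mul_distrib]
      change f ((realDiag d t.1).1.mulVec (k.1.1.1.mulVec w.1)) *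
        (∏ p : Sf, φ p ((padicDiag p d (t.2 p)).1.mulVec ((k.1.2 p).1.mulVec (w.2 p)))) *
        (ν ((k.1.1⁻¹).1.mulVec (Pi.single 0 1)) *
          ∏ p : Sf, η p (((k.1.2 p)⁻¹).1.mulVec (Pi.single 0 1))) = _
      ring
    rw [h1, Fintype.prod_option]
    simp only [hB, Option.elim, sVol, Finset.prod_mul_distrib, Finset.prod_pow, mul_pow]
    ring
  have hprodR : ∏ o, R o = sVol Sf t ^ d * m.real {k : sK a b |
              (sAct (sDiag Sf d t * k.1) w).1 ∈ N ∧
                ∀ p, (sAct (sDiag Sf d t * k.1) w).2 p ∈ N' p} := by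
    have h1 := measureReal_sK_prod a b m μ μp
      {k | (realDiag d t.1).1.mulVec (k.1.mulVec w.1) ∈ N}
      (fun p => {k | (padicDiag p d (t.2 p)).1.mulVec (k.1.mulVec (w.2 p)) ∈ N' p})
    have h2 : {k : sK a b | (sAct (sDiag Sf d t * k.1) w).1 ∈ N ∧
                ∀ p, (sAct (sDiag Sf d t * k.1) w).2 p ∈ N' p}
        = {k : sK a b | k.1.1 ∈ {k : Matrix.SpecialLinearGroup (Fin (d + 2)) ℝ |
            (realDiag d t.1).1.mulVec (k.1.mulVec w.1) ∈ N} ∧ ∀ p : Sf, k.1.2 p ∈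
            {k : Matrix.SpecialLinearGroup (Fin (d + 2)) ℚ_[(p : ℕ)] |
              (padicDiag p d (t.2 p)).1.mulVec (k.1.mulVec (w.2 p)) ∈ N' p}} := by
      ext k
      simp only [Set.mem_ofPred_eq, sAct_mul]
      rfl
    rw [h2, h1, Fintype.prod_option]
    simp only [hR, Option.elim, sVol, Finset.prod_mul_distrib, Finset.prod_pow, mul_pow]
    rw [hS, hSp]
    simp only [Set.mem_ofPred_eq]
    ring
  rw [hprodA, hprodB, hprodR] at hmain
  refine hmain.trans (mul_le_mul_of_nonneg_right hδε.le ?_)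
  rw [← hprodR]
  exact Finset.prod_nonneg fun o _ => hR0 o

end SAsymptotic

/-! ### The lattice `ℤ_S^n` -/

section Lattice

variable {Sf : Finset ℕ} [hS : ∀ p : Sf, Fact (p : ℕ).Prime]

/-- A prime dividing the denominator does not divide the numerator, so the norm at that prime would
exceed one. -/
theorem Rat.den_eq_one_of_padicNorm_le_one {y : ℚ}
    (h : ∀ (q : ℕ) [Fact q.Prime], ‖(y : ℚ_[q])‖ ≤ 1) : y.den = 1 := by
  by_contra hne
  obtain ⟨q, hq, hqd⟩ := Nat.exists_prime_and_dvd hne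
  have : Fact q.Prime := ⟨hq⟩
  have hnum : ‖(y.num : ℚ_[q])‖ = 1 := by
    refine le_antisymm (Padic.norm_int_le_one _) (not_lt.1 fun hlt => ?_)
    rw [Padic.norm_intCast_lt_one_iff] at hlt
    have h1 := Nat.dvd_gcd (Int.natCast_dvd.1 hlt) hqd
    rw [y.reduced] at h1
    exact hq.one_lt.ne' (Nat.dvd_one.1 h1)
  have hden : ‖(y.den : ℚ_[q])‖ < 1 := by
    have := (Padic.norm_intCast_lt_one_iff (p := q) (k := (y.den : ℤ))).2
      (Int.natCast_dvd_natCast.2 hqd)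
    simpa using this
  have hmul : (y : ℚ_[q]) * (y.den : ℚ_[q]) = (y.num : ℚ_[q]) := by
    exact_mod_cast congrArg (fun x : ℚ => (x : ℚ_[q])) y.mul_den_eq_num
  have h2 : ‖(y : ℚ_[q])‖ * ‖(y.den : ℚ_[q])‖ = 1 := by rw [← norm_mul, hmul, hnum]
  have h3 := mul_le_mul_of_nonneg_right (h q) (norm_nonneg (y.den : ℚ_[q]))
  linarith

theorem norm_le_one_of_mem_zS {x : ℚ} (hx : x ∈ zS Sf) {q : ℕ} [hq : Fact q.Prime] (hqS : q ∉ Sf) :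
    ‖(x : ℚ_[q])‖ ≤ 1 := by
  obtain ⟨k, e, rfl⟩ := hx
  have h1 : ∀ p : Sf, ‖((p : ℕ) : ℚ_[q])‖ = 1 := by
    intro p
    refine (Padic.norm_natCast_eq_one_iff).2 ((Nat.coprime_primes hq.out (hS p).out).2 ?_)
    rintro rfl
    exact hqS p.2
  push_cast
  rw [norm_mul, norm_prod]
  simp only [norm_zpow, h1, one_zpow, Finset.prod_const_one, mul_one]
  exact Padic.norm_int_le_one k

/-- The bounds at the primes of `S` bound the denominator, so a fixed multiple of `x` is an integer,
and the real bound leaves finitely many. -/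
theorem finite_zS_bounded (Sf : Finset ℕ) [hS : ∀ p : Sf, Fact (p : ℕ).Prime] (R : ℝ) :
    {x : ℚ | x ∈ zS Sf ∧ |(x : ℝ)| ≤ R ∧ ∀ p : Sf, ‖(x : ℚ_[(p : ℕ)])‖ ≤ R}.Finite := by
  -- `R < 2 ^ E ≤ p ^ E` for all `p` at once, so `L = ∏ p ^ E` clears every denominator.
  obtain ⟨E, hE⟩ := pow_unbounded_of_one_lt R one_lt_two
  set L : ℕ := ∏ p : Sf, (p : ℕ) ^ E with hL
  have hL0 : 0 < L := Finset.prod_pos fun p _ => pow_pos (hS p).out.pos _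
  have hLR : (0 : ℝ) < L := Nat.cast_pos.2 hL0
  refine ((Set.finite_Icc (-⌈R * L⌉) ⌈R * L⌉).image fun k : ℤ => (k : ℚ) / L).subset ?_
  rintro x ⟨hx, hxR, hxp⟩
  have hden : (x * L).den = 1 := by
    refine Rat.den_eq_one_of_padicNorm_le_one fun q hq => ?_
    have hLq : ‖(L : ℚ_[q])‖ ≤ 1 := by simpa using Padic.norm_int_le_one (p := q) (L : ℤ)
    push_cast
    rw [norm_mul]
    by_cases hqS : q ∈ Sf
    · have hq1 : (0 : ℝ) < q := Nat.cast_pos.2 hq.out.pos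
      have hdvd : q ^ E ∣ L := Finset.dvd_prod_of_mem (fun p : Sf => (p : ℕ) ^ E)
        (Finset.mem_univ (⟨q, hqS⟩ : Sf))
      have h1 : ‖(L : ℚ_[q])‖ ≤ ((q : ℝ) ^ E)⁻¹ := by
        obtain ⟨c, hc⟩ := hdvd
        rw [hc]
        push_cast
        rw [norm_mul, norm_pow, Padic.norm_p, inv_pow]
        refine mul_le_of_le_one_right (by positivity) ?_
        simpa using Padic.norm_int_le_one (p := q) (c : ℤ)
      have h2 : ‖(x : ℚ_[q])‖ ≤ (q : ℝ) ^ E := by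
        refine ((hxp ⟨q, hqS⟩).trans hE.le).trans ?_
        exact pow_le_pow_left₀ zero_le_two (by exact_mod_cast hq.out.two_le) E
      calc _ ≤ (q : ℝ) ^ E * ((q : ℝ) ^ E)⁻¹ :=
            mul_le_mul h2 h1 (norm_nonneg _) (by positivity)
        _ = 1 := mul_inv_cancel₀ (by positivity)
    · exact mul_le_one₀ (norm_le_one_of_mem_zS hx hqS) (norm_nonneg _) hLq
  have hint : x * L = ((x * L).num : ℚ) := ((Rat.den_eq_one_iff _).1 hden).symm
  refine ⟨(x * L).num, ?_, ?_⟩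
  · have h1 : |(((x * L).num : ℤ) : ℝ)| ≤ R * L := by
      have h2 : (((x * L).num : ℤ) : ℝ) = (x : ℝ) * L := by
        exact_mod_cast congrArg (fun y : ℚ => (y : ℝ)) hint.symm
      rw [h2, abs_mul, abs_of_pos hLR]
      exact mul_le_mul_of_nonneg_right hxR hLR.le
    have h3 : |(x * L).num| ≤ ⌈R * L⌉ := by
      have : ((|(x * L).num| : ℤ) : ℝ) ≤ (⌈R * L⌉ : ℝ) := by
        push_cast
        exact h1.trans (Int.le_ceil _)
      exact_mod_cast this
    exact abs_le.1 h3
  · have : (L : ℚ) ≠ 0 := by exact_mod_cast hL0.ne'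
    change (((x * L).num : ℤ) : ℚ) / L = x
    rw [← hint]
    field_simp

/-- The lattice `ℤ_S^n` meets a compact set in finitely many points. -/
theorem finite_sEmb_mem {n : ℕ} {Ω : Set (SSpace Sf n)} (hΩ : IsCompact Ω) :
    {v : SLattice Sf n | sEmb v ∈ Ω}.Finite := by
  obtain ⟨R, hR⟩ := hΩ.isBounded.exists_norm_le
  have h := finite_zS_bounded Sf R
  have h2 : ({x : zS Sf | (x : ℚ) ∈
      {x : ℚ | x ∈ zS Sf ∧ |(x : ℝ)| ≤ R ∧ ∀ p : Sf, ‖(x : ℚ_[(p : ℕ)])‖ ≤ R}}).Finite :=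
    h.preimage Subtype.val_injective.injOn
  refine (Set.Finite.pi' fun _ : Fin n => h2).subset fun v hv i => ⟨(v i).2, ?_, fun p => ?_⟩
  · exact ((norm_le_pi_norm (sEmb v).1 i).trans (norm_fst_le _)).trans (hR _ hv)
  · exact (((norm_le_pi_norm ((sEmb v).2 p) i).trans (norm_le_pi_norm (sEmb v).2 p)).trans
      (norm_snd_le _)).trans (hR _ hv)

theorem continuous_sAct {n : ℕ} {X : Type*} [TopologicalSpace X] {h : X → SGroup Sf n}
    {v : X → SSpace Sf n} (hh : Continuous h) (hv : Continuous v) :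
    Continuous fun x => sAct (h x) (v x) := by
  refine Continuous.prodMk ?_ (continuous_pi fun p => ?_)
  · exact continuous_SL_mulVec (continuous_fst.comp hh) (continuous_fst.comp hv)
  · exact continuous_SL_mulVec ((continuous_apply p).comp (continuous_snd.comp hh))
      ((continuous_apply p).comp (continuous_snd.comp hv))

variable {d : ℕ}

/-- The preimages of `Ω` under all `D k g` lie in the image of the compact set `K × Ω`, and that
image contains only finitely many lattice points. -/
theorem exists_finset_sAct_notMem (a : Fin d → ℝ) (b : ∀ p : Sf, Fin d → ℚ_[(p : ℕ)])
    (D g : SGroup Sf (d + 2)) {Ω : Set (SSpace Sf (d + 2))} (hΩ : IsCompact Ω) :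
    ∃ F : Finset (SLattice Sf (d + 2)), ∀ v ∉ F, ∀ k : sK a b,
      sAct (D * k.1 * g) (sEmb v) ∉ Ω := by
  have hc : Continuous fun x : sK a b × SSpace Sf (d + 2) => sAct (D * x.1.1 * g)⁻¹ x.2 :=
    continuous_sAct (((continuous_const.mul (continuous_subtype_val.comp continuous_fst)).mul
      continuous_const).inv) continuous_snd
  have hK := (isCompact_univ (X := sK a b)).prod hΩ
  have hfin := finite_sEmb_mem (hK.image hc)
  refine ⟨hfin.toFinset, fun v hv k hk => hv ?_⟩
  rw [Set.Finite.mem_toFinset]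
  refine ⟨(k, sAct (D * k.1 * g) (sEmb v)), ⟨Set.mem_univ _, hk⟩, ?_⟩
  dsimp only
  rw [← sAct_mul, inv_mul_cancel, sAct_one]

/-- `g` is invertible and `ℚ` embeds in every completion, so a non-zero lattice vector is non-zero
at every place. -/
theorem sAct_ne_zero {n : ℕ} (g : SGroup Sf n) {v : SLattice Sf n} (hv : ∃ i, (v i : ℚ) ≠ 0) :
    (sAct g (sEmb v)).1 ≠ 0 ∧ ∀ p, (sAct g (sEmb v)).2 p ≠ 0 := by
  obtain ⟨i, hi⟩ := hv
  refine ⟨fun h => hi ?_, fun p h => hi ?_⟩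
  · have h1 := congrFun (Matrix.eq_zero_of_mulVec_eq_zero
      (by rw [g.1.2]; exact one_ne_zero) h) i
    have h2 : ((v i : ℚ) : ℝ) = 0 := h1
    exact_mod_cast h2
  · have h1 := congrFun (Matrix.eq_zero_of_mulVec_eq_zero
      (by rw [(g.2 p).2]; exact one_ne_zero) h) i
    have h2 : ((v i : ℚ) : ℚ_[(p : ℕ)]) = 0 := h1
    exact_mod_cast h2

theorem sAct_fst_eq_zero {n : ℕ} (g : SGroup Sf n) {v : SLattice Sf n}
    (hv : ¬ ∃ i, (v i : ℚ) ≠ 0) : (sAct g (sEmb v)).1 = 0 := by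
  push Not at hv
  have h1 : (sEmb v : SSpace Sf n).1 = 0 := funext fun i => by
    change ((v i : ℚ) : ℝ) = 0
    rw [hv i, Rat.cast_zero]
  change g.1.1.mulVec (sEmb v : SSpace Sf n).1 = 0
  rw [h1, Matrix.mulVec_zero]

/-- The closure of a product of sets is the product of their closures. -/
theorem mem_tsupport_sProd {n : ℕ} {f : (Fin n → ℝ) → ℝ}
    {φ : ∀ p : Sf, (Fin n → ℚ_[(p : ℕ)]) → ℝ} {x : SSpace Sf n} (h1 : x.1 ∈ tsupport f)
    (h2 : ∀ p, x.2 p ∈ tsupport (φ p)) : x ∈ tsupport (sProd f φ) := by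
  have h3 : Function.support f ×ˢ Set.univ.pi (fun p : Sf => Function.support (φ p))
      ⊆ Function.support (sProd f φ) := fun y hy =>
    mul_ne_zero hy.1 (Finset.prod_ne_zero_iff.2 fun p _ => hy.2 p (Set.mem_univ p))
  refine closure_mono h3 ?_
  rw [closure_prod_eq, closure_pi_set]
  exact ⟨h1, fun p _ => h2 p⟩

/-- A neighbourhood of a compact box contains an open box around it. -/
theorem exists_open_box {n : ℕ} {C : Set (Fin n → ℝ)} {C' : ∀ p : Sf, Set (Fin n → ℚ_[(p : ℕ)])}
    (hC : IsCompact C) (hC' : ∀ p, IsCompact (C' p)) {W : Set (SSpace Sf n)} (hW : IsOpen W)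
    (hsub : C ×ˢ Set.univ.pi C' ⊆ W) :
    ∃ (N : Set (Fin n → ℝ)) (N' : ∀ p : Sf, Set (Fin n → ℚ_[(p : ℕ)])), IsOpen N ∧
      (∀ p, IsOpen (N' p)) ∧ C ⊆ N ∧ (∀ p, C' p ⊆ N' p) ∧ N ×ˢ Set.univ.pi N' ⊆ W := by
  obtain ⟨ρ, hρ, hρW⟩ := (hC.prod (isCompact_univ_pi hC')).exists_thickening_subset_open hW hsub
  refine ⟨Metric.thickening ρ C, fun p => Metric.thickening ρ (C' p), Metric.isOpen_thickening,
    fun p => Metric.isOpen_thickening, Metric.self_subset_thickening hρ _,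
    fun p => Metric.self_subset_thickening hρ _, fun x hx => hρW ?_⟩
  obtain ⟨y, hy, hxy⟩ := Metric.mem_thickening_iff.1 hx.1
  choose z hz hxz using fun p => Metric.mem_thickening_iff.1 (hx.2 p (Set.mem_univ p))
  refine Metric.mem_thickening_iff.2 ⟨(y, z), ⟨hy, fun p _ => hz p⟩, ?_⟩
  exact max_lt hxy ((dist_pi_lt_iff hρ).2 hxz)

theorem sVol_pos (t : ℝ × (Sf → ℤ)) : 0 < sVol Sf t :=
  mul_pos (Real.exp_pos _) (Finset.prod_pos fun p _ => zpow_pos (Nat.cast_pos.2 (hS p).out.pos) _)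

theorem exists_haar_probability (G : Type*) [Group G] [TopologicalSpace G] [IsTopologicalGroup G]
    [CompactSpace G] [MeasurableSpace G] [BorelSpace G] :
    ∃ μ : Measure G, μ.IsHaarMeasure ∧ IsProbabilityMeasure μ :=
  ⟨Measure.haarMeasure ⊤, inferInstance, ⟨Measure.haarMeasure_self (K₀ := ⊤)⟩⟩

end Lattice

/-! ### Summation over the lattice -/

theorem mainTheorem4
    -- the finite places, the rank `n = d + 2`, and the standard form `q⁰_S` with coefficients `a, b`
    (Sf : Finset ℕ) [∀ p : Sf, Fact (p : ℕ).Prime] (hodd : 2 ∉ Sf)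
    (d : ℕ) (hd : d = 1 ∨ d = 2)
    (u₀ : Sf → ℤ) (hu₀ : ∀ p : Sf, ¬ IsSquare ((u₀ p : ℤ) : ZMod (p : ℕ)))
    (a : Fin d → ℝ) (ha : ∀ i, a i = 1 ∨ a i = -1)
    (b : ∀ p : Sf, Fin d → ℚ_[(p : ℕ)])
    (hb : ∀ (p : Sf) (i : Fin d), IsStdPadicCoeff (p : ℕ) (u₀ p) (b p i))
    (hsplit : ∀ (p : Sf) (i j : Fin d), i ≠ j → IsSquare (-(b p i * b p j)) →
      ¬ (‖b p i‖ < 1 ∧ ‖b p j‖ < 1))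
    -- the normalized Haar measure on `K`
    [MeasurableSpace (sK a b)] [BorelSpace (sK a b)]
    (m : Measure (sK a b)) [m.IsHaarMeasure] [IsProbabilityMeasure m] :
    ∃ c : ℝ, 0 < c ∧
      ∀ (g : SGroup Sf (d + 2))
        -- the form `q_S = q⁰_S ∘ g`
        (q : QuadraticForm ℝ (Fin (d + 2) → ℝ))
        (Q : ∀ p : Sf, QuadraticForm ℚ_[(p : ℕ)] (Fin (d + 2) → ℚ_[(p : ℕ)]))
        (_ : ∀ x, q x = stdForm a (g.1.1.mulVec x))
        (_ : ∀ (p : Sf) (x : Fin (d + 2) → ℚ_[(p : ℕ)]),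
          Q p x = stdForm (b p) ((g.2 p).1.mulVec x))
        -- the function `f = ∏ f_p`
        (f : (Fin (d + 2) → ℝ) → ℝ) (φ : ∀ p : Sf, (Fin (d + 2) → ℚ_[(p : ℕ)]) → ℝ)
        (_ : Continuous f) (_ : HasCompactSupport f) (_ : tsupport f ⊆ {x | 0 < x 0})
        (_ : ∀ p, Continuous (φ p)) (_ : ∀ p, HasCompactSupport (φ p))
        (_ : ∀ p, tsupport (φ p) ⊆ {x | x 0 ≠ 0})
        (_ : ∀ (p : Sf) (u : ℚ_[(p : ℕ)]) (hu : u ≠ 0), ‖u‖ = 1 →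
          ∀ x, φ p ((diagSL d u hu).1.mulVec x) = φ p x)
        -- the function `ν = ∏ ν_p` on the unit spheres
        (ν : (Fin (d + 2) → ℝ) → ℝ) (η : ∀ p : Sf, (Fin (d + 2) → ℚ_[(p : ℕ)]) → ℝ)
        (_ : ContinuousOn ν {x | euclNorm x = 1}) (_ : ∀ x, euclNorm x = 1 → 0 ≤ ν x)
        (_ : ∀ p, ContinuousOn (η p) {x | ‖x‖ = 1}) (_ : ∀ p x, ‖x‖ = 1 → 0 ≤ η p x)
        (_ : ∀ (p : Sf) (u : ℚ_[(p : ℕ)]), ‖u‖ = 1 → ∀ x, ‖x‖ = 1 → η p (u • x) = η p x)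
        -- the dominating function `f⁺`
        (fplus : SSpace Sf (d + 2) → ℝ)
        (_ : Continuous fplus) (_ : HasCompactSupport fplus) (_ : ∀ x, 0 ≤ fplus x)
        (_ : tsupport (sProd f φ) ⊆ {x | 0 < fplus x})
        (_ : ∃ M : ℝ, ∀ t : ℝ × (Sf → ℤ), 0 < t.1 → (∀ p, 0 < t.2 p) →
          ∫ k : sK a b, siegel fplus (sDiag Sf d t * k.1 * g) ∂m ≤ M)
        (ε : ℝ) (_ : 0 < ε),
        ∃ t₀ : ℝ × (Sf → ℤ), 0 < t₀.1 ∧ (∀ p, 0 < t₀.2 p) ∧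
          ∀ t : ℝ × (Sf → ℤ), t₀.1 < t.1 → (∀ p, t₀.2 p < t.2 p) →
            Summable (fun v : SLattice Sf (d + 2) =>
              sJ a b f φ t (sAct g (sEmb v)) (q (sEmb v : SSpace Sf (d + 2)).1,
                  fun p => Q p ((sEmb v : SSpace Sf (d + 2)).2 p)) *
                sProd ν η (sUnit (sAct g (sEmb v)))) ∧
            Integrable (fun k : sK a b =>
              siegel (sProd f φ) (sDiag Sf d t * k.1 * g) *
                sProd ν η (sAct k.1⁻¹ (sE1 Sf d))) m ∧
            |(1 / sVol Sf t ^ d) * ∑' v : SLattice Sf (d + 2),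
                sJ a b f φ t (sAct g (sEmb v)) (q (sEmb v : SSpace Sf (d + 2)).1,
                    fun p => Q p ((sEmb v : SSpace Sf (d + 2)).2 p)) *
                  sProd ν η (sUnit (sAct g (sEmb v)))
              - c * ∫ k : sK a b,
                  siegel (sProd f φ) (sDiag Sf d t * k.1 * g) *
                    sProd ν η (sAct k.1⁻¹ (sE1 Sf d)) ∂m| ≤ ε := by
  have hd0 : 0 < d := by omega
  let _ : MeasurableSpace (realK a) := borel _
  have _ : BorelSpace (realK a) := ⟨rfl⟩
  let _ : ∀ p : Sf, MeasurableSpace (padicK (p : ℕ) (b p)) := fun p => borel _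
  have _ : ∀ p : Sf, BorelSpace (padicK (p : ℕ) (b p)) := fun p => ⟨rfl⟩
  obtain ⟨μ, hμ, hμ1⟩ := exists_haar_probability (realK a)
  choose μp hμp hμp1 using fun p : Sf => exists_haar_probability (padicK (p : ℕ) (b p))
  obtain ⟨c, hc, hlocal⟩ := exists_S_local_asymptotic a b m μ μp
    (fun p h => hodd (h ▸ p.2)) hd ha (fun p i => norm_of_isStdPadicCoeff (hu₀ p) (hb p i)) hsplit
  refine ⟨c, hc, ?_⟩
  intro g q Q hq hQ f φ hf hfc hfs hφ hφc hφs hφu ν η hν _ hη _ hηu fplus hF hFc hF0 hFs hM ε hε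
  obtain ⟨M, hM⟩ := hM
  -- boxes on which the dominating function is bounded from below
  have hbox : tsupport f ×ˢ Set.univ.pi (fun p => tsupport (φ p)) ⊆ {x | 0 < fplus x} :=
    fun x hx => hFs (mem_tsupport_sProd hx.1 fun p => hx.2 p (Set.mem_univ p))
  have hboxc : IsCompact (tsupport f ×ˢ Set.univ.pi (fun p => tsupport (φ p))) :=
    hfc.isCompact.prod (isCompact_univ_pi fun p => (hφc p).isCompact)
  obtain ⟨κ, hκ, hκle⟩ := hboxc.exists_forall_le' (f := fplus) (a := 0) hF.continuousOn hbox
  -- By compactness `f⁺ ≥ κ` on the product of the supports, so `f⁺ > κ / 2` on an open box around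
  -- it.
  obtain ⟨N, N', hN, hN', hfN, hφN, hNW⟩ := exists_open_box hfc.isCompact
    (fun p => (hφc p).isCompact) (isOpen_lt continuous_const hF : IsOpen {x | κ / 2 < fplus x})
    (fun x hx => (half_lt_self hκ).trans_le (hκle x hx))
  have hM0 : 0 < |M| + 1 := by positivity
  -- The factor `κ / 2` is lost in Markov's inequality, and `|M| + 1` dominates the sum of the
  -- integrals of `f⁺` while being positive.
  obtain ⟨t₀, ht₀, ht₀p, hasymp⟩ := hlocal f φ hf hfc hfs hφ hφc hφs hφu ν η hν hη hηu N N' hN hN'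
    hfN hφN (ε * (κ / 2) / (|M| + 1)) (by positivity)
  refine ⟨t₀, ht₀, ht₀p, fun t ht htp => ?_⟩
  have hvol := sVol_pos t
  have hf0 : f 0 = 0 := by
    by_contra hne
    have h1 : (0 : ℝ) < (0 : Fin (d + 2) → ℝ) 0 := hfs (subset_tsupport f hne)
    exact lt_irrefl _ h1
  -- For this `t`, both Siegel transforms are sums over the same finite set `F`, uniformly in `k`.
  obtain ⟨F, hFfin⟩ := exists_finset_sAct_notMem a b (sDiag Sf d t) g hFc.isCompact
  have hcomp : ∀ (v : SLattice Sf (d + 2)) (k : sK a b),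
      sAct (sDiag Sf d t * k.1) (sAct g (sEmb v)) = sAct (sDiag Sf d t * k.1 * g) (sEmb v) :=
    fun v k => (sAct_mul _ _ _).symm
  have hFz : ∀ v ∉ F, ∀ k : sK a b, fplus (sAct (sDiag Sf d t * k.1 * g) (sEmb v)) = 0 :=
    fun v hv k => image_eq_zero_of_notMem_tsupport (hFfin v hv k)
  have hfz : ∀ v ∉ F, ∀ k : sK a b, sProd f φ (sAct (sDiag Sf d t * k.1 * g) (sEmb v)) = 0 := by
    intro v hv k
    by_contra hne
    have h1 : 0 < fplus (sAct (sDiag Sf d t * k.1 * g) (sEmb v)) := hFs (subset_tsupport _ hne)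
    exact h1.ne' (hFz v hv k)
  -- continuity
  have hcact : ∀ v : SLattice Sf (d + 2), Continuous fun k : sK a b =>
      sAct (sDiag Sf d t * k.1 * g) (sEmb v) := fun v =>
    continuous_sAct ((continuous_const.mul continuous_subtype_val).mul continuous_const)
      continuous_const
  have hfφ : Continuous (sProd f φ) :=
    (hf.comp continuous_fst).mul (continuous_finsetProd _ fun p _ =>
      (hφ p).comp ((continuous_apply p).comp continuous_snd))
  have hcν : Continuous fun k : sK a b => sProd ν η (sAct k.1⁻¹ (sE1 Sf d)) := by
    have h1 : Continuous fun k : sK a b => sAct k.1⁻¹ (sE1 Sf d) :=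
      continuous_sAct continuous_subtype_val.inv continuous_const
    refine Continuous.mul ?_ (continuous_finsetProd _ fun p _ => ?_)
    · refine hν.comp_continuous (continuous_fst.comp h1) fun k => ?_
      have hk : IsFormOrthogonal a (k.1⁻¹).1.1 := (inv_mem k.2).1
      change euclNorm ((k.1⁻¹).1.1.mulVec (Pi.single 0 1)) = 1
      rw [euclNorm_eq_one_iff, hk.dotProduct_mulVec]
      simp
    · refine (hη p).comp_continuous ((continuous_apply p).comp (continuous_snd.comp h1)) fun k => ?_
      change ‖(((k.1⁻¹).2 p).1.mulVec (Pi.single 0 1) : Fin (d + 2) → ℚ_[(p : ℕ)])‖ = 1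
      rw [norm_padicK_mulVec ((inv_mem k.2).2 p (Set.mem_univ p)), Pi.norm_single]
      simp
  have hiF : ∀ v : SLattice Sf (d + 2), Integrable (fun k : sK a b =>
      fplus (sAct (sDiag Sf d t * k.1 * g) (sEmb v))) m := fun v =>
    (hF.comp (hcact v)).integrable_of_hasCompactSupport (HasCompactSupport.of_compactSpace _)
  have hif : ∀ v : SLattice Sf (d + 2), Integrable (fun k : sK a b =>
      sProd f φ (sAct (sDiag Sf d t * k.1 * g) (sEmb v)) *
        sProd ν η (sAct k.1⁻¹ (sE1 Sf d))) m := fun v =>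
    ((hfφ.comp (hcact v)).mul hcν).integrable_of_hasCompactSupport
      (HasCompactSupport.of_compactSpace _)
  -- the estimate for each lattice vector
  set J : SLattice Sf (d + 2) → ℝ := fun v =>
    sJ a b f φ t (sAct g (sEmb v)) (q (sEmb v : SSpace Sf (d + 2)).1,
      fun p => Q p ((sEmb v : SSpace Sf (d + 2)).2 p)) * sProd ν η (sUnit (sAct g (sEmb v))) with hJ
  set I : SLattice Sf (d + 2) → ℝ := fun v => ∫ k : sK a b,
    sProd f φ (sAct (sDiag Sf d t * k.1 * g) (sEmb v)) * sProd ν η (sAct k.1⁻¹ (sE1 Sf d)) ∂m with hI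
  set P : SLattice Sf (d + 2) → ℝ := fun v => ∫ k : sK a b,
    fplus (sAct (sDiag Sf d t * k.1 * g) (sEmb v)) ∂m with hP
  have hP0 : ∀ v, 0 ≤ P v := fun v => integral_nonneg fun k => hF0 _
  have hest : ∀ v, |J v - c * (sVol Sf t ^ d * I v)|
      ≤ ε / (|M| + 1) * (sVol Sf t ^ d * P v) := by
    intro v
    have hrhs : 0 ≤ ε / (|M| + 1) * (sVol Sf t ^ d * P v) :=
      mul_nonneg (by positivity) (mul_nonneg (by positivity) (hP0 v))
    by_cases hv : ∃ i, (v i : ℚ) ≠ 0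
    · obtain ⟨hw, hwp⟩ := sAct_ne_zero g hv
      have h1 := hasymp t ht htp _ hw hwp
      simp only [hcomp] at h1
      have hζ : ((stdForm a (sAct g (sEmb v)).1, fun p => stdForm (b p) ((sAct g (sEmb v)).2 p)) :
          ℝ × ∀ p : Sf, ℚ_[(p : ℕ)]) = (q (sEmb v : SSpace Sf (d + 2)).1,
          fun p => Q p ((sEmb v : SSpace Sf (d + 2)).2 p)) :=
        Prod.ext (hq _).symm (funext fun p => (hQ p _).symm)
      rw [hζ] at h1
      refine h1.trans ?_
      -- Markov's inequality for `f⁺`, which exceeds `κ / 2` on the box.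
      have h2 : κ / 2 * m.real {k : sK a b | (sAct (sDiag Sf d t * k.1 * g) (sEmb v)).1 ∈ N ∧
          ∀ p, (sAct (sDiag Sf d t * k.1 * g) (sEmb v)).2 p ∈ N' p} ≤ P v := by
        refine le_trans ?_ (mul_meas_ge_le_integral_of_nonneg
          (Filter.Eventually.of_forall fun k => hF0 _) (hiF v) (κ / 2))
        refine mul_le_mul_of_nonneg_left (measureReal_mono fun k hk => ?_) (half_pos hκ).le
        have h3 : sAct (sDiag Sf d t * k.1 * g) (sEmb v) ∈ N ×ˢ Set.univ.pi N' :=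
          ⟨hk.1, fun p _ => hk.2 p⟩
        have h4 : κ / 2 < fplus (sAct (sDiag Sf d t * k.1 * g) (sEmb v)) := hNW h3
        exact h4.le
      calc _ = ε / (|M| + 1) * (sVol Sf t ^ d * (κ / 2 * m.real {k : sK a b |
            (sAct (sDiag Sf d t * k.1 * g) (sEmb v)).1 ∈ N ∧
              ∀ p, (sAct (sDiag Sf d t * k.1 * g) (sEmb v)).2 p ∈ N' p})) := by ring
        _ ≤ _ := by gcongr
    -- At `v = 0` the factor `1 / r ^ d` of `realJ` is `1 / 0 = 0` because `d > 0`, so this term is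
    -- `0` as the convention demands.
    · have hJ0 : J v = 0 := by
        have h1 : (sAct g (sEmb v)).1 = 0 := sAct_fst_eq_zero g hv
        have h2 : euclNorm (0 : Fin (d + 2) → ℝ) = 0 := by simp [euclNorm]
        simp [hJ, sJ, h1, h2, realJ, hd0.ne']
      have hI0 : I v = 0 := by
        have h1 : ∀ k : sK a b, sProd f φ (sAct (sDiag Sf d t * k.1 * g) (sEmb v)) = 0 := fun k => by
          rw [sProd, sAct_fst_eq_zero _ hv, hf0, zero_mul]
        simp [hI, h1]
      rw [hJ0, hI0, mul_zero, mul_zero, sub_zero, abs_zero]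
      exact hrhs
  -- The estimate itself gives the vanishing: off `F` both `I v` and the error bound are zero.
  have hJF : ∀ v ∉ F, J v = 0 := by
    intro v hv
    have h1 : I v = 0 := by simp [hI, hfz v hv]
    have h2 : P v = 0 := by simp [hP, hFz v hv]
    have h3 := hest v
    simp only [h1, h2, mul_zero, sub_zero] at h3
    exact abs_nonpos_iff.1 h3
  have hsieg : ∀ k : sK a b, siegel (sProd f φ) (sDiag Sf d t * k.1 * g) *
      sProd ν η (sAct k.1⁻¹ (sE1 Sf d)) = ∑ v ∈ F,
        sProd f φ (sAct (sDiag Sf d t * k.1 * g) (sEmb v)) *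
          sProd ν η (sAct k.1⁻¹ (sE1 Sf d)) := fun k => by
    rw [siegel, tsum_eq_sum fun v hv => hfz v hv k, Finset.sum_mul]
  have hsiegF : ∀ k : sK a b, siegel fplus (sDiag Sf d t * k.1 * g) = ∑ v ∈ F,
      fplus (sAct (sDiag Sf d t * k.1 * g) (sEmb v)) := fun k => by
    rw [siegel, tsum_eq_sum fun v hv => hFz v hv k]
  refine ⟨summable_of_ne_finset_zero hJF, ?_, ?_⟩
  · simp only [hsieg]
    exact integrable_finsetSum _ fun v _ => hif v
  · have hPM : ∑ v ∈ F, P v ≤ M := by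
      have h1 := hM t (ht₀.trans ht) fun p => (ht₀p p).trans (htp p)
      simp only [hsiegF] at h1
      rwa [integral_finsetSum _ fun v _ => hiF v] at h1
    rw [tsum_eq_sum hJF]
    simp only [hsieg]
    rw [integral_finsetSum _ fun v _ => hif v]
    have hVd : 0 < sVol Sf t ^ d := pow_pos hvol d
    have e : 1 / sVol Sf t ^ d * ∑ v ∈ F, J v - c * ∑ v ∈ F, I v
        = 1 / sVol Sf t ^ d * ∑ v ∈ F, (J v - c * (sVol Sf t ^ d * I v)) := by
      rw [Finset.sum_sub_distrib, ← Finset.mul_sum, ← Finset.mul_sum]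
      field_simp
    change |1 / sVol Sf t ^ d * ∑ v ∈ F, J v - c * ∑ v ∈ F, I v| ≤ ε
    rw [e, abs_mul, abs_of_pos (one_div_pos.2 hVd)]
    calc _ ≤ 1 / sVol Sf t ^ d * ∑ v ∈ F, ε / (|M| + 1) * (sVol Sf t ^ d * P v) := by
          gcongr
          exact (Finset.abs_sum_le_sum_abs _ _).trans (Finset.sum_le_sum fun v _ => hest v)
      _ = ε / (|M| + 1) * ∑ v ∈ F, P v := by
          rw [← Finset.mul_sum, ← Finset.mul_sum]
          field_simp
      _ ≤ ε / (|M| + 1) * (|M| + 1) := by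
          gcongr
          exact hPM.trans ((le_abs_self M).trans (le_add_of_nonneg_right zero_le_one))
      _ = ε := by field_simp
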